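/- **Setting.** Let $G$ be a compact (or finite) group with normalised Haar measure, and let $U_0,\dots,U_{D-1}$ be continuous unitary representations of $G$ on $n$ qudits of dimension $d$ and $W_0,\dots,W_{D-1}$ fixed unitaries. For $\boldsymbol g\in G^D$ put $C(\boldsymbol g)=U_0(g_0)W_0\cdots U_{D-1}(g_{D-1})W_{D-1}$ and $p(x,\boldsymbol g)=|\langle x|C(\boldsymbol g)|0\rangle|^2$. Fix at every position $j$ an orthonormal operator basis $T^{(j)}_{\lambda,\alpha,k}$ ($\lambda$ an irrep, $\alpha$ a multiplicity index, $k$ a component; $0\le j\le D$, position $D$ being the basis in which $W_{D-1}$ is expanded) with $U_j(g)T_{\lambda,\alpha,k}U_j(g)^\dagger=\sum_{k'}v^\lambda_{k'k}(g)T_{\lambda,\alpha,k'}$, where the $v^\lambda$ are irreducible, pairwise inequivalent unitary matrix representations; let $\Pi_0^{(j)}$ be the projector onto the span of the $T_{\lambda,\alpha,k}$ with $\lambda$ trivial. In the noisy circuit a quantum channel $\mathcal E_j$ acts after each $U_j(g_j)$, with $\mathcal E_j(T_{\lambda,\alpha,k})=e_{\lambda,k}T_{\lambda,\alpha,k}$;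 the output distribution is $\tilde p(x,\boldsymbol g)$. Expanding $C\otimes C^*$ in the bases writes $p$ and $\tilde p$ as sums over paths of basis operators; $p^{\mathcal T}$ and $\tilde p^{\mathcal T}$ are the sums over the paths in which at most $L$ of the irreps $\lambda_0,\dots,\lambda_{D-1}$ are non-trivial. **Assumptions.** (0) Every irrep on a truncated path with non-zero contribution has dimension at most $d_{\max}$. (1) For $i<j<D$ and any basis operator $T$ at position $j$: if $W_l\cdots W_{j-1}$ (acting by conjugation) maps $T$ into the range of $\Pi_0^{(l)}$ for all $i<l<j$, then it holds for the image $A$ of $T$ under $W_i\cdots W_{j-1}$ that $\Pi^{(i)}_0A\in\{0,A\}$; likewise in the adjoint direction. Moreover, for all $i<j\le D$, every row and every column of the matrix $\langle\langle T^{(i)}_b|\mathbf W_i\cdots\mathbf W_{j-1}|T^{(j)}_c\rangle\rangle$, $\mathbf W=W\otimes W^*$, has at most $s$ non-zero entries. (2) $0<\gamma\le 1$, $e_{\lambda,k}=1$ if $\lambda$ is trivial, and $|e_{\lambda,k}|\le 1-\gamma$ otherwise. (3) For some $M$ with $(M+2)(L+1)\le D$, each operator $\Pi_0\mathbf W_i\Pi_0\cdots\mathbf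 W_{i+M}\Pi_0$, $i+M+1<D$, has at most $\mathrm{rank}$ non-zero entries in the bases. (4) Given are subroutines, a call of each of which costs at most $\kappa$ steps: for the dimension and triviality of the irrep of a basis label, listing the labels of an irrep, matrix coefficients $v^\lambda_{kk'}(g_j)$ (dimension at most $d_{\max}$), noise eigenvalues, the non-zero entries of the rows and columns in (1) and of the operators in (3), and the marginals $\sum_{x_{m+1},\dots,x_n}\langle x|T|x\rangle$ of basis operators. (5) The depth $D$, the cost $\kappa$ and $\mathrm{rank}$ are at most $\mathrm{poly}(n)$, and $d=O(1)$. The computational model is a uniform program (first-order recursive functions on lists of natural numbers and exact complex numbers, unit cost per elementary operation) that calls the subroutines. **Statement.** There are two explicit, fixed programs with the following property. Let $0<\varepsilon\le\frac12$, let $K\ge1$ be a constant, let $\Gamma=\gamma$ or (if $\gamma<1$) $\Gamma=\log\frac1{1-\gamma}$, and let $L=\lceil \Gamma^{-1}\log(K/\varepsilon)\rceil$. Suppose that (0)–(5) hold and that the noiseless residual anti-concentrates, $\sum_x\int|p-p^{\mathcal T}|^2\,d\boldsymbol g\le K/d^n$. Then $$\sum_x\Big(\int|\tilde p-\tilde p^{\mathcal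 T}|^2\,d\boldsymbol g\Big)^{1/2}\le\varepsilon,\qquad \int\|\tilde p(\cdot,\boldsymbol g)-\tilde p^{\mathcal T}(\cdot,\boldsymbol g)\|_1^2\,d\boldsymbol g\le\varepsilon^2 ,$$ and there is a time bound $t$ such that, for every $\boldsymbol g$: the first program computes, in at most $t$ steps, any prescribed value $\sum_{x_{m+1},\dots,x_n}\tilde p^{\mathcal T}(x,\boldsymbol g)$, $0\le m\le n$; the second program, given $n$ independent uniform random reals in $[0,1]$, outputs in at most $t$ steps a sample from a distribution $q_{\boldsymbol g}$ with $\|\tilde p(\cdot,\boldsymbol g)-q_{\boldsymbol g}\|_1\le 2\|\tilde p(\cdot,\boldsymbol g)-\tilde p^{\mathcal T}(\cdot,\boldsymbol g)\|_1$; and for $n\ge3$ 1. $t\le \mathrm{poly}(n)\,\big(O(1)/\varepsilon\big)^{O(1/\Gamma)}$ if $s,d_{\max}=O(1)$; 2. $t\le \mathrm{poly}(n)\,n^{O(\log(1/\varepsilon)/\Gamma)}$ if $s\,d_{\max}=\mathrm{poly}(n)$; 3. $t\le \mathrm{poly}(n)\,(\log n)^{O(\log(1/\varepsilon)/\Gamma)}$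 if $s\,d_{\max}=O(\log n)$. The implied constants and the degrees of the polynomials depend only on $d$, $K$ and on the constants and degrees in the hypotheses, not on $n,\gamma,\varepsilon$ or the circuit. -/

import Mathlib

open scoped Matrix
open MeasureTheory

noncomputable section

namespace TruncSim

/- ===== Part I. The machine model: a first-order recursive language on trees whose atoms are
natural numbers and exact complex numbers, with a step count and charged subroutine calls. ===== -/

/-- Machine data: trees with natural and complex atoms. -/
inductive Val where
  | nat (k : ℕ)
  | num (z : ℂ)
  | nil
  | cons (a b : Val)

/-- Lists of data, as right-nested trees. -/
def Val.ofList : List Val → Val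
  | [] => .nil
  | v :: l => .cons v (Val.ofList l)

/-- Unary elementary operations. -/
inductive Op1 where
  | fst | snd | isCons | toNum | conj | neg | inv

/-- Binary elementary operations. There is no multiplication of naturals, and no passage from
complex numbers to naturals other than the outcome of a comparison. -/
inductive Op2 where
  | cons | natAdd | natSub | natEq | natLt | add | mul | ltRe

/-- Meaning of the unary operations; ill-typed applications give `nil`. -/
def Op1.run : Op1 → Val → Val
  | .fst, .cons a _ => a
  | .snd, .cons _ b => b
  | .isCons, .cons _ _ => .nat 1
  | .isCons, _ => .nat 0
  | .toNum, .nat k => .num k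
  | .conj, .num z => .num (starRingEnd ℂ z)
  | .neg, .num z => .num (-z)
  | .inv, .num z => .num z⁻¹
  | _, _ => .nil

open Classical in
/-- Meaning of the binary operations; ill-typed applications give `nil`. -/
def Op2.run : Op2 → Val → Val → Val
  | .cons, a, b => .cons a b
  | .natAdd, .nat j, .nat k => .nat (j + k)
  | .natSub, .nat j, .nat k => .nat (j - k)
  | .natEq, .nat j, .nat k => .nat (if j = k then 1 else 0)
  | .natLt, .nat j, .nat k => .nat (if j < k then 1 else 0)
  | .add, .num y, .num z => .num (y + z)
  | .mul, .num y, .num z => .num (y * z)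
  | .ltRe, .num y, .num z => .nat (if y.re < z.re then 1 else 0)
  | _, _, _ => .nil

/-- Names of the subroutines a program may call. -/
inductive Subroutine where
  | info | expand | coeff | eigen | contractBra | contractKet | contractFull | marginal | rand

/-- Program expressions; variables are de Bruijn indices. -/
inductive Code where
  | var (i : ℕ)
  | lit (k : ℕ)
  | nil
  | op1 (o : Op1) (e : Code)
  | op2 (o : Op2) (e₁ e₂ : Code)
  | letIn (e b : Code)
  | ite (c a b : Code)
  | call (f : ℕ) (e : Code)
  | ask (q : Subroutine) (e : Code)

/-- A program is a finite list of (mutually recursive) one-argument functions, given by their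
bodies; function number `0` is the main one. -/
abbrev Program := List Code

/-- `Eval P O κ env e v t`: with the functions of `P` and the subroutines `O`, in the environment
`env`, the expression `e` evaluates to `v` in `t` steps. Every elementary step costs `1` and every
call of a subroutine costs `κ` in addition. -/
inductive Eval (P : Program) (O : Subroutine → Val → Val) (κ : ℕ) :
    List Val → Code → Val → ℕ → Prop where
  | var {env : List Val} {i : ℕ} {v : Val} (h : env[i]? = some v) :
      Eval P O κ env (.var i) v 1
  | lit {env : List Val} {k : ℕ} : Eval P O κ env (.lit k) (.nat k) 1
  | nil {env : List Val} : Eval P O κ env .nil .nil 1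
  | op1 {env : List Val} {o : Op1} {e : Code} {v w : Val} {t : ℕ} (h : Eval P O κ env e v t)
      (hw : o.run v = w) : Eval P O κ env (.op1 o e) w (t + 1)
  | op2 {env : List Val} {o : Op2} {e₁ e₂ : Code} {v₁ v₂ w : Val} {t₁ t₂ : ℕ}
      (h₁ : Eval P O κ env e₁ v₁ t₁) (h₂ : Eval P O κ env e₂ v₂ t₂) (hw : o.run v₁ v₂ = w) :
      Eval P O κ env (.op2 o e₁ e₂) w (t₁ + t₂ + 1)
  | letIn {env : List Val} {e b : Code} {v w : Val} {t₁ t₂ : ℕ}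
      (h₁ : Eval P O κ env e v t₁) (h₂ : Eval P O κ (v :: env) b w t₂) :
      Eval P O κ env (.letIn e b) w (t₁ + t₂ + 1)
  | iteTrue {env : List Val} {c a b : Code} {v w : Val} {t₁ t₂ : ℕ}
      (h₁ : Eval P O κ env c v t₁) (hv : v ≠ .nat 0) (h₂ : Eval P O κ env a w t₂) :
      Eval P O κ env (.ite c a b) w (t₁ + t₂ + 1)
  | iteFalse {env : List Val} {c a b : Code} {w : Val} {t₁ t₂ : ℕ}
      (h₁ : Eval P O κ env c (.nat 0) t₁) (h₂ : Eval P O κ env b w t₂) :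
      Eval P O κ env (.ite c a b) w (t₁ + t₂ + 1)
  | call {env : List Val} {f : ℕ} {e b : Code} {v w : Val} {t₁ t₂ : ℕ}
      (h₁ : Eval P O κ env e v t₁) (hf : P[f]? = some b) (h₂ : Eval P O κ [v] b w t₂) :
      Eval P O κ env (.call f e) w (t₁ + t₂ + 1)
  | ask {env : List Val} {q : Subroutine} {e : Code} {v w : Val} {t : ℕ}
      (h : Eval P O κ env e v t) (hw : O q v = w) : Eval P O κ env (.ask q e) w (t + κ + 1)

/-- The program `P` halts on `input` with result `v` after at most `t` steps. -/
def RunsWithin (P : Program) (O : Subroutine → Val → Val) (κ : ℕ) (input v : Val) (t : ℕ) : Prop :=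
  ∃ t' ≤ t, Eval P O κ [input] (.call 0 (.var 0)) v t'

/-- The subroutines `O`, with the subroutine `rand` reading the random reals `u`. -/
def withRand {n : ℕ} (O : Subroutine → Val → Val) (u : Fin n → ℝ) : Subroutine → Val → Val
  | .rand, .nat i => if h : i < n then .num (u ⟨i, h⟩ : ℝ) else .nil
  | q, v => O q v

/- ===== Part II. Circuits, irreducible tensor operators, paths. ===== -/

/-- Measurement outcomes of `n` qudits, i.e. labels of the computational basis. -/
abbrev Outcome (n d : ℕ) := Fin n → Fin d

/-- Operators on `n` qudits. -/
abbrev Oper (n d : ℕ) := Matrix (Outcome n d) (Outcome n d) ℂ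

/-- Unitaries on `n` qudits. -/
abbrev QUnitary (n d : ℕ) := Matrix.unitaryGroup (Outcome n d) ℂ

/-- Hilbert-Schmidt inner product `⟨⟨A|B⟩⟩`. -/
def hs {n d : ℕ} (A B : Oper n d) : ℂ := (Aᴴ * B).trace

/-- The unitary channel `A ↦ u A u†`, that is, the Liouville matrix `u ⊗ u*`. -/
def ad {n d : ℕ} (u : QUnitary n d) (A : Oper n d) : Oper n d := (u : Oper n d) * A * (u : Oper n d)ᴴ

/-- Machine encoding of the first `m` entries of an outcome. -/
def prefixVal {n d : ℕ} (x : Outcome n d) (m : ℕ) : Val :=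
  Val.ofList (((List.ofFn x).take m).map fun a => .nat (a : ℕ))

/-- Marginal of a function of the outcome at the first `m` entries of `x`. -/
def prefixMarginal {n d : ℕ} (f : Outcome n d → ℂ) (x : Outcome n d) (m : ℕ) : ℂ :=
  ∑ z : Outcome n d with (∀ i : Fin n, (i : ℕ) < m → z i = x i), f z

/-- Quantum channels (completely positive trace-preserving maps), by Kraus operators. -/
def IsChannel {n d : ℕ} (E : Oper n d →ₗ[ℂ] Oper n d) : Prop :=
  ∃ (r : ℕ) (K : Fin r → Oper n d),
    (∑ a, (K a)ᴴ * K a = 1) ∧ ∀ A, E A = ∑ a, K a * A * (K a)ᴴ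

/-- A symmetry-adapted orthonormal operator basis (irreducible tensor operators) for a unitary
representation `U`: pairwise inequivalent irreducible unitary matrix representations `V l`, with
multiplicities, and operators `T ⟨l, α, k⟩` transforming according to `V l`. `code` is the
numerical label by which a machine refers to a basis element. -/
structure ITOBasis {G : Type*} [Group G] {n d : ℕ} (U : G →* QUnitary n d) where
  Irr : Type
  [fintypeIrr : Fintype Irr]
  [decEqIrr : DecidableEq Irr]
  dim : Irr → ℕ
  mult : Irr → ℕ
  mult_pos : ∀ l, 0 < mult l
  V : (l : Irr) → G →* Matrix.unitaryGroup (Fin (dim l)) ℂ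
  dim_pos : ∀ l, 0 < dim l
  irreducible : ∀ (l : Irr) (S : Submodule ℂ (Fin (dim l) → ℂ)),
    (∀ g, ∀ v ∈ S, (V l g : Matrix (Fin (dim l)) (Fin (dim l)) ℂ) *ᵥ v ∈ S) → S = ⊥ ∨ S = ⊤
  inequivalent : ∀ l m : Irr, l ≠ m →
    ¬ ∃ A : (Fin (dim l) → ℂ) ≃ₗ[ℂ] (Fin (dim m) → ℂ), ∀ g v,
      A ((V l g : Matrix (Fin (dim l)) (Fin (dim l)) ℂ) *ᵥ v) =
        (V m g : Matrix (Fin (dim m)) (Fin (dim m)) ℂ) *ᵥ A v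
  T : (Σ l : Irr, Fin (mult l) × Fin (dim l)) → Oper n d
  orthonormal : ∀ b c, hs (T b) (T c) = if b = c then 1 else 0
  complete : ∀ A : Oper n d, A = ∑ b, hs (T b) A • T b
  covariant : ∀ (g : G) (l : Irr) (α : Fin (mult l)) (k : Fin (dim l)),
    ad (U g) (T ⟨l, α, k⟩) =
      ∑ k', (V l g : Matrix (Fin (dim l)) (Fin (dim l)) ℂ) k' k • T ⟨l, α, k'⟩
  code : (Σ l : Irr, Fin (mult l) × Fin (dim l)) → ℕ
  code_injective : Function.Injective code

attribute [instance] ITOBasis.fintypeIrr ITOBasis.decEqIrr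

/-- A group-parametrised family of noisy circuits. Layers are numbered from `0`; a circuit of depth
`D` uses the layers `j < D`, and the basis at position `D` is the one in which the last fixed
unitary `W (D - 1)` is expanded; later positions play no role. Layer `j` is the noise channel
after `U j (g j)` after `W j`. The noise is diagonal in the symmetry-adapted basis, its eigenvalue
depending on the irrep and the component. -/
structure NoisyCircuit (G : Type*) [Group G] [TopologicalSpace G] (n d : ℕ) where
  U : ℕ → G →* QUnitary n d
  continuous_U : ∀ j, Continuous fun g => (U j g : Oper n d)
  W : ℕ → QUnitary n d
  basis : (j : ℕ) → ITOBasis (U j)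
  noise : ℕ → Oper n d →ₗ[ℂ] Oper n d
  channel : ∀ j, IsChannel (noise j)
  eig : (j : ℕ) → (l : (basis j).Irr) → Fin ((basis j).dim l) → ℂ
  diagonal : ∀ j l α k, noise j ((basis j).T ⟨l, α, k⟩) = eig j l k • (basis j).T ⟨l, α, k⟩

namespace NoisyCircuit

variable {G : Type*} [Group G] [TopologicalSpace G] {n d : ℕ} (C : NoisyCircuit G n d)

/-- Labels (irrep, multiplicity, component) of the basis at position `j`. -/
abbrev Label (j : ℕ) : Type :=
  Σ l : (C.basis j).Irr, Fin ((C.basis j).mult l) × Fin ((C.basis j).dim l)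

/-- The basis operator with a given label. -/
abbrev T (j : ℕ) (b : C.Label j) : Oper n d := (C.basis j).T b

/-- The irrep is trivial. -/
def IsTriv (j : ℕ) (l : (C.basis j).Irr) : Prop := ∀ g, (C.basis j).V l g = 1

open Classical in
/-- The projector `Π₀` onto the span of the basis operators that transform trivially. -/
def proj (j : ℕ) (A : Oper n d) : Oper n d :=
  ∑ b : C.Label j with C.IsTriv j b.1, hs (C.T j b) A • C.T j b

/-- The product `W i * ⋯ * W (j - 1)`, leading from position `j` to position `i`. -/
def wString (i j : ℕ) : QUnitary n d := ((List.Ico i j).map C.W).prod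

/-- The contraction `⟨⟨T_b| W_i ⊗ W_i* ⋯ W_{j-1} ⊗ W_{j-1}* |T_c⟩⟩`. -/
def contraction (i j : ℕ) (b : C.Label i) (c : C.Label j) : ℂ :=
  hs (C.T i b) (ad (C.wString i j) (C.T j c))

/-- `Π₀ W_i Π₀ W_{i+1} ⋯ W_{i+k-1} Π₀` (as Liouville operators, `k` unitaries). -/
def window (i : ℕ) : ℕ → Oper n d → Oper n d
  | 0, A => C.proj i A
  | k + 1, A => C.proj i (ad (C.W i) (window (i + 1) k A))

/-- The matrix element between trivially transforming basis operators of the contracted window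
containing the unitaries `W_i, …, W_{i+M}`. -/
def windowEntry (i M : ℕ) (b : C.Label i) (c : C.Label (i + M + 1)) : ℂ :=
  hs (C.T i b) (C.window i (M + 1) (C.T (i + M + 1) c))

section Distributions

variable [NeZero d] {D : ℕ}

/-- The noiseless circuit `U_0(g_0) W_0 ⋯ U_{D-1}(g_{D-1}) W_{D-1}`. -/
def circuit (g : Fin D → G) : QUnitary n d := (List.ofFn fun i : Fin D => C.U i (g i) * C.W i).prod

/-- The noiseless output distribution `p(x, g) = |⟨x| C(g) |0⟩|²`. -/
def p (g : Fin D → G) (x : Outcome n d) : ℝ :=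
  Complex.normSq ((C.circuit g : Oper n d) x 0)

/-- The noisy output state, from the input state `|0⟩⟨0|`. -/
def noisyState (g : Fin D → G) : Oper n d :=
  (List.ofFn fun i : Fin D => fun A : Oper n d =>
    C.noise i (ad (C.U i (g i)) (ad (C.W i) A))).foldr (fun f A => f A) (Matrix.single 0 0 1)

/-- The noisy output distribution `p̃(x, g)`. -/
def pNoisy (g : Fin D → G) (x : Outcome n d) : ℝ := (C.noisyState g x x).re

/-- Paths of basis operators: a label (irrep, multiplicity, component `k`) at each position
`0, …, D`, and a second component `k'` of the same irrep at each layer. -/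
abbrev Path (D : ℕ) : Type :=
  Σ b : (i : Fin (D + 1)) → C.Label i,
    (i : Fin D) → Fin ((C.basis i.castSucc).dim (b i.castSucc).1)

variable {C} in
/-- The label after the group action at layer `i` of a path. -/
def Path.out (q : C.Path D) (i : Fin D) : C.Label i.castSucc :=
  ⟨(q.1 i.castSucc).1, (q.1 i.castSucc).2.1, q.2 i⟩

variable {C} in
/-- The fixed-unitary transfer coefficient of a path between positions `i` and `i + 1`. -/
def Path.transfer (q : C.Path D) (i : Fin D) : ℂ :=
  hs (C.T i.castSucc (q.out i)) (ad (C.W i) (C.T i.succ (q.1 i.succ)))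

variable {C} in
open Classical in
/-- The number of layers at which the irrep of the path is non-trivial. -/
def Path.weight (q : C.Path D) : ℕ :=
  (Finset.univ.filter fun i : Fin D => ¬ C.IsTriv i.castSucc (q.1 i.castSucc).1).card

variable {C} in
/-- The path has a non-zero contribution: no transfer coefficient vanishes, the overlap
with the input state does not vanish, and the overlap with some outcome does not vanish. -/
def Path.Valid (q : C.Path D) : Prop :=
  (∀ i, q.transfer i ≠ 0) ∧ (∃ x, C.T _ (q.1 0) x x ≠ 0) ∧ C.T _ (q.1 (Fin.last D)) 0 0 ≠ 0

variable {C} in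
/-- Contribution of a path to the probability of outcome `x`, where each layer is damped by the
factor `η` (the noise eigenvalues, or `1` for the noiseless circuit). -/
def Path.value (q : C.Path D) (η : (j : ℕ) → (l : (C.basis j).Irr) → Fin ((C.basis j).dim l) → ℂ)
    (g : Fin D → G) (x : Outcome n d) : ℂ :=
  C.T _ (q.1 0) x x *
    (∏ i : Fin D, η i.castSucc (q.1 i.castSucc).1 (q.1 i.castSucc).2.2 *
      ((C.basis i.castSucc).V (q.1 i.castSucc).1 (g i) :
        Matrix (Fin ((C.basis i.castSucc).dim (q.1 i.castSucc).1))
          (Fin ((C.basis i.castSucc).dim (q.1 i.castSucc).1)) ℂ) (q.1 i.castSucc).2.2 (q.2 i) *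
      q.transfer i) *
    starRingEnd ℂ (C.T _ (q.1 (Fin.last D)) 0 0)

/-- The noiseless truncated (quasi-)distribution `p^𝒯`: paths with at most `L` non-trivial
irreps. -/
def pTrunc (L : ℕ) (g : Fin D → G) (x : Outcome n d) : ℂ :=
  ∑ q : C.Path D with q.weight ≤ L, q.value (fun _ _ _ => 1) g x

/-- The noisy truncated (quasi-)distribution `p̃^𝒯`. -/
def pNoisyTrunc (L : ℕ) (g : Fin D → G) (x : Outcome n d) : ℂ :=
  ∑ q : C.Path D with q.weight ≤ L, q.value C.eig g x

end Distributions

/- ===== Part III. The assumptions. ===== -/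

/-- Every irrep on a valid path with at most `L` non-trivial irreps has dimension at most
`dmax`. -/
def IrrepDimBound [NeZero d] (D L dmax : ℕ) : Prop :=
  ∀ q : C.Path D, q.Valid → q.weight ≤ L →
    ∀ i : Fin D, (C.basis i.castSucc).dim (q.1 i.castSucc).1 ≤ dmax

/-- Controlled tree growth: each fixed unitary maps a basis operator, or a basis operator that was
so far propagated inside the trivial subspaces, entirely into the trivial subspace or entirely
into its orthogonal complement; likewise in the adjoint direction. -/
def ControlledGrowth (D : ℕ) : Prop :=
  (∀ i j, i < j → j < D → ∀ c : C.Label j,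
    (∀ l, i < l → l < j →
      C.proj l (ad (C.wString l j) (C.T j c)) = ad (C.wString l j) (C.T j c)) →
    C.proj i (ad (C.wString i j) (C.T j c)) = 0 ∨
      C.proj i (ad (C.wString i j) (C.T j c)) = ad (C.wString i j) (C.T j c)) ∧
  (∀ i j, i < j → j < D → ∀ b : C.Label i,
    (∀ l, i < l → l < j →
      C.proj l (ad ((C.wString i l)⁻¹) (C.T i b)) = ad ((C.wString i l)⁻¹) (C.T i b)) →
    C.proj j (ad ((C.wString i j)⁻¹) (C.T i b)) = 0 ∨
      C.proj j (ad ((C.wString i j)⁻¹) (C.T i b)) = ad ((C.wString i j)⁻¹) (C.T i b))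

/-- Path contractions: a product of consecutive fixed unitaries takes each basis operator to a
combination of at most `s` basis operators, in both directions. -/
def SparseContractions (D s : ℕ) : Prop :=
  ∀ i j, i < j → j ≤ D →
    (∀ b : C.Label i, {c : C.Label j | C.contraction i j b c ≠ 0}.ncard ≤ s) ∧
    (∀ c : C.Label j, {b : C.Label i | C.contraction i j b c ≠ 0}.ncard ≤ s)

/-- Noise penalisation with gap `γ`: the noise fixes the operators that transform trivially and
damps all others by at least `1 - γ`. -/
def NoisePenalised (D : ℕ) (γ : ℝ) : Prop :=
  ∀ j < D, ∀ (l : (C.basis j).Irr) (k : Fin ((C.basis j).dim l)),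
    (C.IsTriv j l → C.eig j l k = 1) ∧ (¬ C.IsTriv j l → ‖C.eig j l k‖ ≤ 1 - γ)

/-- Efficient contractions: each window of the unitaries `W_i, …, W_{i+M}` between projectors onto
trivial subspaces has at most `rank` non-zero entries. -/
def ContractibleWindows (D M rank : ℕ) : Prop :=
  ∀ i, i + M + 1 < D →
    {bc : C.Label i × C.Label (i + M + 1) | C.windowEntry i M bc.1 bc.2 ≠ 0}.ncard ≤ rank

/-- Machine encoding of a basis label at position `j`. -/
def labelVal (j : ℕ) (b : C.Label j) : Val := .nat ((C.basis j).code b)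

open Classical in
/-- The subroutines answer correctly, for the circuit with parameters `g`:
`info` gives the dimension of the irrep of a label and whether it is trivial; `expand` lists the
labels with the same irrep and multiplicity; `coeff` evaluates matrix coefficients of irreps;
`eigen` gives the noise eigenvalues; `contractBra` and `contractKet` list the non-zero contractions
of a basis operator with a product of consecutive fixed unitaries; `contractFull` lists the
non-zero entries of a window; `marginal` evaluates marginals of the diagonal of a basis
operator. Nothing is required for irreps of dimension above `dmax` in `expand` and `coeff`, nor
on other inputs. -/
structure Subroutines (D M dmax : ℕ) (g : Fin D → G) (O : Subroutine → Val → Val) : Prop where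
  info : ∀ j < D, ∀ b : C.Label j,
    O .info (Val.ofList [.nat j, C.labelVal j b]) =
      Val.ofList [.nat ((C.basis j).dim b.1), .nat (if C.IsTriv j b.1 then 1 else 0)]
  expand : ∀ j < D, ∀ b : C.Label j, (C.basis j).dim b.1 ≤ dmax →
    O .expand (Val.ofList [.nat j, C.labelVal j b]) =
      Val.ofList (List.ofFn fun k => C.labelVal j ⟨b.1, b.2.1, k⟩)
  coeff : ∀ (i : Fin D) (l : (C.basis i).Irr) (α : Fin ((C.basis i).mult l))
    (k k' : Fin ((C.basis i).dim l)), (C.basis i).dim l ≤ dmax →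
    O .coeff (Val.ofList [.nat i, C.labelVal i ⟨l, α, k⟩, C.labelVal i ⟨l, α, k'⟩]) =
      .num (((C.basis i).V l (g i) :
        Matrix (Fin ((C.basis i).dim l)) (Fin ((C.basis i).dim l)) ℂ) k k')
  eigen : ∀ j < D, ∀ b : C.Label j,
    O .eigen (Val.ofList [.nat j, C.labelVal j b]) = .num (C.eig j b.1 b.2.2)
  contractBra : ∀ i j, i < j → j ≤ D → ∀ b : C.Label i, ∃ cs : List (C.Label j),
    cs.Nodup ∧ (∀ c, c ∈ cs ↔ C.contraction i j b c ≠ 0) ∧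
    O .contractBra (Val.ofList [.nat i, .nat j, C.labelVal i b]) =
      Val.ofList (cs.map fun c => .cons (C.labelVal j c) (.num (C.contraction i j b c)))
  contractKet : ∀ i j, i < j → j ≤ D → ∀ c : C.Label j, ∃ bs : List (C.Label i),
    bs.Nodup ∧ (∀ b, b ∈ bs ↔ C.contraction i j b c ≠ 0) ∧
    O .contractKet (Val.ofList [.nat i, .nat j, C.labelVal j c]) =
      Val.ofList (bs.map fun b => .cons (C.labelVal i b) (.num (C.contraction i j b c)))
  contractFull : ∀ i, i + M + 1 < D → ∃ es : List (C.Label i × C.Label (i + M + 1)),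
    es.Nodup ∧ (∀ e, e ∈ es ↔ C.windowEntry i M e.1 e.2 ≠ 0) ∧
    O .contractFull (.nat i) =
      Val.ofList (es.map fun e => Val.ofList
        [C.labelVal i e.1, C.labelVal (i + M + 1) e.2, .num (C.windowEntry i M e.1 e.2)])
  marginal : ∀ j ≤ D, ∀ (b : C.Label j) (x : Outcome n d), ∀ m ≤ n,
    O .marginal (Val.ofList [.nat j, C.labelVal j b, prefixVal x m]) =
      .num (prefixMarginal (fun z => C.T j b z z) x m)

end NoisyCircuit

end TruncSim

end

open TruncSim

open scoped Matrix

noncomputable section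

namespace TruncSim

/-! The proof has an analytic half (the error) and an algorithmic half (evaluation and sampling).
Both read an output probability as a sum over paths of basis operators.

Error. By Schur orthogonality (`integral_coeff_eq_zero`), distinct products of matrix coefficients,
one factor per layer, are orthogonal in L² of the circuit parameters. Paths with more than L
non-trivial layers are grouped by these products. The noise factor of a path depends only on its
product, so the noise multiplies each coefficient of the noiseless residual by a number of modulus
at most (1-γ)^(L+1) (`integral_residual_le`). Cauchy-Schwarz over the d^n outcomes compensates the
d^(-n) in the anti-concentration bound and gives both estimates (`error_bounds`, `damping_le`).

Evaluation. Marking each non-trivial layer by a variable X turns the truncated sum into `tau L`, the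
sum of the coefficients of degree at most L, of a product of transfer matrices (`sum_path_eq_tau`).
A search started at an end of the circuit could meet exponentially many labels. But since (M+2)(L+1)
≤ D, a path with at most L non-trivial layers has M+2 consecutive trivial ones. Cutting each path at
its first such run (`tau_sum_row_eq_sum_windows`) leaves at most `rank` window entries per position,
and from both ends of the window one searches outwards. By controlled growth, the image of a basis
operator under consecutive fixed unitaries is wholly trivial or wholly non-trivial. In the first
case the search moves on without branching; in the second it branches into at most s·dmax labels and
spends one unit of the degree budget. The backward search also counts the current run of trivial
layers, since no earlier run may be complete (`scan`). On reaching the beginning of the circuit it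
hands the unspent budget to the forward search. The cost is polynomial times (4·s·dmax)^(L+1)
(`runs_scanFwd`, `runs_scanBack`, `totalTime_le`).

Sampling. Entries are drawn one after another, with weights the positive parts of the marginals of
the truncated distribution F. F sums to 1, because only trivially transforming operators have a
trace (`sum_pNoisyTrunc`). The positive part of a sum is at most the sum of the positive parts, so
the sampled distribution satisfies q(x) ≤ max(Re F(x), 0) (`outProb_le`). Hence ‖Re F - q‖₁ = ‖Re
F‖₁ - 1 ≤ ‖p̃ - Re F‖₁, and the triangle inequality gives the factor 2 (`sum_abs_sub_outProb_le`).

Running time. Since L+1 ≤ 2 + log(K/ε)/r, the three regimes amount to three choices of a base that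
dominates 4·s·dmax (`exists_time_bound`). -/

/-! ### Reasoning about programs -/

/-- `e` evaluates to `v` in at most `T` steps. -/
def Runs (P : Program) (O : Subroutine → Val → Val) (κ : ℕ) (env : List Val) (e : Code) (v : Val)
    (T : ℕ) : Prop := ∃ t ≤ T, Eval P O κ env e v t

/-- The expression makes no function calls and uses only the first `m` variables. -/
def Code.isPure : Code → ℕ → Bool
  | .var i, m => decide (i < m)
  | .lit _, _ => true
  | .nil, _ => true
  | .op1 _ e, m => e.isPure m
  | .op2 _ e₁ e₂, m => e₁.isPure m && e₂.isPure m
  | .letIn e b, m => e.isPure m && b.isPure (m + 1)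
  | .ite c a b, m => c.isPure m && a.isPure m && b.isPure m
  | .call _ _, _ => false
  | .ask _ e, m => e.isPure m

/-- The value of an expression without function calls. -/
def Code.val (O : Subroutine → Val → Val) : Code → List Val → Val
  | .var i, env => env.getD i .nil
  | .lit k, _ => .nat k
  | .nil, _ => .nil
  | .op1 o e, env => o.run (e.val O env)
  | .op2 o e₁ e₂, env => o.run (e₁.val O env) (e₂.val O env)
  | .letIn e b, env => b.val O (e.val O env :: env)
  | .ite c a b, env => match c.val O env with
    | .nat 0 => b.val O env
    | _ => a.val O env
  | .call _ _, _ => .nil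
  | .ask q e, env => O q (e.val O env)

/-- Number of nodes of an expression. -/
def Code.size : Code → ℕ
  | .var _ => 1
  | .lit _ => 1
  | .nil => 1
  | .op1 _ e => e.size + 1
  | .op2 _ e₁ e₂ => e₁.size + e₂.size + 1
  | .letIn e b => e.size + b.size + 1
  | .ite c a b => c.size + a.size + b.size + 1
  | .call _ e => e.size + 1
  | .ask _ e => e.size + 1

section Rules

variable {P : Program} {O : Subroutine → Val → Val} {κ : ℕ} {env : List Val}

theorem Runs.mono {e : Code} {v : Val} {T T' : ℕ} (h : Runs P O κ env e v T) (hT : T ≤ T') :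
    Runs P O κ env e v T' := by
  obtain ⟨t, ht, h⟩ := h
  exact ⟨t, ht.trans hT, h⟩

theorem Runs.op1 {e : Code} {v : Val} {T : ℕ} (o : Op1) (h : Runs P O κ env e v T) :
    Runs P O κ env (.op1 o e) (o.run v) (T + 1) := by
  obtain ⟨t, ht, h⟩ := h
  exact ⟨t + 1, by omega, .op1 h rfl⟩

theorem Runs.op2 {e₁ e₂ : Code} {v₁ v₂ : Val} {T₁ T₂ : ℕ} (o : Op2) (h₁ : Runs P O κ env e₁ v₁ T₁)
    (h₂ : Runs P O κ env e₂ v₂ T₂) :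
    Runs P O κ env (.op2 o e₁ e₂) (o.run v₁ v₂) (T₁ + T₂ + 1) := by
  obtain ⟨t₁, ht₁, h₁⟩ := h₁
  obtain ⟨t₂, ht₂, h₂⟩ := h₂
  exact ⟨t₁ + t₂ + 1, by omega, .op2 h₁ h₂ rfl⟩

theorem Runs.letIn {e b : Code} {v w : Val} {T₁ T₂ : ℕ} (h₁ : Runs P O κ env e v T₁)
    (h₂ : Runs P O κ (v :: env) b w T₂) : Runs P O κ env (.letIn e b) w (T₁ + T₂ + 1) := by
  obtain ⟨t₁, ht₁, h₁⟩ := h₁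
  obtain ⟨t₂, ht₂, h₂⟩ := h₂
  exact ⟨t₁ + t₂ + 1, by omega, .letIn h₁ h₂⟩

theorem Runs.iteTrue {c a b : Code} {v w : Val} {T₁ T₂ : ℕ} (h₁ : Runs P O κ env c v T₁)
    (hv : v ≠ .nat 0) (h₂ : Runs P O κ env a w T₂) :
    Runs P O κ env (.ite c a b) w (T₁ + T₂ + 1) := by
  obtain ⟨t₁, ht₁, h₁⟩ := h₁
  obtain ⟨t₂, ht₂, h₂⟩ := h₂
  exact ⟨t₁ + t₂ + 1, by omega, .iteTrue h₁ hv h₂⟩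

theorem Runs.iteFalse {c a b : Code} {w : Val} {T₁ T₂ : ℕ} (h₁ : Runs P O κ env c (.nat 0) T₁)
    (h₂ : Runs P O κ env b w T₂) : Runs P O κ env (.ite c a b) w (T₁ + T₂ + 1) := by
  obtain ⟨t₁, ht₁, h₁⟩ := h₁
  obtain ⟨t₂, ht₂, h₂⟩ := h₂
  exact ⟨t₁ + t₂ + 1, by omega, .iteFalse h₁ h₂⟩

theorem Runs.call {f : ℕ} {e b : Code} {v w : Val} {T₁ T₂ : ℕ} (h₁ : Runs P O κ env e v T₁)
    (hf : P[f]? = some b) (h₂ : Runs P O κ [v] b w T₂) :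
    Runs P O κ env (.call f e) w (T₁ + T₂ + 1) := by
  obtain ⟨t₁, ht₁, h₁⟩ := h₁
  obtain ⟨t₂, ht₂, h₂⟩ := h₂
  exact ⟨t₁ + t₂ + 1, by omega, .call h₁ hf h₂⟩

theorem Runs.ask {e : Code} {v : Val} {T : ℕ} (q : Subroutine) (h : Runs P O κ env e v T) :
    Runs P O κ env (.ask q e) (O q v) (T + κ + 1) := by
  obtain ⟨t, ht, h⟩ := h
  exact ⟨t + κ + 1, by omega, .ask h rfl⟩

/-- Without function calls there is no recursion, so evaluation is a total function of the
environment. Each node costs at most κ+1 steps. Concrete program fragments are thereby verified by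
`rfl` and `decide`, and only function calls need an argument. -/
theorem Runs.val (P : Program) (O : Subroutine → Val → Val) (κ : ℕ) (e : Code) (env : List Val)
    (he : e.isPure env.length = true) : Runs P O κ env e (e.val O env) (e.size * (κ + 1)) := by
  induction e generalizing env with
  | var i =>
    have hi : i < env.length := by simpa [Code.isPure] using he
    exact ⟨1, by simp [Code.size], .var (by simp [Code.val, List.getD, hi])⟩
  | lit k => exact ⟨1, by simp [Code.size], .lit⟩
  | nil => exact ⟨1, by simp [Code.size], .nil⟩
  | op1 o e ih =>
    refine ((ih env he).op1 o).mono ?_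
    simp only [Code.size, add_mul]; omega
  | op2 o e₁ e₂ ih₁ ih₂ =>
    simp only [Code.isPure, Bool.and_eq_true] at he
    refine ((ih₁ env he.1).op2 o (ih₂ env he.2)).mono ?_
    simp only [Code.size, add_mul]; omega
  | letIn e b ih₁ ih₂ =>
    simp only [Code.isPure, Bool.and_eq_true] at he
    refine ((ih₁ env he.1).letIn (ih₂ (_ :: env) he.2)).mono ?_
    simp only [Code.size, add_mul]; omega
  | ite c a b ih₁ ih₂ ih₃ =>
    simp only [Code.isPure, Bool.and_eq_true] at he
    have h₁ := ih₁ env he.1.1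
    have h₂ := ih₂ env he.1.2
    have h₃ := ih₃ env he.2
    by_cases hc : c.val O env = .nat 0
    · rw [hc] at h₁
      have : Code.val O (.ite c a b) env = b.val O env := by simp [Code.val, hc]
      rw [this]
      refine (h₁.iteFalse h₃).mono ?_
      simp only [Code.size, add_mul]; omega
    · have : Code.val O (.ite c a b) env = a.val O env := by
        rw [Code.val]
        split
        · contradiction
        · rfl
      rw [this]
      refine (h₁.iteTrue hc h₂).mono ?_
      simp only [Code.size, add_mul]; omega
  | call f e => simp [Code.isPure] at he
  | ask q e ih =>
    refine ((ih env he).ask q).mono ?_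
    simp only [Code.size, add_mul]; omega

/-- A variant of `Runs.val` with prescribed value and time. -/
theorem Runs.ofVal {e : Code} {v : Val} {T : ℕ} (he : e.isPure env.length = true)
    (hv : e.val O env = v) (hT : e.size * (κ + 1) ≤ T) : Runs P O κ env e v T :=
  hv ▸ (Runs.val P O κ e env he).mono hT

end Rules

namespace Code

/-- First component. -/
abbrev fst (e : Code) : Code := .op1 .fst e
/-- Second component. -/
abbrev snd (e : Code) : Code := .op1 .snd e
/-- Pairing. -/
abbrev pair (a b : Code) : Code := .op2 .cons a b
/-- The complex number zero. -/
abbrev zero : Code := .op1 .toNum (.lit 0)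
/-- Lists of two entries. -/
abbrev list2 (a b : Code) : Code := pair a (pair b .nil)
/-- Lists of three entries. -/
abbrev list3 (a b c : Code) : Code := pair a (list2 b c)
/-- Predecessor. -/
abbrev pred (a : Code) : Code := .op2 .natSub a (.lit 1)
/-- Successor. -/
abbrev succ (a : Code) : Code := .op2 .natAdd a (.lit 1)

/-- A function that sums `body` over the list in the second component of its argument. -/
def sumLoop (f : ℕ) (body : Code) : Code :=
  .ite (.op1 .isCons (Code.var 0).snd)
    (.op2 .add body (.call f (pair (Code.var 0).fst (Code.var 0).snd.snd)))
    zero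

end Code

/-- The body sees the context and the whole remaining list but reads only its head, hence the
quantification over the tail `rest`. Every sum in the programs is an instance of this loop. -/
theorem Runs.sumLoop {P : Program} {O : Subroutine → Val → Val} {κ : ℕ} {f : ℕ} {body : Code}
    (hf : P[f]? = some (Code.sumLoop f body)) {α : Type*} (enc : α → Val) (F : α → ℂ) (ctx : Val)
    (T : ℕ) (xs : List α)
    (h : ∀ x ∈ xs, ∀ rest, Runs P O κ [.cons ctx (.cons (enc x) rest)] body (.num (F x)) T) :
    Runs P O κ [.cons ctx (Val.ofList (xs.map enc))] (Code.sumLoop f body)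
      (.num (xs.map F).sum) (xs.length * (T + 16 * (κ + 1)) + 16 * (κ + 1)) := by
  induction xs with
  | nil =>
    have hz : Runs P O κ [.cons ctx .nil] Code.zero (.num 0) (2 * (κ + 1)) :=
      .ofVal rfl (by simp [Code.val, Op1.run]) (by simp [Code.size])
    have hc : Runs P O κ [.cons ctx .nil] (.op1 .isCons (Code.var 0).snd) (.nat 0) (3 * (κ + 1)) :=
      .ofVal rfl rfl (by simp [Code.size])
    exact (hc.iteFalse hz).mono (by simp; omega)
  | cons x xs ih =>
    have ih := ih fun y hy => h y (List.mem_cons_of_mem _ hy)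
    have h1 := h x List.mem_cons_self (Val.ofList (xs.map enc))
    have hc := Runs.call (Runs.val P O κ (Code.pair (Code.var 0).fst (Code.var 0).snd.snd)
      [.cons ctx (.cons (enc x) (Val.ofList (xs.map enc)))] rfl) hf ih
    have := Runs.iteTrue (b := Code.zero) (Runs.val P O κ (.op1 .isCons (Code.var 0).snd)
      [.cons ctx (.cons (enc x) (Val.ofList (xs.map enc)))] rfl) (by simp [Code.val, Op1.run])
      (h1.op2 .add hc)
    simp only [List.map_cons, List.sum_cons, List.length_cons]
    refine Runs.mono this ?_
    simp only [Code.size]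
    ring_nf
    omega

/-! ### Operators, the Hilbert-Schmidt product and unitary channels -/

section Operators

variable {n d : ℕ}

theorem hs_add (A B B' : Oper n d) : hs A (B + B') = hs A B + hs A B' := by
  simp [hs, Matrix.mul_add]

theorem hs_smul (A B : Oper n d) (z : ℂ) : hs A (z • B) = z * hs A B := by
  simp [hs]

theorem hs_zero (A : Oper n d) : hs A 0 = 0 := by simp [hs]

theorem hs_sum {ι : Type*} (A : Oper n d) (S : Finset ι) (B : ι → Oper n d) :
    hs A (∑ i ∈ S, B i) = ∑ i ∈ S, hs A (B i) := by
  simp [hs, Matrix.mul_sum, Matrix.trace_sum]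

theorem hs_conj (A B : Oper n d) : starRingEnd ℂ (hs A B) = hs B A := by
  rw [hs, starRingEnd_apply, ← Matrix.trace_conjTranspose]
  simp [hs]

theorem ad_add (u : QUnitary n d) (A B : Oper n d) : ad u (A + B) = ad u A + ad u B := by
  simp [ad, Matrix.mul_add, Matrix.add_mul]

theorem ad_smul (u : QUnitary n d) (z : ℂ) (A : Oper n d) : ad u (z • A) = z • ad u A := by
  simp [ad]

theorem ad_zero (u : QUnitary n d) : ad u 0 = 0 := by simp [ad]

theorem ad_sum {ι : Type*} (u : QUnitary n d) (S : Finset ι) (B : ι → Oper n d) :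
    ad u (∑ i ∈ S, B i) = ∑ i ∈ S, ad u (B i) := by
  simp [ad, Matrix.mul_sum, Matrix.sum_mul]

theorem ad_one (A : Oper n d) : ad 1 A = A := by simp [ad]

theorem ad_mul (u v : QUnitary n d) (A : Oper n d) : ad (u * v) A = ad u (ad v A) := by
  simp [ad, Matrix.mul_assoc]

theorem ad_trace (u : QUnitary n d) (A : Oper n d) : (ad u A).trace = A.trace := by
  rw [ad, Matrix.trace_mul_comm, ← Matrix.mul_assoc, ← Matrix.star_eq_conjTranspose,
    Unitary.coe_star_mul_self, Matrix.one_mul]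

theorem hs_ad (u : QUnitary n d) (A B : Oper n d) : hs A (ad u B) = hs (ad u⁻¹ A) B := by
  rw [hs, hs, ad, ad]
  simp only [Matrix.conjTranspose_mul, Matrix.conjTranspose_conjTranspose,
    Matrix.UnitaryGroup.inv_val, Matrix.star_eq_conjTranspose]
  rw [← Matrix.mul_assoc, ← Matrix.mul_assoc, Matrix.trace_mul_comm]
  simp [Matrix.mul_assoc]

end Operators

/-! ### Tensor operator bases, contractions, and controlled growth in terms of labels. -/

namespace NoisyCircuit

variable {G : Type*} [Group G] [TopologicalSpace G] {n d : ℕ} (C : NoisyCircuit G n d)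

theorem hs_T_T (j : ℕ) (b c : C.Label j) : hs (C.T j b) (C.T j c) = if b = c then 1 else 0 :=
  (C.basis j).orthonormal b c

theorem sum_hs_mul_hs (j : ℕ) (A B : Oper n d) :
    ∑ b : C.Label j, hs A (C.T j b) * hs (C.T j b) B = hs A B := by
  conv_rhs => rw [(C.basis j).complete B, hs_sum]
  simp [hs_smul, mul_comm]

theorem ext_hs (j : ℕ) {A B : Oper n d} (h : ∀ b, hs (C.T j b) A = hs (C.T j b) B) : A = B := by
  rw [(C.basis j).complete A, (C.basis j).complete B]
  exact Finset.sum_congr rfl fun b _ => by rw [h b]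

theorem hs_proj [DecidablePred (C.IsTriv j)] (b : C.Label j) (A : Oper n d) :
    hs (C.T j b) (C.proj j A) = if C.IsTriv j b.1 then hs (C.T j b) A else 0 := by
  classical
  rw [proj, hs_sum, Finset.sum_filter, Finset.sum_eq_single b]
  · simp only [hs_smul, hs_T_T]; simp
  · intro c _ hc
    simp only [hs_smul, hs_T_T, if_neg hc.symm]; simp
  · simp

/-- Under the identity action every line is invariant, so irreducibility leaves room for one line
only. This is why a trivial layer offers no choice of component and causes no branching. -/
theorem IsTriv.dim_eq_one {C : NoisyCircuit G n d} {j : ℕ} {l : (C.basis j).Irr}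
    (h : C.IsTriv j l) : (C.basis j).dim l = 1 := by
  have hpos := (C.basis j).dim_pos l
  let e : Fin ((C.basis j).dim l) → ℂ := Pi.single ⟨0, hpos⟩ 1
  rcases (C.basis j).irreducible l (Submodule.span ℂ {e}) (by
    intro g v hv
    rw [h g]; simpa using hv) with h0 | h1
  · have : e = 0 := by simpa [Submodule.span_singleton_eq_bot] using h0
    have := congrFun this ⟨0, hpos⟩
    simp [e] at this
  · have := finrank_span_singleton (K := ℂ) (v := e) (by
      intro h0
      have := congrFun h0 ⟨0, hpos⟩
      simp [e] at this)
    rw [h1] at this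
    simpa using this

theorem wString_self (i : ℕ) : C.wString i i = 1 := by simp [wString]

theorem wString_succ_right {i j : ℕ} (h : i ≤ j) : C.wString i (j + 1) = C.wString i j * C.W j := by
  simp [wString, List.Ico.succ_top h]

theorem wString_succ_left {i j : ℕ} (h : i < j) : C.wString i j = C.W i * C.wString (i + 1) j := by
  simp [wString, List.Ico.eq_cons h]

/-- Matrix elements of a single fixed unitary. -/
def step (j : ℕ) (b : C.Label j) (c : C.Label (j + 1)) : ℂ := hs (C.T j b) (ad (C.W j) (C.T (j + 1) c))

theorem contraction_self (i : ℕ) (b c : C.Label i) :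
    C.contraction i i b c = if b = c then 1 else 0 := by
  rw [contraction, wString_self, ad_one, hs_T_T]

theorem contraction_succ_right {i j : ℕ} (h : i ≤ j) (b : C.Label i) (c : C.Label (j + 1)) :
    C.contraction i (j + 1) b c = ∑ b', C.contraction i j b b' * C.step j b' c := by
  simp only [contraction, step, hs_ad (C.wString i j)]
  rw [sum_hs_mul_hs, wString_succ_right C h, ad_mul, hs_ad (C.wString i j)]

theorem contraction_succ_left {i j : ℕ} (h : i < j) (b : C.Label i) (c : C.Label j) :
    C.contraction i j b c = ∑ b', C.step i b b' * C.contraction (i + 1) j b' c := by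
  simp only [contraction, step, hs_ad (C.W i)]
  rw [sum_hs_mul_hs, wString_succ_left C h, ad_mul, hs_ad (C.W i)]

/-- Conjugation by a unitary is injective. The lists returned by the contraction subroutines are
therefore non-empty, and a program may inspect their first entry. -/
theorem exists_contraction_ne_zero_right (i j : ℕ) (b : C.Label i) :
    ∃ c, C.contraction i j b c ≠ 0 := by
  by_contra! h
  have h0 : ad (C.wString i j)⁻¹ (C.T i b) = 0 := C.ext_hs j fun c => by
    rw [hs_zero, ← hs_conj, ← hs_ad]
    exact (congrArg _ (h c)).trans (map_zero _)
  have : C.T i b = 0 := by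
    rw [← ad_one (C.T i b), ← mul_inv_cancel (C.wString i j), ad_mul, h0, ad_zero]
  have h1 := C.hs_T_T i b b
  rw [if_pos rfl, this, hs_zero] at h1
  exact zero_ne_one h1

theorem exists_contraction_ne_zero_left (i j : ℕ) (c : C.Label j) :
    ∃ b, C.contraction i j b c ≠ 0 := by
  by_contra! h
  have h0 : ad (C.wString i j) (C.T j c) = 0 := C.ext_hs i fun b => by
    rw [hs_zero]; exact h b
  have : C.T j c = 0 := by
    rw [← ad_one (C.T j c), ← inv_mul_cancel (C.wString i j), ad_mul, h0, ad_zero]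
  have h1 := C.hs_T_T j c c
  rw [if_pos rfl, this, hs_zero] at h1
  exact zero_ne_one h1

theorem proj_eq_self_iff (j : ℕ) (A : Oper n d) :
    C.proj j A = A ↔ ∀ b, hs (C.T j b) A ≠ 0 → C.IsTriv j b.1 := by
  classical
  constructor
  · intro h b hb
    by_contra hn
    apply hb
    rw [← h, hs_proj, if_neg hn]
  · intro h
    refine C.ext_hs j fun b => ?_
    rw [hs_proj]
    split_ifs with ht
    · rfl
    · by_contra hn
      exact ht (h b (Ne.symm hn))

theorem proj_eq_zero_iff (j : ℕ) (A : Oper n d) :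
    C.proj j A = 0 ↔ ∀ b, hs (C.T j b) A ≠ 0 → ¬ C.IsTriv j b.1 := by
  classical
  constructor
  · intro h b hb ht
    apply hb
    have := C.hs_proj b A
    rwa [if_pos ht, h, hs_zero, eq_comm] at this
  · intro h
    refine C.ext_hs j fun b => ?_
    rw [hs_proj, hs_zero]
    split_ifs with ht
    · by_contra hn
      exact h b hn ht
    · rfl

theorem contraction_ne_zero_iff (i j : ℕ) (b : C.Label i) (c : C.Label j) :
    hs (C.T j c) (ad (C.wString i j)⁻¹ (C.T i b)) ≠ 0 ↔ C.contraction i j b c ≠ 0 := by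
  rw [contraction, hs_ad, ← hs_conj]
  simp

/-- The image at position `i` of a basis operator at position `j` transforms trivially. -/
def TrivLeft (i j : ℕ) (c : C.Label j) : Prop := ∀ b, C.contraction i j b c ≠ 0 → C.IsTriv i b.1

/-- The image at position `j` of a basis operator at position `i` transforms trivially. -/
def TrivRight (i j : ℕ) (b : C.Label i) : Prop := ∀ c, C.contraction i j b c ≠ 0 → C.IsTriv j c.1

variable {C} in
-- The dichotomy for projectors becomes one for supports: the labels in the image are all trivial or
-- all non-trivial, so a single label decides between the two.
theorem ControlledGrowth.left {D i j : ℕ} (h : C.ControlledGrowth D) (hij : i < j) (hj : j < D)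
    (c : C.Label j) (hc : ∀ l, i < l → l < j → C.TrivLeft l j c) :
    C.TrivLeft i j c ∨ ∀ b, C.contraction i j b c ≠ 0 → ¬ C.IsTriv i b.1 := by
  rcases h.1 i j hij hj c (fun l h1 h2 => (C.proj_eq_self_iff _ _).2 (hc l h1 h2)) with h | h
  · exact .inr ((C.proj_eq_zero_iff _ _).1 h)
  · exact .inl ((C.proj_eq_self_iff _ _).1 h)

variable {C} in
theorem ControlledGrowth.right {D i j : ℕ} (h : C.ControlledGrowth D) (hij : i < j) (hj : j < D)
    (b : C.Label i) (hb : ∀ l, i < l → l < j → C.TrivRight i l b) :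
    C.TrivRight i j b ∨ ∀ c, C.contraction i j b c ≠ 0 → ¬ C.IsTriv j c.1 := by
  rcases h.2 i j hij hj b (fun l h1 h2 => (C.proj_eq_self_iff _ _).2
    fun c hc => hb l h1 h2 c ((C.contraction_ne_zero_iff _ _ _ _).1 hc)) with h | h
  · exact .inr fun c hc => (C.proj_eq_zero_iff _ _).1 h c ((C.contraction_ne_zero_iff _ _ _ _).2 hc)
  · exact .inl fun c hc => (C.proj_eq_self_iff _ _).1 h c ((C.contraction_ne_zero_iff _ _ _ _).2 hc)

/-- The definition peels off the leftmost unitary; rows grow to the right, so their induction needs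
the rightmost one. -/
theorem window_succ (i k : ℕ) (A : Oper n d) :
    C.window i (k + 1) A = C.window i k (ad (C.W (i + k)) (C.proj (i + k + 1) A)) := by
  induction k generalizing i with
  | zero => simp [window]
  | succ k ih =>
    rw [window, ih, window]
    congr 4 <;> congr 1 <;> omega

theorem window_zero_op (i k : ℕ) : C.window i k 0 = 0 := by
  induction k generalizing i with
  | zero => simp [window, proj, hs_zero]
  | succ k ih => rw [window, ih, ad_zero]; simp [proj, hs_zero]

theorem proj_add (j : ℕ) (A B : Oper n d) : C.proj j (A + B) = C.proj j A + C.proj j B := by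
  simp [proj, hs_add, add_smul, Finset.sum_add_distrib]

theorem proj_smul (j : ℕ) (z : ℂ) (A : Oper n d) : C.proj j (z • A) = z • C.proj j A := by
  simp [proj, hs_smul, mul_smul, Finset.smul_sum]

theorem window_add (i k : ℕ) (A B : Oper n d) :
    C.window i k (A + B) = C.window i k A + C.window i k B := by
  induction k generalizing i with
  | zero => simp [window, proj_add]
  | succ k ih => simp [window, ih, ad_add, proj_add]

theorem window_smul (i k : ℕ) (z : ℂ) (A : Oper n d) :
    C.window i k (z • A) = z • C.window i k A := by
  induction k generalizing i with
  | zero => simp [window, proj_smul]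
  | succ k ih => simp [window, ih, ad_smul, proj_smul]

theorem window_sum {ι : Type*} (i k : ℕ) (S : Finset ι) (A : ι → Oper n d) :
    C.window i k (∑ a ∈ S, A a) = ∑ a ∈ S, C.window i k (A a) := by
  classical
  induction S using Finset.induction_on with
  | empty => simp [window_zero_op]
  | insert a S ha ih => simp [Finset.sum_insert ha, window_add, ih]

theorem conj_trace_T_mulVec (j : ℕ) (l : (C.basis j).Irr) (α : Fin ((C.basis j).mult l)) (g : G)
    (k : Fin ((C.basis j).dim l)) :
    (C.T j ⟨l, α, k⟩).trace = ∑ k', ((C.basis j).V l g :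
      Matrix (Fin ((C.basis j).dim l)) (Fin ((C.basis j).dim l)) ℂ) k' k *
        (C.T j ⟨l, α, k'⟩).trace := by
  rw [← ad_trace (C.U j g), (C.basis j).covariant g l α k]
  simp [Matrix.trace_sum]

/-- Only trivially transforming basis operators have a trace. -/
theorem isTriv_of_trace_ne_zero (j : ℕ) (b : C.Label j) (hb : (C.T j b).trace ≠ 0) :
    C.IsTriv j b.1 := by
  obtain ⟨l, α, k⟩ := b
  -- Conjugation preserves the trace, so the conjugated traces form a fixed vector of the irrep;
  -- conjugation converts the transposed coefficients at the inverse of `g` into those at `g`. A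
  -- non-zero fixed vector spans the irrep, which is then trivial.
  let t : Fin ((C.basis j).dim l) → ℂ := fun k => starRingEnd ℂ (C.T j ⟨l, α, k⟩).trace
  have ht : ∀ g, ((C.basis j).V l g : Matrix (Fin ((C.basis j).dim l))
      (Fin ((C.basis j).dim l)) ℂ) *ᵥ t = t := by
    intro g
    funext i
    simp only [Matrix.mulVec, dotProduct, t]
    rw [C.conj_trace_T_mulVec j l α g⁻¹ i, map_sum]
    refine Finset.sum_congr rfl fun i' _ => ?_
    rw [map_mul, map_inv, Matrix.UnitaryGroup.inv_apply, Matrix.star_apply]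
    simp
  have hspan := (C.basis j).irreducible l (Submodule.span ℂ {t}) (by
    intro g v hv
    obtain ⟨a, rfl⟩ := Submodule.mem_span_singleton.1 hv
    rw [Matrix.mulVec_smul, ht]
    exact hv)
  have htop : Submodule.span ℂ {t} = ⊤ := by
    refine hspan.resolve_left fun h => hb ?_
    have h0 : t = 0 := by simpa [Submodule.span_singleton_eq_bot] using h
    have := congrFun h0 k
    simpa [t] using this
  intro g
  apply Subtype.ext
  refine Matrix.ext_of_mulVec_single fun i => ?_
  obtain ⟨a, ha⟩ := Submodule.mem_span_singleton.1
    (htop ▸ Submodule.mem_top : (Pi.single i 1 : Fin ((C.basis j).dim l) → ℂ) ∈ Submodule.span ℂ {t})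
  rw [← ha, Matrix.mulVec_smul, ht]
  simp

end NoisyCircuit

/-! ### Sums over chains of labels -/

section Chains

variable {R : Type*} [CommRing R] {X : ℕ → Type*} [∀ j, Fintype (X j)]

/-- Row vectors propagated from position `0` through the kernels `K`. -/
def row (K : ∀ j, X j → X (j + 1) → R) (init : X 0 → R) : (l : ℕ) → X l → R
  | 0, b => init b
  | l + 1, c => ∑ b, row K init l b * K l b c

/-- Column vectors propagated backwards through `m` kernels. -/
def col (K : ∀ j, X j → X (j + 1) → R) (f : ∀ j, X j → R) : ℕ → (j : ℕ) → X j → R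
  | 0, j, b => f j b
  | m + 1, j, b => ∑ c, K j b c * col K f m (j + 1) c

/-- Row vectors for the kernels `K₀ + K₁`, resolved by the current number `r` of consecutive
kernels `K₀`, and restricted to chains without earlier runs of `B` consecutive kernels `K₀`. -/
def runRow (B : ℕ) (K₀ K₁ : ∀ j, X j → X (j + 1) → R) (init : X 0 → R) : (l r : ℕ) → X l → R
  | 0, 0, b => init b
  | 0, _ + 1, _ => 0
  | l + 1, 0, c => ∑ b, (∑ r ∈ Finset.range B, runRow B K₀ K₁ init l r b) * K₁ l b c
  | l + 1, r + 1, c => ∑ b, runRow B K₀ K₁ init l r b * K₀ l b c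

theorem sum_chain (K : ∀ j, X j → X (j + 1) → R) (init : X 0 → R) (D : ℕ) (f : X D → R) :
    ∑ b : ((i : Fin (D + 1)) → X i), init (b 0) *
      (∏ i : Fin D, K i (b i.castSucc) (b i.succ)) * f (b (Fin.last D)) =
      ∑ c, row K init D c * f c := by
  induction D with
  | zero =>
    refine Fintype.sum_equiv (Equiv.piUnique fun i : Fin 1 => X i) _ _ fun b => ?_
    simp [row]
  | succ D ih =>
    rw [← (Fin.snocEquiv fun i : Fin (D + 2) => X i).sum_comp, Fintype.sum_prod_type]
    refine Finset.sum_congr rfl fun c _ => ?_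
    rw [row, ← ih fun b => K D b c, Finset.sum_mul]
    refine Finset.sum_congr rfl fun b _ => ?_
    rw [Fin.prod_univ_castSucc]
    have h0 : (Fin.snocEquiv fun i : Fin (D + 2) => X i) (c, b) 0 = b 0 := by
      exact Fin.snoc_castSucc (α := fun i : Fin (D + 2) => X i) c b 0
    have h1 : ∀ i : Fin (D + 1),
        (Fin.snocEquiv fun i : Fin (D + 2) => X i) (c, b) i.castSucc = b i :=
      fun i => Fin.snoc_castSucc (α := fun i : Fin (D + 2) => X i) c b i
    have h2 : (Fin.snocEquiv fun i : Fin (D + 2) => X i) (c, b) (Fin.last (D + 1)) = c :=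
      Fin.snoc_last (α := fun i : Fin (D + 2) => X i) c b
    have h3 : ∀ i : Fin D,
        (Fin.snocEquiv fun i : Fin (D + 2) => X i) (c, b) i.castSucc.succ = b i.succ :=
      fun i => h1 i.succ
    have h4 : (Fin.snocEquiv fun i : Fin (D + 2) => X i) (c, b) (Fin.last D).succ = c := h2
    rw [h0, h2, h4, h1]
    have h5 : (∏ i : Fin D, K i.castSucc ((Fin.snocEquiv fun i : Fin (D + 2) => X i) (c, b)
        i.castSucc.castSucc) ((Fin.snocEquiv fun i : Fin (D + 2) => X i) (c, b) i.castSucc.succ)) =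
        ∏ i : Fin D, K i (b i.castSucc) (b i.succ) :=
      Finset.prod_congr rfl fun i _ => by rw [h1, h3]; rfl
    rw [h5, ← mul_assoc]
    rfl

theorem sum_row_mul_col (K : ∀ j, X j → X (j + 1) → R) (init : X 0 → R) (f : ∀ j, X j → R)
    (l m : ℕ) : ∑ b, row K init l b * col K f m l b = ∑ b, init b * col K f (l + m) 0 b := by
  induction l generalizing m with
  | zero => simp [row]
  | succ l ih =>
    rw [add_right_comm, add_assoc, ← ih (m + 1)]
    simp only [row, col, Finset.sum_mul, Finset.mul_sum]
    rw [Finset.sum_comm]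
    simp only [mul_assoc]

/-- Chains are split according to the step at which a run of `B` kernels `K₀` is completed for the
first time. From then on they are unrestricted, which is why the full columns appear behind the cut.
The first sum collects the chains with no completed run among the first `l` steps. -/
theorem sum_col_eq_add_sum_windows {B : ℕ} (hB : 0 < B) (K₀ K₁ : ∀ j, X j → X (j + 1) → R)
    (init : X 0 → R) (f : ∀ j, X j → R) (l m : ℕ) :
    ∑ b, init b * col (K₀ + K₁) f (l + m) 0 b =
      ∑ b, (∑ r ∈ Finset.range B, runRow B K₀ K₁ init l r b) * col (K₀ + K₁) f m l b +
      ∑ i ∈ Finset.range l, ∑ b, runRow B K₀ K₁ init (i + 1) B b *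
        col (K₀ + K₁) f (l + m - (i + 1)) (i + 1) b := by
  induction l generalizing m with
  | zero =>
    obtain ⟨B, rfl⟩ := Nat.exists_eq_succ_of_ne_zero hB.ne'
    simp [runRow, Finset.sum_range_succ']
  | succ l ih =>
    have e : l + 1 + m = l + (m + 1) := by omega
    rw [e, ih (m + 1), Finset.sum_range_succ]
    have hadd : ∀ x y z w : R, w = x + z → w + y = x + (y + z) := by rintro x y z _ rfl; ring
    refine hadd _ _ _ _ ?_
    have e2 : l + (m + 1) - (l + 1) = m := by omega
    rw [e2, ← Finset.sum_add_distrib]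
    simp only [col, Finset.mul_sum]
    rw [Finset.sum_comm]
    refine Finset.sum_congr rfl fun c _ => ?_
    rw [← add_mul, ← Finset.sum_range_succ (fun r => runRow B K₀ K₁ init (l + 1) r c),
      Finset.sum_range_succ', runRow]
    simp only [runRow]
    rw [Finset.sum_comm, ← Finset.sum_add_distrib, Finset.sum_mul]
    refine Finset.sum_congr rfl fun b _ => ?_
    rw [← Finset.sum_mul, Pi.add_apply, Pi.add_apply, Pi.add_apply]
    ring

/-- Pigeonhole: if no run of `B` kernels `K₀` has occurred, each kernel `K₁` accounts for at most
`B` steps (itself and the `K₀` before it). With `r` trailing `K₀`, at least (l - r)/B factors `K₁`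
are present. -/
theorem pow_dvd_runRow {B : ℕ} {z : R} {K₀ K₁ : ∀ j, X j → X (j + 1) → R}
    (hz : ∀ j b c, z ∣ K₁ j b c) (init : X 0 → R) (l r k : ℕ) (h : B * k + r < l + B) (b : X l) :
    z ^ k ∣ runRow B K₀ K₁ init l r b := by
  induction l generalizing r k with
  | zero =>
    cases r with
    | zero =>
      obtain rfl : k = 0 := by
        by_contra hk
        have := Nat.le_mul_of_pos_right B (Nat.pos_of_ne_zero hk)
        omega
      simp
    | succ r => simp [runRow]
  | succ l ih =>
    cases r with
    | zero =>
      rw [runRow]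
      cases k with
      | zero => simp
      | succ k =>
        refine Finset.dvd_sum fun b _ => ?_
        rw [pow_succ]
        refine mul_dvd_mul (Finset.dvd_sum fun r hr => ih r k ?_ b) (hz _ _ _)
        have := Finset.mem_range.1 hr
        rw [mul_add] at h
        omega
    | succ r =>
      rw [runRow]
      exact Finset.dvd_sum fun b _ => (ih r k (by omega) b).mul_right _

end Chains

/-! ### Truncation of polynomials -/

section Truncation

open Polynomial

/-- The sum of the coefficients up to degree `w`. -/
def tau (w : ℕ) : ℂ[X] →ₗ[ℂ] ℂ := ∑ i ∈ Finset.range (w + 1), Polynomial.lcoeff ℂ i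

theorem tau_apply (w : ℕ) (f : ℂ[X]) : tau w f = ∑ i ∈ Finset.range (w + 1), f.coeff i := by
  simp [tau, LinearMap.sum_apply]

theorem tau_C_mul (w : ℕ) (z : ℂ) (f : ℂ[X]) : tau w (C z * f) = z * tau w f := by
  rw [← smul_eq_C_mul, map_smul, smul_eq_mul]

theorem tau_C (w : ℕ) (z : ℂ) : tau w (C z) = z := by
  rw [tau_apply, Finset.sum_range_succ']
  simp [coeff_C_succ]

theorem tau_zero_X_mul (f : ℂ[X]) : tau 0 (X * f) = 0 := by
  simp [tau_apply]

theorem tau_succ_X_mul (w : ℕ) (f : ℂ[X]) : tau (w + 1) (X * f) = tau w f := by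
  rw [tau_apply, Finset.sum_range_succ', tau_apply]
  simp

theorem tau_eq_zero_of_dvd {w : ℕ} {f : ℂ[X]} (h : X ^ (w + 1) ∣ f) : tau w f = 0 := by
  rw [tau_apply]
  exact Finset.sum_eq_zero fun i hi => X_pow_dvd_iff.1 h i (Finset.mem_range.1 hi)

theorem tau_X_pow (w k : ℕ) : tau w (X ^ k) = if k ≤ w then 1 else 0 := by
  simp [tau_apply, coeff_X_pow, Finset.sum_ite_eq']

end Truncation

namespace NoisyCircuit

/-! ### Path sums as polynomials counting non-trivial layers -/

variable {G : Type*} [Group G] [TopologicalSpace G] {n d : ℕ} (C : NoisyCircuit G n d)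

/-- The label with another component of the same irrep. -/
def relabel {j : ℕ} (b : C.Label j) (k : Fin ((C.basis j).dim b.1)) : C.Label j := ⟨b.1, b.2.1, k⟩

theorem IsTriv.relabel_eq {C : NoisyCircuit G n d} {j : ℕ} {b : C.Label j} (h : C.IsTriv j b.1)
    (k : Fin ((C.basis j).dim b.1)) : C.relabel b k = b := by
  obtain ⟨l, α, k'⟩ := b
  have : (C.basis j).dim l = 1 := h.dim_eq_one
  have hk : k = k' := by
    ext
    have h1 : k.1 < (C.basis j).dim l := k.2
    have h2 := k'.2
    omega
  rw [hk]
  rfl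

/-- Layer amplitudes: a number for each label before, and component after, the layer. -/
abbrev Amplitude : Type := (j : ℕ) → (b : C.Label j) → Fin ((C.basis j).dim b.1) → ℂ

open Classical in
/-- Trivial part of the transfer kernel. -/
def kerTriv (j : ℕ) (b : C.Label j) (c : C.Label (j + 1)) : Polynomial ℂ :=
  if C.IsTriv j b.1 then Polynomial.C (C.step j b c) else 0

open Classical in
/-- Non-trivial part of the transfer kernel, marked by the variable. -/
def kerNontriv (amp : C.Amplitude) (j : ℕ) (b : C.Label j) (c : C.Label (j + 1)) : Polynomial ℂ :=
  if C.IsTriv j b.1 then 0 else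
    Polynomial.X * Polynomial.C (∑ k, amp j b k * C.step j (C.relabel b k) c)

/-- The transfer kernel. -/
def ker (amp : C.Amplitude) : ∀ j, C.Label j → C.Label (j + 1) → Polynomial ℂ :=
  C.kerTriv + C.kerNontriv amp

theorem ker_of_triv (amp : C.Amplitude) {j : ℕ} {b : C.Label j} (h : C.IsTriv j b.1)
    (c : C.Label (j + 1)) : C.ker amp j b c = Polynomial.C (C.step j b c) := by
  simp [ker, kerTriv, kerNontriv, h]

theorem ker_of_not_triv (amp : C.Amplitude) {j : ℕ} {b : C.Label j} (h : ¬ C.IsTriv j b.1)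
    (c : C.Label (j + 1)) : C.ker amp j b c =
      Polynomial.X * Polynomial.C (∑ k, amp j b k * C.step j (C.relabel b k) c) := by
  simp [ker, kerTriv, kerNontriv, h]

/-- Overlap of basis operators with the input state. -/
def overlap [NeZero d] (j : ℕ) (b : C.Label j) : Polynomial ℂ :=
  Polynomial.C (starRingEnd ℂ (C.T j b 0 0))

/-- The kernel carries one factor X for each non-trivial layer, so the degree of a path is its
weight, and `tau L` keeps the light paths and sets X to 1. The amplitude must be 1 on trivial irreps
because the trivial kernel contains no amplitude. -/
theorem sum_path_eq_tau [NeZero d] (amp : C.Amplitude) (D L : ℕ)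
    (hamp : ∀ j < D, ∀ b : C.Label j, C.IsTriv j b.1 → ∀ k, amp j b k = 1)
    (init : C.Label 0 → ℂ) :
    ∑ q : C.Path D with q.weight ≤ L, init (q.1 0) *
      (∏ i : Fin D, amp i (q.1 i.castSucc) (q.2 i) * q.transfer i) *
        starRingEnd ℂ (C.T _ (q.1 (Fin.last D)) 0 0) =
    tau L (∑ c, row (C.ker amp) (fun b => Polynomial.C (init b)) D c * C.overlap D c) := by
  classical
  rw [← sum_chain, map_sum, Finset.sum_filter, Fintype.sum_sigma]
  refine Finset.sum_congr rfl fun b _ => ?_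
  have hker : ∀ i : Fin D, C.ker amp i (b i.castSucc) (b i.succ) =
      Polynomial.X ^ (if ¬ C.IsTriv i.castSucc (b i.castSucc).1 then 1 else 0) *
        Polynomial.C (∑ k, amp i (b i.castSucc) k *
          C.step i (C.relabel (b i.castSucc) k) (b i.succ)) := by
    intro i
    by_cases h : C.IsTriv i.castSucc (b i.castSucc).1
    · rw [if_neg (not_not.2 h), pow_zero, one_mul]
      refine (C.ker_of_triv amp (j := i) h _).trans ?_
      congr 1
      rw [Finset.sum_congr rfl fun k _ => by
        rw [hamp i i.2 _ h k, IsTriv.relabel_eq (C := C) (j := i) h k]]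
      -- A trivial irrep has a single component, so the sum over components is one term.
      have h1 := IsTriv.dim_eq_one (C := C) (j := i) h
      simp only [Finset.sum_const, Finset.card_univ, Fintype.card_fin]
      erw [h1]; simp
    · rw [if_pos h, pow_one]
      exact C.ker_of_not_triv amp (j := i) h _
  rw [Finset.prod_congr rfl fun i _ => hker i, Finset.prod_mul_distrib, Finset.prod_pow_eq_pow_sum,
    ← map_prod, overlap]
  have hw : ∀ k, Path.weight (C := C) ⟨b, k⟩ =
      ∑ i : Fin D, if ¬ C.IsTriv i.castSucc (b i.castSucc).1 then 1 else 0 := fun k => by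
    rw [Path.weight, Finset.card_filter]
  have hre : ∀ (x y z : ℂ) (w : ℕ), Polynomial.C x * (Polynomial.X ^ w * Polynomial.C y) *
      Polynomial.C z = Polynomial.C (x * y * z) * Polynomial.X ^ w := by
    intro x y z w
    simp only [map_mul]; ring
  rw [hre, tau_C_mul, tau_X_pow]
  simp only [hw]
  split_ifs with hle
  · rw [Finset.prod_univ_sum, Fintype.piFinset_univ, mul_one, Finset.mul_sum, Finset.sum_mul]
    rfl
  · simp

/-! ### Decomposition at the first long run of trivial layers -/

variable (M : ℕ) (amp : C.Amplitude) (init : C.Label 0 → ℂ)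

/-- Rows resolved by the current run of trivial layers. -/
def runs (l r : ℕ) (b : C.Label l) : Polynomial ℂ :=
  runRow (M + 2) C.kerTriv (C.kerNontriv amp) (fun b => Polynomial.C (init b)) l r b

/-- Columns that start after a layer. -/
def fwd [NeZero d] (m j : ℕ) (b : C.Label j) : Polynomial ℂ :=
  ∑ c, Polynomial.C (C.step j b c) * col (C.ker amp) C.overlap m (j + 1) c

theorem runs_eq_zero {l r : ℕ} (h : l < r) (b : C.Label l) : C.runs M amp init l r b = 0 := by
  induction l generalizing r with
  | zero =>
    obtain ⟨r, rfl⟩ := Nat.exists_eq_succ_of_ne_zero (Nat.ne_of_gt h)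
    rfl
  | succ l ih =>
    obtain ⟨r, rfl⟩ := Nat.exists_eq_succ_of_ne_zero (Nat.ne_zero_of_lt h)
    refine Finset.sum_eq_zero fun b _ => ?_
    have := ih (r := r) (by omega) b
    rw [runs] at this
    rw [this, zero_mul]

theorem runs_succ_succ (l r : ℕ) (c : C.Label (l + 1)) :
    C.runs M amp init (l + 1) (r + 1) c = ∑ b, C.runs M amp init l r b * C.kerTriv l b c := rfl

theorem runs_succ_zero (l : ℕ) (c : C.Label (l + 1)) :
    C.runs M amp init (l + 1) 0 c =
      ∑ b, (∑ r ∈ Finset.range (M + 2), C.runs M amp init l r b) * C.kerNontriv amp l b c := rfl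

/-- A run of `k + 1` trivial layers ending here began at position `i` with counter 0. The projectors
of the window are these trivial layers; the last unitary lies outside and acts on the operator at
the end. -/
theorem runs_window (i k : ℕ) (c : C.Label (i + k + 1)) :
    C.runs M amp init (i + k + 1) (k + 1) c = ∑ b, C.runs M amp init i 0 b *
      Polynomial.C (hs (C.T i b) (C.window i k (ad (C.W (i + k)) (C.T (i + k + 1) c)))) := by
  classical
  induction k with
  | zero =>
    rw [runs_succ_succ]
    refine Finset.sum_congr rfl fun b _ => ?_
    rw [window, hs_proj, kerTriv]
    split_ifs
    · rfl
    · rw [map_zero]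
  | succ k ih =>
    rw [runs_succ_succ]
    refine (Finset.sum_congr rfl fun b _ =>
      congrArg (· * C.kerTriv (i + (k + 1)) b c) (ih b)).trans ?_
    simp only [Finset.sum_mul]
    rw [Finset.sum_comm]
    refine Finset.sum_congr rfl fun b _ => ?_
    simp only [mul_assoc]
    rw [← Finset.mul_sum, window_succ]
    congr 1
    rw [proj, ad_sum, window_sum, hs_sum, map_sum, Finset.sum_filter]
    refine Finset.sum_congr rfl fun b' _ => ?_
    rw [kerTriv]
    by_cases h : C.IsTriv (i + k + 1) b'.1
    · rw [if_pos (show C.IsTriv (i + (k + 1)) b'.1 from h), if_pos h, ad_smul, window_smul,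
        hs_smul, ← map_mul, mul_comm]
      rfl
    · rw [if_neg (show ¬ C.IsTriv (i + (k + 1)) b'.1 from h), if_neg h, mul_zero]

/-- The cut at the first M+2 consecutive trivial layers. These sit at positions i, …, i+M+1 and
enclose the M+1 unitaries of a window. Counter 0 in front of the window says that the run starts
exactly at `i`, so each path is counted once. -/
theorem tau_sum_row_eq_sum_windows [NeZero d] {D L : ℕ} (hD : (M + 2) * (L + 1) ≤ D) :
    tau L (∑ c, row (C.ker amp) (fun b => Polynomial.C (init b)) D c * C.overlap D c) =
      ∑ i ∈ Finset.range (D - (M + 1)), ∑ b : C.Label i, ∑ c : C.Label (i + M + 1),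
        C.windowEntry i M b c *
          tau L (C.runs M amp init i 0 b * C.fwd amp (D - (i + M + 2)) (i + M + 1) c) := by
  have h := sum_row_mul_col (C.ker amp) (fun b => Polynomial.C (init b)) C.overlap D 0
  simp only [col] at h
  have hdec := sum_col_eq_add_sum_windows (B := M + 2) (by omega) C.kerTriv (C.kerNontriv amp)
    (fun b => Polynomial.C (init b)) C.overlap D 0
  have hM : M + 2 ≤ D := le_trans (Nat.le_mul_of_pos_right _ (by omega)) hD
  rw [ker] at h ⊢
  -- Chains without a complete run carry the factor X^(L+1), by the bound on `D`, and are removed by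
  -- the truncation.
  rw [h, hdec, map_add, tau_eq_zero_of_dvd, zero_add]
  swap
  · refine Finset.dvd_sum fun b _ => Dvd.dvd.mul_right (Finset.dvd_sum fun r hr => ?_) _
    refine pow_dvd_runRow (fun j b c => ?_) _ _ _ _ ?_ _
    · rw [kerNontriv]
      split_ifs
      · exact dvd_zero _
      · exact dvd_mul_right _ _
    · have := Finset.mem_range.1 hr
      omega
  -- A run of M+2 layers cannot be complete before step M+2, so the first M+1 summands vanish; the
  -- others are indexed by the start of the run.
  have hsplit : D = (M + 1) + (D - (M + 1)) := by omega
  rw [show Finset.range D = Finset.range ((M + 1) + (D - (M + 1))) by rw [← hsplit],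
    Finset.sum_range_add, Finset.sum_eq_zero, zero_add, map_sum]
  · refine Finset.sum_congr rfl fun i _ => ?_
    have hcomm : M + 1 + i = i + (M + 1) := by omega
    rw [hcomm]
    have hidx : D + 0 - (i + (M + 1) + 1) = D - (i + M + 2) := by omega
    rw [hidx, ← ker]
    have h1 : ∀ c : C.Label (i + (M + 1) + 1), runRow (M + 2) C.kerTriv (C.kerNontriv amp)
        (fun b => Polynomial.C (init b)) (i + (M + 1) + 1) (M + 2) c =
        ∑ b : C.Label i, ∑ a : C.Label (i + M + 1), C.runs M amp init i 0 b *
          Polynomial.C (C.windowEntry i M b a * C.step (i + M + 1) a c) := by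
      intro c
      refine (C.runs_window M amp init i (M + 1) c).trans ?_
      refine Finset.sum_congr rfl fun b _ => ?_
      rw [← Finset.mul_sum, ← map_sum]
      congr 2
      rw [(C.basis (i + M + 1)).complete (ad (C.W (i + (M + 1))) (C.T (i + (M + 1) + 1) c)),
        window_sum, hs_sum]
      refine Finset.sum_congr rfl fun a _ => ?_
      rw [window_smul, hs_smul, mul_comm]
      rfl
    simp only [h1, Finset.sum_mul]
    rw [Finset.sum_comm, map_sum]
    refine Finset.sum_congr rfl fun b _ => ?_
    rw [Finset.sum_comm, map_sum]
    refine Finset.sum_congr rfl fun a _ => ?_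
    rw [← tau_C_mul, fwd, Finset.mul_sum, Finset.mul_sum]
    congr 1
    refine Finset.sum_congr rfl fun c _ => ?_
    rw [map_mul]
    exact (by intros; ring : ∀ r w s x : Polynomial ℂ, r * (w * s) * x = w * (r * (s * x))) _ _ _ _
  · intro i hi
    have := Finset.mem_range.1 hi
    refine Finset.sum_eq_zero fun b _ => ?_
    have h0 := C.runs_eq_zero M amp init (l := i + 1) (r := M + 2) (by omega) b
    rw [runs] at h0
    rw [h0, zero_mul]

/-! ### Forward scans -/

/-- As long as the images are trivial, the kernels are the bare unitaries, and their product is a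
single contraction from the original label. This is what lets the search pass trivial layers without
branching. -/
theorem fwd_eq_sum_contraction [NeZero d] (j p m : ℕ) (b : C.Label j)
    (h : ∀ l, j < l → l < j + 1 + p → C.TrivRight j l b) :
    C.fwd amp (p + m) j b = ∑ c : C.Label (j + 1 + p),
      Polynomial.C (C.contraction j (j + 1 + p) b c) * col (C.ker amp) C.overlap m (j + 1 + p) c := by
  classical
  induction p generalizing m with
  | zero =>
    rw [fwd, Nat.zero_add]
    refine Finset.sum_congr rfl fun c _ => ?_
    have : C.contraction j (j + 1) b c = C.step j b c := by
      rw [contraction_succ_right C le_rfl]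
      simp [contraction_self]
    rw [← this]
  | succ p ih =>
    have e : p + 1 + m = p + (m + 1) := by omega
    rw [e, ih (m + 1) fun l h1 h2 => h l h1 (by omega)]
    have h1 : ∀ c : C.Label (j + 1 + p), Polynomial.C (C.contraction j (j + 1 + p) b c) *
        col (C.ker amp) C.overlap (m + 1) (j + 1 + p) c = ∑ c' : C.Label (j + 1 + p + 1),
          Polynomial.C (C.contraction j (j + 1 + p) b c * C.step (j + 1 + p) c c') *
            col (C.ker amp) C.overlap m (j + 1 + p + 1) c' := by
      intro c
      by_cases hc : C.contraction j (j + 1 + p) b c = 0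
      · simp [hc]
      · have ht := h (j + 1 + p) (by omega) (by omega) c hc
        rw [col, Finset.mul_sum]
        refine Finset.sum_congr rfl fun c' _ => ?_
        rw [ker_of_triv C amp ht, map_mul, mul_assoc]
    rw [Finset.sum_congr rfl fun c _ => h1 c, Finset.sum_comm]
    refine Finset.sum_congr rfl fun c' _ => ?_
    rw [← Finset.sum_mul, ← map_sum, ← contraction_succ_right C (by omega)]
    rfl

theorem tau_fwd_end [NeZero d] {D j : ℕ} (hj : j < D) (b : C.Label j)
    (h : ∀ l, j < l → l < D → C.TrivRight j l b) (w : ℕ) :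
    tau w (C.fwd amp (D - (j + 1)) j b) =
      ∑ c : C.Label D, C.contraction j D b c * starRingEnd ℂ (C.T D c 0 0) := by
  obtain ⟨p, rfl⟩ : ∃ p, D = j + 1 + p := ⟨D - (j + 1), by omega⟩
  have e : j + 1 + p - (j + 1) = p + 0 := by omega
  rw [e, C.fwd_eq_sum_contraction amp j p 0 b h, map_sum]
  refine Finset.sum_congr rfl fun c _ => ?_
  rw [tau_C_mul, col, overlap, tau_C]

/-- At the first non-trivial position all labels in the image are non-trivial, so the same factor X
comes out of every branch. Each such factor lowers the truncation degree by one and ends the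
recursion at budget 0. -/
theorem fwd_nontriv [NeZero d] {D j i : ℕ} (hji : j < i) (hi : i < D) (b : C.Label j)
    (h : ∀ l, j < l → l < i → C.TrivRight j l b)
    (hn : ∀ c : C.Label i, C.contraction j i b c ≠ 0 → ¬ C.IsTriv i c.1) :
    C.fwd amp (D - (j + 1)) j b = Polynomial.X * ∑ c : C.Label i,
      Polynomial.C (C.contraction j i b c) *
        ∑ k, Polynomial.C (amp i c k) * C.fwd amp (D - (i + 1)) i (C.relabel c k) := by
  obtain ⟨p, rfl⟩ : ∃ p, i = j + 1 + p := ⟨i - (j + 1), by omega⟩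
  have e : D - (j + 1) = p + ((D - (j + 1 + p + 1)) + 1) := by omega
  rw [e, C.fwd_eq_sum_contraction amp j p _ b h, Finset.mul_sum]
  refine Finset.sum_congr rfl fun c _ => ?_
  by_cases hc : C.contraction j (j + 1 + p) b c = 0
  · simp [hc]
  · rw [mul_left_comm, col]
    congr 1
    have ht := hn c hc
    simp only [C.ker_of_not_triv amp ht, fwd, Finset.mul_sum, map_sum, map_mul, Finset.sum_mul]
    rw [Finset.sum_comm]
    refine Finset.sum_congr rfl fun k _ => Finset.sum_congr rfl fun c' _ => ?_
    ring

theorem tau_zero_fwd [NeZero d] {D j i : ℕ} (hji : j < i) (hi : i < D) (b : C.Label j)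
    (h : ∀ l, j < l → l < i → C.TrivRight j l b)
    (hn : ∀ c : C.Label i, C.contraction j i b c ≠ 0 → ¬ C.IsTriv i c.1) :
    tau 0 (C.fwd amp (D - (j + 1)) j b) = 0 := by
  rw [C.fwd_nontriv amp hji hi b h hn, tau_zero_X_mul]

theorem tau_succ_fwd [NeZero d] {D j i : ℕ} (hji : j < i) (hi : i < D) (b : C.Label j)
    (h : ∀ l, j < l → l < i → C.TrivRight j l b)
    (hn : ∀ c : C.Label i, C.contraction j i b c ≠ 0 → ¬ C.IsTriv i c.1) (w : ℕ) :
    tau (w + 1) (C.fwd amp (D - (j + 1)) j b) = ∑ c : C.Label i, C.contraction j i b c *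
      ∑ k, amp i c k * tau w (C.fwd amp (D - (i + 1)) i (C.relabel c k)) := by
  rw [C.fwd_nontriv amp hji hi b h hn, tau_succ_X_mul, map_sum]
  simp only [tau_C_mul, map_sum]

/-! ### Backward scans -/

/-- The part of the row at position `l` with at most `ρ` further trivial layers before `i`. -/
def scan (i l ρ : ℕ) (b : C.Label l) : Polynomial ℂ :=
  ∑ a : C.Label i, Polynomial.C (C.contraction i l a b) *
    ∑ r ∈ Finset.range (ρ + 1), C.runs M amp init i r a

theorem scan_self (l ρ : ℕ) (b : C.Label l) : C.scan M amp init l l ρ b =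
    ∑ r ∈ Finset.range (ρ + 1), C.runs M amp init l r b := by
  simp only [scan, contraction_self, apply_ite Polynomial.C, map_one, map_zero, ite_mul, one_mul,
    zero_mul, Finset.sum_ite_eq', Finset.mem_univ, if_true]

theorem scan_zero (l ρ : ℕ) (b : C.Label l) : C.scan M amp init 0 l ρ b =
    Polynomial.C (∑ a : C.Label 0, C.contraction 0 l a b * init a) := by
  rw [scan, map_sum]
  refine Finset.sum_congr rfl fun a _ => ?_
  rw [map_mul, Finset.sum_range_succ', Finset.sum_eq_zero, zero_add]
  · rfl
  · exact fun r _ => rfl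

theorem sum_runs_succ (l ρ : ℕ) (c : C.Label (l + 1)) :
    ∑ r ∈ Finset.range (ρ + 1), C.runs M amp init (l + 1) r c =
      ∑ b, (∑ r ∈ Finset.range (M + 2), C.runs M amp init l r b) * C.kerNontriv amp l b c +
      ∑ b, (∑ r ∈ Finset.range ρ, C.runs M amp init l r b) * C.kerTriv l b c := by
  rw [Finset.sum_range_succ', runs_succ_zero, add_comm]
  simp only [runs_succ_succ, Finset.sum_mul]
  rw [Finset.sum_comm (s := Finset.range ρ)]

theorem scan_succ {i l : ℕ} (ρ : ℕ) (b : C.Label l) :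
    C.scan M amp init (i + 1) l ρ b = (∑ a : C.Label i, ∑ c : C.Label (i + 1),
      (∑ r ∈ Finset.range (M + 2), C.runs M amp init i r a) * (C.kerNontriv amp i a c *
        Polynomial.C (C.contraction (i + 1) l c b))) +
      ∑ a : C.Label i, ∑ c : C.Label (i + 1),
        (∑ r ∈ Finset.range ρ, C.runs M amp init i r a) * (C.kerTriv i a c *
          Polynomial.C (C.contraction (i + 1) l c b)) := by
  rw [scan]
  simp only [sum_runs_succ, mul_add, Finset.sum_add_distrib]
  congr 1
  · simp only [Finset.mul_sum]
    rw [Finset.sum_comm]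
    refine Finset.sum_congr rfl fun a _ => Finset.sum_congr rfl fun c _ => ?_
    ring
  · simp only [Finset.mul_sum]
    rw [Finset.sum_comm]
    refine Finset.sum_congr rfl fun a _ => Finset.sum_congr rfl fun c _ => ?_
    ring

theorem sum_kerTriv_mul {i l : ℕ} (h : i < l) (a : C.Label i) (b : C.Label l)
    [Decidable (C.IsTriv i a.1)] : ∑ c, C.kerTriv i a c *
      Polynomial.C (C.contraction (i + 1) l c b) =
        if C.IsTriv i a.1 then Polynomial.C (C.contraction i l a b) else 0 := by
  rw [contraction_succ_left C h, map_sum]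
  simp only [kerTriv]
  split_ifs with ht
  · simp
  · simp

theorem sum_kerNontriv_mul {i l : ℕ} (h : i < l) (a : C.Label i) (b : C.Label l)
    [Decidable (C.IsTriv i a.1)] : ∑ c, C.kerNontriv amp i a c *
      Polynomial.C (C.contraction (i + 1) l c b) =
        if C.IsTriv i a.1 then 0 else Polynomial.X *
          ∑ k, Polynomial.C (amp i a k * C.contraction i l (C.relabel a k) b) := by
  simp only [kerNontriv]
  split_ifs with ht
  · simp
  · simp only [mul_assoc]
    rw [← Finset.mul_sum]
    congr 1
    simp only [contraction_succ_left C h, ← map_mul, ← map_sum, Finset.mul_sum, Finset.sum_mul]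
    rw [Finset.sum_comm]
    simp only [mul_assoc]

/-- A change of component keeps the irrep, so a trivial image receives nothing from the non-trivial
kernel. The trivial kernel extends the contraction by one unitary and uses one of the trivial layers
still allowed. With none left the result is zero. -/
theorem scan_triv {i l : ℕ} (h : i < l) (ρ : ℕ) (b : C.Label l) (ht : C.TrivLeft i l b) :
    C.scan M amp init (i + 1) l ρ b = ∑ a : C.Label i, Polynomial.C (C.contraction i l a b) *
      ∑ r ∈ Finset.range ρ, C.runs M amp init i r a := by
  classical
  rw [scan_succ C M amp init]
  simp only [← Finset.mul_sum, C.sum_kerTriv_mul h, C.sum_kerNontriv_mul amp h]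
  rw [Finset.sum_eq_zero, zero_add]
  · refine Finset.sum_congr rfl fun a _ => ?_
    split_ifs with hta
    · ring
    · have : C.contraction i l a b = 0 := by
        by_contra h0
        exact hta (ht a h0)
      simp [this]
  · intro a _
    split_ifs with hta
    · simp
    · have : ∀ k, C.contraction i l (C.relabel a k) b = 0 := fun k => by
        by_contra h0
        exact hta (ht (C.relabel a k) h0)
      simp [this]

theorem scan_triv_zero {i l : ℕ} (h : i < l) (b : C.Label l) (ht : C.TrivLeft i l b) :
    C.scan M amp init (i + 1) l 0 b = 0 := by
  rw [C.scan_triv M amp init h 0 b ht]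
  simp

theorem scan_triv_succ {i l : ℕ} (h : i < l) (ρ : ℕ) (b : C.Label l) (ht : C.TrivLeft i l b) :
    C.scan M amp init (i + 1) l (ρ + 1) b = C.scan M amp init i l ρ b :=
  C.scan_triv M amp init h (ρ + 1) b ht

/-- Exchanges the components before and after a layer, to pass between sums organised by the label
on either side of it. -/
theorem sum_label_swap {R : Type*} [AddCommMonoid R] (j : ℕ)
    (F : (b : C.Label j) → Fin ((C.basis j).dim b.1) → R) :
    ∑ b, ∑ k, F b k = ∑ b, ∑ k, F (C.relabel b k) b.2.2 := by
  simp only [Fintype.sum_sigma, Fintype.sum_prod_type]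
  refine Finset.sum_congr rfl fun l _ => Finset.sum_congr rfl fun α _ => ?_
  have hswap : ∀ f : Fin ((C.basis j).dim l) → Fin ((C.basis j).dim l) → R,
    ∑ y, ∑ k, f y k = ∑ k, ∑ y, f y k := fun f => Finset.sum_comm
  exact hswap fun y k => F ⟨l, (α, y)⟩ k

/-- A non-trivial layer ends the run, so `ρ` disappears: before it any run shorter than M+2 is
allowed. The components are swapped because the backward search meets the label behind the layer
first. -/
theorem scan_nontriv {i l : ℕ} (h : i < l) (ρ : ℕ) (b : C.Label l)
    (hn : ∀ a, C.contraction i l a b ≠ 0 → ¬ C.IsTriv i a.1) :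
    C.scan M amp init (i + 1) l ρ b = Polynomial.X * ∑ a : C.Label i,
      Polynomial.C (C.contraction i l a b) * ∑ k, Polynomial.C (amp i (C.relabel a k) a.2.2) *
        ∑ r ∈ Finset.range (M + 2), C.runs M amp init i r (C.relabel a k) := by
  classical
  rw [scan_succ C M amp init]
  simp only [← Finset.mul_sum, C.sum_kerTriv_mul h, C.sum_kerNontriv_mul amp h]
  rw [add_comm, Finset.sum_eq_zero, zero_add]
  · have h1 : ∀ a : C.Label i, ((∑ r ∈ Finset.range (M + 2), C.runs M amp init i r a) *
        if C.IsTriv i a.1 then 0 else Polynomial.X *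
          ∑ k, Polynomial.C (amp i a k * C.contraction i l (C.relabel a k) b)) =
        ∑ k, Polynomial.X * (Polynomial.C (C.contraction i l (C.relabel a k) b) *
          (Polynomial.C (amp i a k) * ∑ r ∈ Finset.range (M + 2), C.runs M amp init i r a)) := by
      intro a
      split_ifs with hta
      · have : ∀ k, C.contraction i l (C.relabel a k) b = 0 := fun k => by
          by_contra h0
          exact hn (C.relabel a k) h0 hta
        simp [this]
      · rw [Finset.mul_sum, Finset.mul_sum]
        refine Finset.sum_congr rfl fun k _ => ?_
        rw [map_mul]; ring
    rw [Finset.sum_congr rfl fun a _ => h1 a, sum_label_swap, Finset.mul_sum]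
    refine Finset.sum_congr rfl fun a _ => ?_
    rw [Finset.mul_sum, Finset.mul_sum]
    rfl
  · intro a _
    split_ifs with hta
    · have : C.contraction i l a b = 0 := by
        by_contra h0
        exact hn a h0 hta
      simp [this]
    · simp

/-- The trace is propagated without change. -/
theorem sum_trace_mul_col [NeZero d] (m j : ℕ) : ∑ b : C.Label j, Polynomial.C (C.T j b).trace *
    col (C.ker amp) C.overlap m j b = 1 := by
  induction m generalizing j with
  | zero =>
    simp only [col, overlap, ← map_mul]
    rw [← map_sum, ← map_one Polynomial.C]
    congr 1
    have h := congrArg Matrix.trace ((C.basis j).complete (Matrix.single (0 : Outcome n d) 0 1))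
    rw [Matrix.trace_single_eq_same, Matrix.trace_sum] at h
    rw [h]
    refine Finset.sum_congr rfl fun b _ => ?_
    rw [Matrix.trace_smul, smul_eq_mul, mul_comm, hs, Matrix.trace_mul_single]
    simp
  | succ m ih =>
    rw [← ih (j + 1)]
    have h1 : ∀ b : C.Label j, Polynomial.C (C.T j b).trace *
        col (C.ker amp) C.overlap (m + 1) j b = ∑ c, Polynomial.C ((C.T j b).trace *
          C.step j b c) * col (C.ker amp) C.overlap m (j + 1) c := by
      intro b
      by_cases hb : (C.T j b).trace = 0
      · simp [hb]
      · have ht := C.isTriv_of_trace_ne_zero j b hb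
        rw [col, Finset.mul_sum]
        refine Finset.sum_congr rfl fun c _ => ?_
        rw [C.ker_of_triv amp ht, map_mul, mul_assoc]
    rw [Finset.sum_congr rfl fun b _ => h1 b, Finset.sum_comm]
    refine Finset.sum_congr rfl fun c _ => ?_
    rw [← Finset.sum_mul, ← map_sum]
    congr 2
    rw [← ad_trace (C.W j)]
    conv_rhs => rw [(C.basis j).complete (ad (C.W j) (C.T (j + 1) c))]
    rw [Matrix.trace_sum]
    refine Finset.sum_congr rfl fun b _ => ?_
    rw [Matrix.trace_smul, smul_eq_mul, mul_comm]
    rfl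

end NoisyCircuit

namespace NoisyCircuit

/-! ### Schur orthogonality -/

section Schur

variable {G : Type*} [Group G] [TopologicalSpace G] {n d : ℕ} (C : NoisyCircuit G n d)

/-- Matrix coefficients of the irreps at position `j`. -/
def coeff (j : ℕ) (l : (C.basis j).Irr) (g : G) :
    Matrix (Fin ((C.basis j).dim l)) (Fin ((C.basis j).dim l)) ℂ := (C.basis j).V l g

theorem coeff_mul (j : ℕ) (l : (C.basis j).Irr) (g h : G) :
    C.coeff j l (g * h) = C.coeff j l g * C.coeff j l h := by
  simp [coeff]

theorem conjTranspose_mul_coeff (j : ℕ) (l : (C.basis j).Irr) (g : G) :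
    (C.coeff j l g)ᴴ * C.coeff j l g = 1 := by
  exact Matrix.mem_unitaryGroup_iff'.1 ((C.basis j).V l g).2

theorem norm_coeff_le (j : ℕ) (l : (C.basis j).Irr) (g : G) (k k' : Fin ((C.basis j).dim l)) :
    ‖C.coeff j l g k k'‖ ≤ 1 :=
  entry_norm_bound_of_unitary ((C.basis j).V l g).2 k k'

/-- Continuity is assumed of the representations `U` only. This formula transfers it to the irreps,
using that each of them occurs with positive multiplicity. -/
theorem coeff_eq_hs (j : ℕ) (l : (C.basis j).Irr) (α : Fin ((C.basis j).mult l)) (g : G)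
    (k k' : Fin ((C.basis j).dim l)) :
    C.coeff j l g k k' = hs (C.T j ⟨l, α, k⟩) (ad (C.U j g) (C.T j ⟨l, α, k'⟩)) := by
  rw [(C.basis j).covariant g l α k', hs_sum, Finset.sum_eq_single k]
  · rw [hs_smul, hs_T_T, if_pos rfl, mul_one]; rfl
  · intro b _ hb
    rw [hs_smul, hs_T_T, if_neg, mul_zero]
    simpa using hb.symm
  · simp

theorem continuous_coeff (j : ℕ) (l : (C.basis j).Irr) (k k' : Fin ((C.basis j).dim l)) :
    Continuous fun g => C.coeff j l g k k' := by
  simp only [C.coeff_eq_hs j l ⟨0, (C.basis j).mult_pos l⟩, hs, ad]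
  have := C.continuous_U j
  exact (continuous_const.matrix_mul ((this.matrix_mul continuous_const).matrix_mul
    this.matrix_conjTranspose)).matrix_trace

/-- Indices of matrix coefficients. -/
abbrev CoeffIndex (j : ℕ) : Type :=
  Σ l : (C.basis j).Irr, Fin ((C.basis j).dim l) × Fin ((C.basis j).dim l)

/-- Products of matrix coefficients, one for each layer. -/
def coeffProd {D : ℕ} (θ : (i : Fin D) → C.CoeffIndex i) (g : Fin D → G) : ℂ :=
  ∏ i : Fin D, C.coeff i (θ i).1 (g i) (θ i).2.1 (θ i).2.2

theorem norm_coeffProd_le {D : ℕ} (θ : (i : Fin D) → C.CoeffIndex i) (g : Fin D → G) :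
    ‖C.coeffProd θ g‖ ≤ 1 := by
  rw [coeffProd, norm_prod]
  exact Finset.prod_le_one (fun _ _ => norm_nonneg _) fun i _ => C.norm_coeff_le _ _ _ _ _

variable [MeasurableSpace G] [BorelSpace G]

theorem measurable_coeff (j : ℕ) (l : (C.basis j).Irr) (k k' : Fin ((C.basis j).dim l)) :
    Measurable fun g => C.coeff j l g k k' := (C.continuous_coeff j l k k').measurable

theorem measurable_coeffProd {D : ℕ} (θ : (i : Fin D) → C.CoeffIndex i) :
    Measurable (C.coeffProd θ) :=
  Finset.measurable_fun_prod _ fun (i : Fin D) _ =>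
    (C.measurable_coeff i (θ i).1 (θ i).2.1 (θ i).2.2).comp (measurable_pi_apply i)

variable (μ : Measure G) [IsProbabilityMeasure μ]

theorem integrable_coeff_mul_conj (j : ℕ) (l m : (C.basis j).Irr) (k k' : Fin ((C.basis j).dim l))
    (a a' : Fin ((C.basis j).dim m)) :
    Integrable (fun g => C.coeff j l g k k' * starRingEnd ℂ (C.coeff j m g a a')) μ := by
  refine Integrable.of_bound (C := 1) (((C.measurable_coeff j l k k').mul
    (Complex.continuous_conj.measurable.comp
      (C.measurable_coeff j m a a'))).aestronglyMeasurable) (.of_forall fun g => ?_)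
  rw [norm_mul, RCLike.norm_conj]
  exact mul_le_one₀ (C.norm_coeff_le j l g k k') (norm_nonneg _) (C.norm_coeff_le j m g a a')

theorem integrable_coeffProd_mul_conj {D : ℕ} (θ θ' : (i : Fin D) → C.CoeffIndex i) :
    Integrable (fun g => C.coeffProd θ g * starRingEnd ℂ (C.coeffProd θ' g))
      (Measure.pi fun _ : Fin D => μ) := by
  refine Integrable.of_bound (C := 1) ((C.measurable_coeffProd θ).mul
    (Complex.continuous_conj.measurable.comp (C.measurable_coeffProd θ'))).aestronglyMeasurable
      (.of_forall fun g => ?_)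
  rw [norm_mul, RCLike.norm_conj]
  exact mul_le_one₀ (C.norm_coeffProd_le θ g) (norm_nonneg _) (C.norm_coeffProd_le θ' g)

/-- Averages of products of matrix coefficients, as an intertwiner. -/
def averaged (j : ℕ) (l m : (C.basis j).Irr) (k' : Fin ((C.basis j).dim l))
    (a' : Fin ((C.basis j).dim m)) :
    Matrix (Fin ((C.basis j).dim l)) (Fin ((C.basis j).dim m)) ℂ :=
  fun x y => ∫ g, C.coeff j l g x k' * starRingEnd ℂ (C.coeff j m g y a') ∂μ

variable [IsTopologicalGroup G] [μ.IsHaarMeasure]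

/-- Left invariance of Haar measure: translating the integration variable by `h` multiplies the
average by the two representations at `h`. -/
theorem averaged_intertwines (j : ℕ) (l m : (C.basis j).Irr) (k' : Fin ((C.basis j).dim l))
    (a' : Fin ((C.basis j).dim m)) (h : G) :
    C.coeff j l h * C.averaged μ j l m k' a' = C.averaged μ j l m k' a' * C.coeff j m h := by
  have key : C.coeff j l h * C.averaged μ j l m k' a' * (C.coeff j m h)ᴴ =
      C.averaged μ j l m k' a' := by
    ext x y
    have h1 : (C.averaged μ j l m k' a') x y =
        ∫ g, C.coeff j l (h * g) x k' * starRingEnd ℂ (C.coeff j m (h * g) y a') ∂μ :=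
      (integral_mul_left_eq_self (μ := μ)
        (fun g => C.coeff j l g x k' * starRingEnd ℂ (C.coeff j m g y a')) h).symm
    rw [h1]
    have h2 : ∀ g, C.coeff j l (h * g) x k' * starRingEnd ℂ (C.coeff j m (h * g) y a') =
        ∑ v, ∑ u, C.coeff j l h x u * starRingEnd ℂ (C.coeff j m h y v) *
          (C.coeff j l g u k' * starRingEnd ℂ (C.coeff j m g v a')) := by
      intro g
      rw [coeff_mul, coeff_mul, Matrix.mul_apply, Matrix.mul_apply, map_sum, Finset.sum_mul_sum,
        Finset.sum_comm]
      refine Finset.sum_congr rfl fun v _ => Finset.sum_congr rfl fun u _ => ?_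
      rw [map_mul]; ring
    simp only [h2]
    rw [integral_finsetSum _ fun v _ => integrable_finsetSum _ fun u _ =>
      (C.integrable_coeff_mul_conj μ j l m u k' v a').const_mul _, Matrix.mul_apply]
    refine Finset.sum_congr rfl fun v _ => ?_
    rw [integral_finsetSum _ fun u _ =>
      (C.integrable_coeff_mul_conj μ j l m u k' v a').const_mul _, Matrix.mul_apply, Finset.sum_mul]
    refine Finset.sum_congr rfl fun u _ => ?_
    rw [integral_const_mul, Matrix.conjTranspose_apply, averaged, ← starRingEnd_apply]
    ring
  calc C.coeff j l h * C.averaged μ j l m k' a'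
      = C.coeff j l h * C.averaged μ j l m k' a' * ((C.coeff j m h)ᴴ * C.coeff j m h) := by
        rw [conjTranspose_mul_coeff, Matrix.mul_one]
    _ = _ := by rw [← Matrix.mul_assoc, key]

/-- Schur's lemma: kernel and range of the intertwiner are invariant, so it is zero or an
isomorphism, and the latter contradicts inequivalence. -/
theorem integral_coeff_of_ne (j : ℕ) {l m : (C.basis j).Irr} (hlm : l ≠ m)
    (k k' : Fin ((C.basis j).dim l)) (a a' : Fin ((C.basis j).dim m)) :
    ∫ g, C.coeff j l g k k' * starRingEnd ℂ (C.coeff j m g a a') ∂μ = 0 := by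
  set A := C.averaged μ j l m k' a' with hA
  have hint : ∀ h v, A *ᵥ (C.coeff j m h *ᵥ v) = C.coeff j l h *ᵥ (A *ᵥ v) := by
    intro h v
    rw [Matrix.mulVec_mulVec, Matrix.mulVec_mulVec, ← C.averaged_intertwines]
  suffices A = 0 from congrFun (congrFun this k) a
  rcases (C.basis j).irreducible m (LinearMap.ker A.mulVecLin) (by
    intro g v hv
    simp only [LinearMap.mem_ker, Matrix.mulVecLin_apply] at hv ⊢
    exact (hint g v).trans (by rw [hv, Matrix.mulVec_zero])) with hk | hk
  · exfalso
    rcases (C.basis j).irreducible l (LinearMap.range A.mulVecLin) (by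
      rintro g _ ⟨v, rfl⟩
      exact ⟨C.coeff j m g *ᵥ v, hint g v⟩) with hr | hr
    · have h0 : A.mulVecLin = 0 := LinearMap.range_eq_bot.1 hr
      rw [h0, LinearMap.ker_zero] at hk
      have := (C.basis j).dim_pos m
      have h1 : (Pi.single a 1 : Fin ((C.basis j).dim m) → ℂ) ∈ (⊥ : Submodule ℂ _) :=
        hk ▸ Submodule.mem_top
      have h2 := congrFun ((Submodule.mem_bot ℂ).1 h1) a
      simp at h2
    · exact (C.basis j).inequivalent m l hlm.symm
        ⟨LinearEquiv.ofBijective A.mulVecLin ⟨LinearMap.ker_eq_bot.1 hk,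
          LinearMap.range_eq_top.1 hr⟩, fun g v => hint g v⟩
  · have h0 : A.mulVecLin = 0 := LinearMap.ker_eq_top.1 hk
    refine Matrix.ext_of_mulVec_single fun i => ?_
    rw [Matrix.zero_mulVec]
    exact LinearMap.congr_fun h0 _

/-- An eigenspace of a self-intertwiner is invariant and non-zero, hence everything. -/
theorem averaged_eq_smul_one (j : ℕ) (l : (C.basis j).Irr) (k' a' : Fin ((C.basis j).dim l)) :
    ∃ c : ℂ, C.averaged μ j l l k' a' = c • 1 := by
  set A := C.averaged μ j l l k' a' with hA
  have : Nonempty (Fin ((C.basis j).dim l)) := ⟨k'⟩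
  obtain ⟨c, hc⟩ := Module.End.exists_eigenvalue (Matrix.toLin' A)
  refine ⟨c, ?_⟩
  rcases (C.basis j).irreducible l (Module.End.eigenspace (Matrix.toLin' A) c) (by
    intro g v hv
    rw [Module.End.mem_eigenspace_iff, Matrix.toLin'_apply] at hv ⊢
    change A *ᵥ (C.coeff j l g *ᵥ v) = c • (C.coeff j l g *ᵥ v)
    rw [Matrix.mulVec_mulVec, ← C.averaged_intertwines, ← Matrix.mulVec_mulVec, hv,
      Matrix.mulVec_smul]) with hk | hk
  · exact absurd hk hc
  · refine Matrix.ext_of_mulVec_single fun i => ?_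
    have : (Pi.single i 1 : Fin ((C.basis j).dim l) → ℂ) ∈
        Module.End.eigenspace (Matrix.toLin' A) c := hk ▸ Submodule.mem_top
    rw [Module.End.mem_eigenspace_iff, Matrix.toLin'_apply] at this
    rw [this, Matrix.smul_mulVec, Matrix.one_mulVec]

theorem integral_coeff_same (j : ℕ) (l : (C.basis j).Irr) (k k' a a' : Fin ((C.basis j).dim l))
    (h : (k, k') ≠ (a, a')) :
    ∫ g, C.coeff j l g k k' * starRingEnd ℂ (C.coeff j l g a a') ∂μ = 0 := by
  obtain ⟨c, hc⟩ := C.averaged_eq_smul_one μ j l k' a'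
  have h1 : ∫ g, C.coeff j l g k k' * starRingEnd ℂ (C.coeff j l g a a') ∂μ =
      (c • (1 : Matrix (Fin ((C.basis j).dim l)) (Fin ((C.basis j).dim l)) ℂ)) k a := by
    rw [← hc]; rfl
  rw [h1]
  -- Off the diagonal a scalar matrix vanishes. On the diagonal the second indices differ, and
  -- unitarity of the coefficients makes the trace, hence the scalar, zero.
  by_cases hka : k = a
  · have hk' : k' ≠ a' := fun h2 => h (by rw [hka, h2])
    have htr := congrArg Matrix.trace hc
    have h0 : (C.averaged μ j l l k' a').trace = 0 := by
      rw [Matrix.trace]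
      simp only [Matrix.diag, averaged]
      rw [← integral_finsetSum _ fun x _ => C.integrable_coeff_mul_conj μ j l l x k' x a']
      have : ∀ g, ∑ x, C.coeff j l g x k' * starRingEnd ℂ (C.coeff j l g x a') = 0 := by
        intro g
        have := congrFun (congrFun (C.conjTranspose_mul_coeff j l g) a') k'
        rw [Matrix.mul_apply, Matrix.one_apply_ne hk'.symm] at this
        rw [← this]
        refine Finset.sum_congr rfl fun x _ => ?_
        rw [Matrix.conjTranspose_apply, mul_comm]; rfl
      simp [this]
    rw [h0] at htr
    have hd := (C.basis j).dim_pos l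
    have : c = 0 := by
      simp only [Matrix.trace_smul, Matrix.trace_one, Fintype.card_fin, smul_eq_mul] at htr
      rcases mul_eq_zero.1 htr.symm with h | h
      · exact h
      · exact absurd (Nat.cast_eq_zero.1 h) hd.ne'
    simp [this]
  · simp [Matrix.one_apply_ne hka]

/-- Schur orthogonality of matrix coefficients. -/
theorem integral_coeff_eq_zero (j : ℕ) (θ θ' : C.CoeffIndex j) (h : θ ≠ θ') :
    ∫ g, C.coeff j θ.1 g θ.2.1 θ.2.2 * starRingEnd ℂ (C.coeff j θ'.1 g θ'.2.1 θ'.2.2) ∂μ = 0 := by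
  obtain ⟨l, k, k'⟩ := θ
  obtain ⟨m, a, a'⟩ := θ'
  by_cases hlm : l = m
  · subst hlm
    refine C.integral_coeff_same μ j l k k' a a' fun h2 => h ?_
    rw [h2]
  · exact C.integral_coeff_of_ne μ j hlm k k' a a'

theorem integral_coeffProd_eq_zero {D : ℕ} (θ θ' : (i : Fin D) → C.CoeffIndex i) (h : θ ≠ θ') :
    ∫ g, C.coeffProd θ g * starRingEnd ℂ (C.coeffProd θ' g) ∂(Measure.pi fun _ : Fin D => μ)
      = 0 := by
  obtain ⟨i, hi⟩ := Function.ne_iff.1 h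
  simp only [coeffProd, map_prod, ← Finset.prod_mul_distrib]
  rw [integral_fintype_prod_eq_prod (𝕜 := ℂ) (μ := fun _ : Fin D => μ) fun (i : Fin D) (g : G) =>
    C.coeff i (θ i).1 g (θ i).2.1 (θ i).2.2 *
      starRingEnd ℂ (C.coeff i (θ' i).1 g (θ' i).2.1 (θ' i).2.2)]
  exact Finset.prod_eq_zero (Finset.mem_univ i) (C.integral_coeff_eq_zero μ i _ _ hi)

end Schur

end NoisyCircuit

/-! ### Sums of orthogonal functions -/

/-- Parseval without normalisation. The norms of the functions are left unevaluated, since the same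
ones occur with and without noise. -/
theorem integral_norm_sq_sum_orthogonal {Ω Θ : Type*} [MeasurableSpace Ω] [Fintype Θ]
    {P : Measure Ω} (Φ : Θ → Ω → ℂ)
    (hint : ∀ θ θ', Integrable (fun ω => Φ θ ω * starRingEnd ℂ (Φ θ' ω)) P)
    (horth : ∀ θ θ', θ ≠ θ' → ∫ ω, Φ θ ω * starRingEnd ℂ (Φ θ' ω) ∂P = 0) (c : Θ → ℂ) :
    ∫ ω, ‖∑ θ, c θ * Φ θ ω‖ ^ 2 ∂P = ∑ θ, ‖c θ‖ ^ 2 * ∫ ω, ‖Φ θ ω‖ ^ 2 ∂P := by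
  have hc : ∀ z : ℂ, ((‖z‖ ^ 2 : ℝ) : ℂ) = z * starRingEnd ℂ z := fun z => by
    rw [Complex.mul_conj, Complex.normSq_eq_norm_sq]
  apply Complex.ofReal_injective
  rw [← integral_complex_ofReal, Complex.ofReal_sum]
  simp only [Complex.ofReal_mul, ← integral_complex_ofReal, hc]
  have h1 : ∀ ω, (∑ θ, c θ * Φ θ ω) * starRingEnd ℂ (∑ θ, c θ * Φ θ ω) =
      ∑ θ, ∑ θ', c θ * starRingEnd ℂ (c θ') * (Φ θ ω * starRingEnd ℂ (Φ θ' ω)) := by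
    intro ω
    rw [map_sum, Finset.sum_mul_sum]
    refine Finset.sum_congr rfl fun θ _ => Finset.sum_congr rfl fun θ' _ => ?_
    rw [map_mul]; ring
  simp only [h1]
  rw [integral_finsetSum _ fun θ _ => integrable_finsetSum _ fun θ' _ => (hint θ θ').const_mul _]
  refine Finset.sum_congr rfl fun θ _ => ?_
  rw [integral_finsetSum _ fun θ' _ => (hint θ θ').const_mul _, Finset.sum_eq_single θ]
  · rw [integral_const_mul]
  · intro θ' _ h
    rw [integral_const_mul, horth θ θ' h.symm, mul_zero]
  · simp

namespace NoisyCircuit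

/-! ### Path expansion of the output distributions -/

section Expansion

/-- Circuit parameters, extended to all layers. -/
def extend {G : Type*} [Group G] {D : ℕ} (g : Fin D → G) (j : ℕ) : G := if h : j < D then g ⟨j, h⟩ else 1

theorem extend_apply {G : Type*} [Group G] {D : ℕ} (g : Fin D → G) (i : Fin D) : extend g i = g i := by
  simp [extend]

variable {G : Type*} [Group G] [TopologicalSpace G] {n d : ℕ} (C : NoisyCircuit G n d)

/-- Damping factors for each irrep and component. -/
abbrev Damping : Type := (j : ℕ) → (l : (C.basis j).Irr) → Fin ((C.basis j).dim l) → ℂ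

/-- The amplitude of a layer: damping times matrix coefficient. -/
def layerAmp (η : C.Damping) (g : ℕ → G) : C.Amplitude := fun j b k =>
  η j b.1 b.2.2 * C.coeff j b.1 (g j) b.2.2 k

/-- Noisy evolution under general diagonal maps. -/
def evolve [NeZero d] (E : ℕ → Oper n d →ₗ[ℂ] Oper n d) (g : ℕ → G) : ℕ → ℕ → Oper n d
  | 0, _ => Matrix.single 0 0 1
  | m + 1, j => E j (ad (C.U j (g j)) (ad (C.W j) (evolve E g m (j + 1))))

/-- After the expansion of `A`, the label `c` stands behind the layer and `k` is the component in
front. Swapping the two makes the sum collapse at `c = b`. -/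
theorem hs_layer (E : ℕ → Oper n d →ₗ[ℂ] Oper n d) (η : C.Damping)
    (hE : ∀ j l α k, E j (C.T j ⟨l, α, k⟩) = η j l k • C.T j ⟨l, α, k⟩) (g : ℕ → G) (j : ℕ)
    (b : C.Label j) (A : Oper n d) :
    hs (C.T j b) (E j (ad (C.U j (g j)) A)) =
      ∑ k, C.layerAmp η g j b k * hs (C.T j (C.relabel b k)) A := by
  classical
  have h1 : ∀ c : C.Label j, hs (C.T j b) (E j (ad (C.U j (g j)) (C.T j c))) =
      ∑ k, if b = C.relabel c k then C.layerAmp η g j (C.relabel c k) c.2.2 else 0 := by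
    rintro ⟨l, α, k'⟩
    rw [(C.basis j).covariant (g j) l α k', map_sum, hs_sum]
    refine Finset.sum_congr rfl fun k _ => ?_
    rw [map_smul, hE, hs_smul, hs_smul, hs_T_T, mul_ite, mul_ite, mul_one, mul_zero, mul_zero]
    refine if_congr Iff.rfl ?_ rfl
    rw [mul_comm]
    rfl
  conv_lhs => rw [(C.basis j).complete A]
  simp only [ad_sum, map_sum, hs_sum, ad_smul, map_smul, hs_smul, h1]
  simp only [Finset.mul_sum]
  rw [sum_label_swap, Finset.sum_eq_single b]
  · refine Finset.sum_congr rfl fun k _ => ?_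
    rw [if_pos (show b = C.relabel (C.relabel b k) b.2.2 from rfl), mul_comm]
    rfl
  · intro c _ hc
    refine Finset.sum_eq_zero fun k _ => ?_
    rw [if_neg (show ¬ b = C.relabel (C.relabel c k) c.2.2 from fun h => hc h.symm), mul_zero]
  · simp

variable [NeZero d]

/-- The path expansion for arbitrary diagonal maps; the noise and the identity are the two cases
used. -/
theorem evolve_apply (E : ℕ → Oper n d →ₗ[ℂ] Oper n d) (η : C.Damping)
    (hE : ∀ j l α k, E j (C.T j ⟨l, α, k⟩) = η j l k • C.T j ⟨l, α, k⟩) {D : ℕ} (g : Fin D → G)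
    (x : Outcome n d) :
    C.evolve E (extend g) D 0 x x = ∑ q : C.Path D, q.value η g x := by
  have hcol : ∀ m j b, hs (C.T j b) (C.evolve E (extend g) m j) =
      col (fun j (b : C.Label j) (c : C.Label (j + 1)) =>
        ∑ k, C.layerAmp η (extend g) j b k * C.step j (C.relabel b k) c)
        (fun j b => starRingEnd ℂ (C.T j b 0 0)) m j b := by
    intro m
    induction m with
    | zero =>
      intro j b
      rw [evolve, col, hs, Matrix.trace_mul_single]
      simp
    | succ m ih =>
      intro j b
      rw [evolve, C.hs_layer E η hE, col]
      simp only [← ih, Finset.sum_mul]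
      rw [Finset.sum_comm]
      refine Finset.sum_congr rfl fun k _ => ?_
      simp only [mul_assoc, ← Finset.mul_sum]
      congr 1
      rw [hs_ad, ← C.sum_hs_mul_hs (j + 1)]
      simp only [step, hs_ad]
  have h1 : C.evolve E (extend g) D 0 x x =
      ∑ b : C.Label 0, C.T 0 b x x * hs (C.T 0 b) (C.evolve E (extend g) D 0) := by
    conv_lhs => rw [(C.basis 0).complete (C.evolve E (extend g) D 0)]
    rw [Matrix.sum_apply]
    refine Finset.sum_congr rfl fun b _ => ?_
    rw [Matrix.smul_apply, smul_eq_mul, mul_comm]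
  have h2 := sum_row_mul_col (fun j (b : C.Label j) (c : C.Label (j + 1)) =>
    ∑ k, C.layerAmp η (extend g) j b k * C.step j (C.relabel b k) c)
    (fun b => C.T 0 b x x) (fun j b => starRingEnd ℂ (C.T j b 0 0)) D 0
  simp only [hcol] at h1
  refine h1.trans (h2.symm.trans ?_)
  simp only [col]
  rw [← sum_chain, Fintype.sum_sigma]
  refine Finset.sum_congr rfl fun b _ => ?_
  rw [Finset.prod_univ_sum, Fintype.piFinset_univ, Finset.mul_sum, Finset.sum_mul]
  refine Finset.sum_congr rfl fun k _ => ?_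
  rw [Path.value]
  congr 2
  refine Finset.prod_congr rfl fun i _ => ?_
  rw [layerAmp, extend_apply]
  rfl

theorem foldr_eq_evolve (E : ℕ → Oper n d →ₗ[ℂ] Oper n d) (g : ℕ → G) (m j : ℕ) :
    (List.ofFn fun i : Fin m => fun A : Oper n d =>
      E (j + i) (ad (C.U (j + i) (g (j + i))) (ad (C.W (j + i)) A))).foldr (fun f A => f A)
        (Matrix.single 0 0 1) = C.evolve E g m j := by
  induction m generalizing j with
  | zero => simp [evolve]
  | succ m ih =>
    rw [List.ofFn_succ, List.foldr_cons, evolve, ← ih (j + 1)]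
    simp only [Fin.val_zero, Nat.add_zero, Fin.val_succ, Nat.add_assoc, Nat.add_comm 1]

theorem noisyState_eq {D : ℕ} (g : Fin D → G) :
    C.noisyState g = C.evolve C.noise (extend g) D 0 := by
  rw [← foldr_eq_evolve, noisyState]
  simp only [Nat.zero_add, extend_apply]

theorem noisyState_apply {D : ℕ} (g : Fin D → G) (x : Outcome n d) :
    C.noisyState g x x = ∑ q : C.Path D, q.value C.eig g x := by
  rw [noisyState_eq, C.evolve_apply C.noise C.eig C.diagonal]

theorem ad_prod_eq_evolve (g : ℕ → G) (m j : ℕ) :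
    ad (List.ofFn fun i : Fin m => C.U (j + i) (g (j + i)) * C.W (j + i)).prod
      (Matrix.single 0 0 1) = C.evolve (fun _ => LinearMap.id) g m j := by
  induction m generalizing j with
  | zero => simp [evolve, ad_one]
  | succ m ih =>
    rw [List.ofFn_succ, List.prod_cons, ad_mul, ad_mul, evolve, ← ih (j + 1)]
    simp only [Fin.val_zero, Nat.add_zero, Fin.val_succ, Nat.add_assoc, Nat.add_comm 1]
    rfl

theorem p_eq_sum {D : ℕ} (g : Fin D → G) (x : Outcome n d) :
    (C.p g x : ℂ) = ∑ q : C.Path D, q.value (fun _ _ _ => 1) g x := by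
  rw [← C.evolve_apply (fun _ => LinearMap.id) _ (fun _ _ _ _ => by simp), ← ad_prod_eq_evolve]
  simp only [Nat.zero_add, extend_apply]
  rw [p, Complex.normSq_eq_conj_mul_self, mul_comm, circuit, ad, Matrix.mul_apply,
    Finset.sum_eq_single 0]
  · rw [Matrix.mul_apply, Finset.sum_eq_single 0]
    · simp
    · intro y _ hy
      rw [Matrix.single_apply_of_row_ne hy.symm, mul_zero]
    · simp
  · intro y _ hy
    rw [Matrix.mul_apply, Finset.sum_eq_zero, zero_mul]
    intro z _
    rw [Matrix.single_apply_of_col_ne _ _ hy.symm, mul_zero]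
  · simp

open scoped ComplexOrder in
theorem posSemidef_evolve (g : ℕ → G) (m j : ℕ) : (C.evolve C.noise g m j).PosSemidef := by
  induction m generalizing j with
  | zero =>
    have : (Matrix.single (0 : Outcome n d) 0 (1 : ℂ)) =
        (Matrix.single (0 : Outcome n d) 0 (1 : ℂ))ᴴ * Matrix.single 0 0 1 := by simp
    rw [evolve, this]
    exact Matrix.posSemidef_conjTranspose_mul_self _
  | succ m ih =>
    obtain ⟨r, K, -, hK⟩ := C.channel j
    rw [evolve, hK]
    refine Matrix.posSemidef_sum _ fun a _ => ?_
    exact (((ih (j + 1)).mul_mul_conjTranspose_same _).mul_mul_conjTranspose_same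
      _).mul_mul_conjTranspose_same _

theorem trace_evolve (g : ℕ → G) (m j : ℕ) : (C.evolve C.noise g m j).trace = 1 := by
  induction m generalizing j with
  | zero => simp [evolve]
  | succ m ih =>
    obtain ⟨r, K, hK1, hK⟩ := C.channel j
    rw [evolve, hK, Matrix.trace_sum, ← ih (j + 1), ← ad_trace (C.W j), ← ad_trace (C.U j (g j))]
    conv_rhs => rw [← Matrix.one_mul (ad (C.U j (g j)) _), ← hK1, Matrix.sum_mul, Matrix.trace_sum]
    refine Finset.sum_congr rfl fun a _ => ?_
    rw [Matrix.trace_mul_comm, Matrix.mul_assoc]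

open scoped ComplexOrder in
theorem pNoisy_nonneg {D : ℕ} (g : Fin D → G) (x : Outcome n d) : 0 ≤ C.pNoisy g x := by
  rw [pNoisy, noisyState_eq]
  exact (Complex.le_def.1 ((C.posSemidef_evolve (extend g) D 0).diag_nonneg (i := x))).1

open scoped ComplexOrder in
theorem coe_pNoisy {D : ℕ} (g : Fin D → G) (x : Outcome n d) :
    (C.pNoisy g x : ℂ) = C.noisyState g x x := by
  have h := (Complex.le_def.1 ((C.posSemidef_evolve (extend g) D 0).diag_nonneg (i := x))).2
  rw [pNoisy, noisyState_eq]
  exact Complex.ext rfl (by simpa using h)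

theorem sum_pNoisy {D : ℕ} (g : Fin D → G) : ∑ x, C.pNoisy g x = 1 := by
  have h := C.trace_evolve (extend g) D 0
  have h2 := congrArg Complex.re h
  rw [Matrix.trace, Complex.re_sum] at h2
  simpa [pNoisy, noisyState_eq] using h2

end Expansion

/-! ### The truncation error -/

section Error

variable {G : Type*} [Group G] [TopologicalSpace G] {n d : ℕ} {C : NoisyCircuit G n d}

/-- The matrix coefficients on a path. -/
def Path.coeffIndex {D : ℕ} (q : C.Path D) (i : Fin D) : C.CoeffIndex i :=
  ⟨(q.1 i.castSucc).1, (q.1 i.castSucc).2.2, q.2 i⟩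

/-- The product of the damping factors. -/
def damp {D : ℕ} (η : C.Damping) (θ : (i : Fin D) → C.CoeffIndex i) : ℂ :=
  ∏ i : Fin D, η i (θ i).1 (θ i).2.1

theorem norm_damp_le {D L : ℕ} {γ : ℝ} (hγ0 : 0 < γ) (hγ1 : γ ≤ 1) (hC : C.NoisePenalised D γ)
    (q : C.Path D) (hq : ¬ q.weight ≤ L) : ‖damp C.eig q.coeffIndex‖ ≤ (1 - γ) ^ (L + 1) := by
  classical
  have h1 : ∀ i : Fin D, ‖C.eig i (q.coeffIndex i).1 (q.coeffIndex i).2.1‖ ≤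
      (1 - γ) ^ (if ¬ C.IsTriv i.castSucc (q.1 i.castSucc).1 then 1 else 0) := by
    intro i
    have h := hC i i.2 (q.coeffIndex i).1 (q.coeffIndex i).2.1
    by_cases ht : C.IsTriv i.castSucc (q.1 i.castSucc).1
    · rw [if_neg (not_not.2 ht), pow_zero, h.1 ht, norm_one]
    · rw [if_pos ht, pow_one]
      exact h.2 ht
  rw [damp, norm_prod]
  refine (Finset.prod_le_prod (fun _ _ => norm_nonneg _) fun i _ => h1 i).trans ?_
  rw [Finset.prod_pow_eq_pow_sum]
  refine pow_le_pow_of_le_one (by linarith) (by linarith) ?_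
  have : q.weight = ∑ i : Fin D, if ¬ C.IsTriv i.castSucc (q.1 i.castSucc).1 then 1 else 0 := by
    rw [Path.weight, Finset.card_filter]
  omega

variable [NeZero d]

/-- The part of the path value that does not depend on the group elements and damping. -/
def Path.amplitude {D : ℕ} (q : C.Path D) (x : Outcome n d) : ℂ :=
  C.T _ (q.1 0) x x * (∏ i : Fin D, q.transfer i) *
    starRingEnd ℂ (C.T _ (q.1 (Fin.last D)) 0 0)

theorem Path.value_eq {D : ℕ} (q : C.Path D) (η : C.Damping) (g : Fin D → G) (x : Outcome n d) :
    q.value η g x = q.amplitude x * damp η q.coeffIndex * C.coeffProd q.coeffIndex g := by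
  rw [Path.value, Path.amplitude, damp, coeffProd, Finset.prod_mul_distrib,
    Finset.prod_mul_distrib]
  exact (by intros; ring : ∀ a e v t s : ℂ, a * (e * v * t) * s = a * t * s * e * v) _ _ _ _ _

open Classical in
/-- The sum of the amplitudes of the heavy paths with given matrix coefficients. -/
def heavyAmplitude {D : ℕ} (L : ℕ) (x : Outcome n d) (θ : (i : Fin D) → C.CoeffIndex i) : ℂ :=
  ∑ q : C.Path D with ¬ q.weight ≤ L ∧ q.coeffIndex = θ, q.amplitude x

/-- Heavy paths with the same matrix coefficients share their damping factor, which therefore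
multiplies the whole coefficient of an orthogonal function. The noisy and noiseless residuals then
differ only in these multipliers. -/
theorem sum_heavy {D : ℕ} (L : ℕ) (η : C.Damping) (g : Fin D → G) (x : Outcome n d) :
    ∑ q : C.Path D, q.value η g x - ∑ q : C.Path D with q.weight ≤ L, q.value η g x =
      ∑ θ, damp η θ * C.heavyAmplitude L x θ * C.coeffProd θ g := by
  classical
  rw [← Finset.sum_filter_add_sum_filter_not Finset.univ fun q : C.Path D => q.weight ≤ L,
    add_sub_cancel_left, ← Finset.sum_fiberwise _ Path.coeffIndex]
  refine Finset.sum_congr rfl fun θ _ => ?_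
  rw [heavyAmplitude, Finset.mul_sum, Finset.sum_mul, Finset.filter_filter]
  refine Finset.sum_congr rfl fun q hq => ?_
  obtain ⟨-, -, rfl⟩ := Finset.mem_filter.1 hq
  rw [Path.value_eq]
  ring

/-- The damping estimate needs a heavy path with index `θ`; if there is none, the coefficient is an
empty sum. -/
theorem norm_damp_mul_heavyAmplitude_le {D L : ℕ} {γ : ℝ} (hγ0 : 0 < γ) (hγ1 : γ ≤ 1)
    (hC : C.NoisePenalised D γ) (x : Outcome n d) (θ : (i : Fin D) → C.CoeffIndex i) :
    ‖damp C.eig θ * C.heavyAmplitude L x θ‖ ≤ (1 - γ) ^ (L + 1) * ‖C.heavyAmplitude L x θ‖ := by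
  classical
  by_cases h : ∃ q : C.Path D, ¬ q.weight ≤ L ∧ q.coeffIndex = θ
  · obtain ⟨q, hq, rfl⟩ := h
    rw [norm_mul]
    exact mul_le_mul_of_nonneg_right (norm_damp_le hγ0 hγ1 hC q hq) (norm_nonneg _)
  · have : C.heavyAmplitude L x θ = 0 := by
      rw [heavyAmplitude, Finset.filter_false_of_mem, Finset.sum_empty]
      intro q _ hq
      exact h ⟨q, hq⟩
    simp [this]

theorem p_sub_pTrunc {D : ℕ} (L : ℕ) (g : Fin D → G) (x : Outcome n d) :
    (C.p g x : ℂ) - C.pTrunc L g x = ∑ θ, C.heavyAmplitude L x θ * C.coeffProd θ g := by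
  rw [p_eq_sum, pTrunc, sum_heavy]
  simp [damp]

theorem pNoisy_sub_pNoisyTrunc {D : ℕ} (L : ℕ) (g : Fin D → G) (x : Outcome n d) :
    (C.pNoisy g x : ℂ) - C.pNoisyTrunc L g x =
      ∑ θ, damp C.eig θ * C.heavyAmplitude L x θ * C.coeffProd θ g := by
  rw [coe_pNoisy, noisyState_apply, pNoisyTrunc, sum_heavy]

variable [MeasurableSpace G] [BorelSpace G] (μ : Measure G) [IsProbabilityMeasure μ]

theorem integrable_norm_sq_residual {D : ℕ} (L : ℕ) (x : Outcome n d) :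
    Integrable (fun g : Fin D → G => ‖(C.pNoisy g x : ℂ) - C.pNoisyTrunc L g x‖ ^ 2)
      (Measure.pi fun _ : Fin D => μ) := by
  simp only [pNoisy_sub_pNoisyTrunc]
  have hm : Measurable fun g : Fin D → G =>
      ‖∑ θ, damp C.eig θ * C.heavyAmplitude L x θ * C.coeffProd θ g‖ ^ 2 :=
    ((Finset.measurable_fun_sum _ fun θ _ => (C.measurable_coeffProd θ).const_mul _).norm).pow_const 2
  refine Integrable.of_bound (C := (∑ θ : (i : Fin D) → C.CoeffIndex i,
    ‖damp C.eig θ * C.heavyAmplitude L x θ‖) ^ 2) hm.aestronglyMeasurable (.of_forall fun g => ?_)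
  rw [norm_pow, norm_norm]
  refine pow_le_pow_left₀ (norm_nonneg _) ((norm_sum_le _ _).trans ?_) 2
  refine Finset.sum_le_sum fun θ _ => ?_
  rw [norm_mul]
  exact mul_le_of_le_one_right (norm_nonneg _) (C.norm_coeffProd_le θ g)

variable [IsTopologicalGroup G] [μ.IsHaarMeasure]

/-- The noise damps the residual. -/
theorem integral_residual_le {D : ℕ} (L : ℕ) {γ : ℝ} (hγ0 : 0 < γ) (hγ1 : γ ≤ 1)
    (hC : C.NoisePenalised D γ) (x : Outcome n d) :
    ∫ g, ‖(C.pNoisy g x : ℂ) - C.pNoisyTrunc L g x‖ ^ 2 ∂(Measure.pi fun _ : Fin D => μ) ≤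
      ((1 - γ) ^ (L + 1)) ^ 2 *
        ∫ g, ‖(C.p g x : ℂ) - C.pTrunc L g x‖ ^ 2 ∂(Measure.pi fun _ : Fin D => μ) := by
  simp only [pNoisy_sub_pNoisyTrunc, p_sub_pTrunc]
  rw [integral_norm_sq_sum_orthogonal _ (C.integrable_coeffProd_mul_conj μ)
      (C.integral_coeffProd_eq_zero μ),
    integral_norm_sq_sum_orthogonal _ (C.integrable_coeffProd_mul_conj μ)
      (C.integral_coeffProd_eq_zero μ), Finset.mul_sum]
  refine Finset.sum_le_sum fun θ _ => ?_
  rw [← mul_assoc, ← mul_pow]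
  exact mul_le_mul_of_nonneg_right (pow_le_pow_left₀ (norm_nonneg _)
    (norm_damp_mul_heavyAmplitude_le hγ0 hγ1 hC x θ) 2) (integral_nonneg fun _ => by positivity)

/-- Cauchy-Schwarz over the d^n outcomes costs a factor d^n, exactly what the anti-concentration
bound provides. Both inequalities follow from the single estimate `htot`. -/
theorem error_bounds {D : ℕ} (L : ℕ) {γ K ε : ℝ} (hγ0 : 0 < γ) (hγ1 : γ ≤ 1)
    (hC : C.NoisePenalised D γ) (hε : 0 < ε) (hδ : ((1 - γ) ^ (L + 1)) ^ 2 * K ≤ ε ^ 2)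
    (hK : ∑ x, ∫ g, ‖(C.p g x : ℂ) - C.pTrunc L g x‖ ^ 2 ∂(Measure.pi fun _ : Fin D => μ)
        ≤ K / (d : ℝ) ^ n) :
    (∑ x, Real.sqrt (∫ g, ‖(C.pNoisy g x : ℂ) - C.pNoisyTrunc L g x‖ ^ 2
          ∂(Measure.pi fun _ : Fin D => μ)) ≤ ε) ∧
      (∫ g, (∑ x, ‖(C.pNoisy g x : ℂ) - C.pNoisyTrunc L g x‖) ^ 2
          ∂(Measure.pi fun _ : Fin D => μ) ≤ ε ^ 2) := by
  have hd : (0 : ℝ) < (d : ℝ) ^ n := pow_pos (Nat.cast_pos.2 (NeZero.pos d)) n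
  have hcard : ((Finset.univ : Finset (Outcome n d)).card : ℝ) = (d : ℝ) ^ n := by
    simp
  have htot : (d : ℝ) ^ n * ∑ x, ∫ g, ‖(C.pNoisy g x : ℂ) - C.pNoisyTrunc L g x‖ ^ 2
      ∂(Measure.pi fun _ : Fin D => μ) ≤ ε ^ 2 := by
    refine le_trans ?_ hδ
    refine (mul_le_mul_of_nonneg_left (Finset.sum_le_sum fun x _ =>
      integral_residual_le μ L hγ0 hγ1 hC x) hd.le).trans ?_
    rw [← Finset.mul_sum, mul_left_comm]
    refine mul_le_mul_of_nonneg_left ?_ (by positivity)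
    rw [mul_comm]
    exact (le_div_iff₀ hd).1 hK
  constructor
  · refine abs_le_of_sq_le_sq' ?_ hε.le |>.2
    refine (sq_sum_le_card_mul_sum_sq).trans ?_
    rw [hcard]
    refine le_trans (le_of_eq ?_) htot
    congr 1
    exact Finset.sum_congr rfl fun x _ => Real.sq_sqrt (integral_nonneg fun _ => by positivity)
  · refine le_trans ?_ htot
    rw [← integral_finsetSum _ fun x _ => integrable_norm_sq_residual μ L x, ← integral_const_mul]
    refine integral_mono_of_nonneg (.of_forall fun _ => by positivity)
      ((integrable_finsetSum _ fun x _ => integrable_norm_sq_residual μ L x).const_mul _)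
      (.of_forall fun g => ?_)
    simp only
    rw [← hcard]
    exact sq_sum_le_card_mul_sum_sq

end Error

end NoisyCircuit

/-- The truncation parameter suffices for the damping. -/
theorem rate_pos {γ r : ℝ} (hγ0 : 0 < γ)
    (hr : r = γ ∨ (γ < 1 ∧ r = Real.log (1 / (1 - γ)))) : 0 < r := by
  rcases hr with rfl | ⟨h, rfl⟩
  · exact hγ0
  · refine Real.log_pos ?_
    rw [lt_div_iff₀ (by linarith)]
    linarith

/-- For either choice of the rate, 1-γ ≤ exp(-r), so L ≥ log(K/ε)/r gives (1-γ)^L ≤ ε/K. Squaring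
leaves a spare factor 1/K, which is at most 1. -/
theorem damping_le {γ r K ε : ℝ} (hγ0 : 0 < γ) (hγ1 : γ ≤ 1) (hK : 1 ≤ K) (hε : 0 < ε)
    (hr : r = γ ∨ (γ < 1 ∧ r = Real.log (1 / (1 - γ)))) :
    ((1 - γ) ^ (⌈Real.log (K / ε) / r⌉₊ + 1)) ^ 2 * K ≤ ε ^ 2 := by
  have hK0 : 0 < K := by linarith
  have hr0 := rate_pos hγ0 hr
  have h1 : 1 - γ ≤ Real.exp (-r) := by
    rcases hr with rfl | ⟨h, rfl⟩
    · exact Real.one_sub_le_exp_neg r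
    · rw [one_div, Real.log_inv, neg_neg, Real.exp_log (by linarith)]
  have h0 : 0 ≤ 1 - γ := by linarith
  set L := ⌈Real.log (K / ε) / r⌉₊
  have hL : Real.log (K / ε) ≤ L * r := (div_le_iff₀ hr0).1 (Nat.le_ceil _)
  have h2 : (1 - γ) ^ (L + 1) ≤ ε / K := by
    calc (1 - γ) ^ (L + 1) ≤ (1 - γ) ^ L := pow_le_pow_of_le_one h0 (by linarith) (by omega)
      _ ≤ Real.exp (-r) ^ L := pow_le_pow_left₀ h0 h1 L
      _ = Real.exp (-(L * r)) := by rw [← Real.exp_nat_mul]; ring_nf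
      _ ≤ Real.exp (-Real.log (K / ε)) := Real.exp_le_exp.2 (by linarith)
      _ = ε / K := by rw [Real.exp_neg, Real.exp_log (by positivity), inv_div]
  calc ((1 - γ) ^ (L + 1)) ^ 2 * K ≤ (ε / K) ^ 2 * K := by gcongr
    _ = ε ^ 2 / K := by field_simp
    _ ≤ ε ^ 2 := div_le_self (by positivity) hK

/-! ### The programs

The functions below are stored at the positions indicated by the numerals in calls. The parameters
`n, d, D, L, M, dmax` travel in a list, preceded by the prefix of the outcome. -/

namespace Code

/-- Entry of a list. -/
def nth : ℕ → Code → Code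
  | 0, e => e.fst
  | k + 1, e => nth k e.snd

/-- The argument of a function. -/
abbrev arg : Code := .var 0
/-- The complex number one. -/
abbrev one : Code := .op1 .toNum (.lit 1)
/-- First entry of the list in the second component of the argument. -/
abbrev head : Code := arg.snd.fst

/-- Marginal of the truncated distribution at the prefix in front of the parameters. -/
def evalFn : Code :=
  .call 2 (pair arg (.op2 .natSub (nth 3 arg) (succ (nth 5 arg))))

/-- Sum over the windows below a given position. -/
def windowsFn : Code :=
  .ite arg.snd
    (.op2 .add (.call 3 (pair (pair arg.fst (pred arg.snd)) (.ask .contractFull (pred arg.snd))))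
      (.call 2 (pair arg.fst (pred arg.snd))))
    zero

/-- Contribution of an entry of a window. -/
def entryBody : Code :=
  .op2 .mul (nth 2 head)
    (.call 4 (pair
      (pair arg.fst.fst (pair (nth 4 arg.fst.fst)
        (pair (succ (.op2 .natAdd arg.fst.snd (nth 5 arg.fst.fst))) (nth 1 head))))
      (pair (pair arg.fst.snd (nth 0 head))
        (pair arg.fst.snd (pair (.lit 0) (pair (pair (nth 0 head) one) .nil))))))

/-- Backward scan for the next non-trivial layer. -/
def scanBackFn : Code :=
  .ite arg.snd.snd.fst
    (.letIn (.ask .contractKet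
        (list3 (pred arg.snd.snd.fst) arg.snd.fst.fst arg.snd.fst.snd))
      -- The first label of the list speaks for all of them, by controlled growth. In the trivial
      -- case the inner test reads the number of trivial layers still allowed.
      (.ite (nth 1 (.ask .info (list2 (pred (Code.var 1).snd.snd.fst) (Code.var 0).fst.fst)))
        (.ite (Code.var 1).snd.snd.snd.fst
          (.call 4 (pair (Code.var 1).fst (pair (Code.var 1).snd.fst
            (pair (pred (Code.var 1).snd.snd.fst)
              (pair (pred (Code.var 1).snd.snd.snd.fst) (.var 0))))))
          zero)
        (.ite (Code.var 1).fst.snd.fst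
          (.call 5 (pair (pair (Code.var 1).fst (pred (Code.var 1).snd.snd.fst)) (.var 0)))
          zero)))
    (.op2 .mul (.call 7 (pair arg.fst.fst arg.snd.snd.snd.snd))
      (.call 8 (pair (pair arg.fst.fst arg.fst.snd.fst)
        (pair arg.fst.snd.snd (succ arg.fst.snd.snd.fst)))))

/-- Contribution of a label after a non-trivial layer, in the backward direction. -/
def branchBackBody : Code :=
  .op2 .mul head.snd
    (.ite (.op2 .natLt (nth 6 arg.fst.fst.fst) (nth 0 (.ask .info (list2 arg.fst.snd head.fst))))
      zero
      (.call 6 (pair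
        (pair (pair arg.fst.fst.fst (pair (pred arg.fst.fst.snd.fst) arg.fst.fst.snd.snd))
          (pair arg.fst.snd head.fst))
        (.ask .expand (list2 arg.fst.snd head.fst)))))

/-- Contribution of a label before a non-trivial layer, in the backward direction. -/
def layerBackBody : Code :=
  .op2 .mul (.op2 .mul (.ask .eigen (list2 arg.fst.snd.fst head))
      (.ask .coeff (list3 arg.fst.snd.fst head arg.fst.snd.snd)))
    (.call 4 (pair arg.fst.fst (pair (pair arg.fst.snd.fst head)
      (pair arg.fst.snd.fst (pair (succ (nth 5 arg.fst.fst.fst)) (pair (pair head one) .nil))))))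

/-- Contribution of a label at position `0`. -/
def marginalBody : Code :=
  .op2 .mul head.snd (.ask .marginal (list3 (.lit 0) head.fst (nth 0 arg.fst)))

/-- Forward scan for the next non-trivial layer. -/
def scanFwdFn : Code :=
  .letIn (.ask .contractBra (list3 arg.snd.fst.fst arg.snd.snd arg.snd.fst.snd))
    (.ite (.op2 .natEq (Code.var 1).snd.snd (nth 3 (Code.var 1).fst.fst))
      (.call 11 (pair (pair (Code.var 1).snd.snd (.call 12 (nth 1 (Code.var 1).fst.fst))) (.var 0)))
      (.ite (nth 1 (.ask .info (list2 (Code.var 1).snd.snd (Code.var 0).fst.fst)))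
        (.call 8 (pair (Code.var 1).fst (pair (Code.var 1).snd.fst (succ (Code.var 1).snd.snd))))
        (.ite (Code.var 1).fst.snd
          (.call 9 (pair (pair (Code.var 1).fst (Code.var 1).snd.snd) (.var 0)))
          zero)))

/-- Contribution of a label before a non-trivial layer, in the forward direction. -/
def branchFwdBody : Code :=
  .op2 .mul head.snd
    (.ite (.op2 .natLt (nth 6 arg.fst.fst.fst) (nth 0 (.ask .info (list2 arg.fst.snd head.fst))))
      zero
      (.call 10 (pair
        (pair (pair arg.fst.fst.fst (pred arg.fst.fst.snd)) (pair arg.fst.snd head.fst))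
        (.ask .expand (list2 arg.fst.snd head.fst)))))

/-- Contribution of a label after a non-trivial layer, in the forward direction. -/
def layerFwdBody : Code :=
  .op2 .mul (.op2 .mul (.ask .eigen (list2 arg.fst.snd.fst arg.fst.snd.snd))
      (.ask .coeff (list3 arg.fst.snd.fst arg.fst.snd.snd head)))
    (.call 8 (pair arg.fst.fst (pair (pair arg.fst.snd.fst head) (succ arg.fst.snd.fst))))

/-- Contribution of a label at the last position. -/
def endBody : Code :=
  .op2 .mul head.snd (.op1 .conj (.ask .marginal (list3 arg.fst.fst head.fst arg.fst.snd)))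

/-- A list of zeros. -/
def zerosFn : Code :=
  .ite arg (pair (.lit 0) (.call 12 (pred arg))) .nil

/-- Extends the prefix outcome by outcome. -/
def sampleFn : Code :=
  .ite (.op2 .natLt arg.snd.fst (nth 0 arg.fst))
    (.letIn (.call 14 (pair (pair arg.fst arg.snd.snd) (pair (.lit 0) (nth 1 arg.fst))))
      (.letIn (.op2 .mul (.ask .rand (Code.var 1).snd.fst) (.call 15 (pair .nil (.var 0))))
        (.call 13 (pair (Code.var 2).fst (pair (succ (Code.var 2).snd.fst)
          (.call 17 (pair (Code.var 2).snd.snd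
            (.call 16 (pair (.var 0) (pair zero (pair (.lit 0) (.var 1)))))))))))
    )
    arg.snd.snd

/-- Positive parts of the marginals at the one-step extensions of a prefix. -/
def weightsFn : Code :=
  .ite arg.snd.snd
    (pair
      (.letIn (.call 1 (pair (.call 17 (pair arg.fst.snd arg.snd.fst)) arg.fst.fst))
        (.ite (.op2 .ltRe zero (.var 0)) (.var 0) zero))
      (.call 14 (pair arg.fst (pair (succ arg.snd.fst) (pred arg.snd.snd)))))
    .nil

/-- The first index at which the partial sums exceed a threshold. -/
def pickFn : Code :=
  .ite (.op1 .isCons arg.snd.snd.snd.snd)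
    (.letIn (.op2 .add arg.snd.fst arg.snd.snd.snd.fst)
      (.ite (.op2 .ltRe (Code.var 1).fst (.var 0)) (Code.var 1).snd.snd.fst
        (.call 16 (pair (Code.var 1).fst (pair (.var 0)
          (pair (succ (Code.var 1).snd.snd.fst) (Code.var 1).snd.snd.snd.snd))))))
    arg.snd.snd.fst

/-- Appends an entry to a list. -/
def snocFn : Code :=
  .ite (.op1 .isCons arg.fst)
    (pair arg.fst.fst (.call 17 (pair arg.fst.snd arg.snd)))
    (pair arg.snd .nil)

end Code

open Code in
/-- The functions shared by the two programs. -/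
def library : Program :=
  [evalFn, windowsFn, sumLoop 3 entryBody, scanBackFn, sumLoop 5 branchBackBody,
    sumLoop 6 layerBackBody, sumLoop 7 marginalBody, scanFwdFn, sumLoop 9 branchFwdBody,
    sumLoop 10 layerFwdBody, sumLoop 11 endBody, zerosFn, sampleFn, weightsFn, sumLoop 15 head,
    pickFn, snocFn]

open Code in
/-- The program that evaluates marginals of the truncated distribution. -/
def evaluatorProgram : Program := .call 1 (pair (nth 6 arg) arg) :: library

open Code in
/-- The program that draws a sample. -/
def samplerProgram : Program := .call 13 (pair arg (pair (.lit 0) .nil)) :: library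

/-! ### Correctness of the evaluator -/

/-- The list enumerates the support of a function. -/
def Enumerates {α : Type*} (cs : List α) (f : α → ℂ) : Prop :=
  cs.Nodup ∧ ∀ c, c ∈ cs ↔ f c ≠ 0

theorem Enumerates.sum_eq {α : Type*} [Fintype α] {cs : List α} {f : α → ℂ} (h : Enumerates cs f)
    (F : α → ℂ) : (cs.map fun c => f c * F c).sum = ∑ c, f c * F c := by
  classical
  rw [← List.sum_toFinset _ h.1]
  refine Finset.sum_subset (Finset.subset_univ _) fun c _ hc => ?_
  have : f c = 0 := by
    by_contra h0
    exact hc (List.mem_toFinset.2 ((h.2 c).2 h0))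
  rw [this, zero_mul]

theorem Enumerates.length_eq {α : Type*} {cs : List α} {f : α → ℂ} (h : Enumerates cs f) :
    cs.length = {c | f c ≠ 0}.ncard := by
  classical
  have : {c | f c ≠ 0} = (cs.toFinset : Set α) := by
    ext c
    simp [h.2 c]
  rw [this, Set.ncard_coe_finset, List.toFinset_card_of_nodup h.1]

/-- A uniform size bound for almost all call-free fragments of the programs, so that time estimates
reduce to linear arithmetic in κ+1. -/
theorem Runs.pure {P : Program} {O : Subroutine → Val → Val} {κ : ℕ} {env : List Val} {e : Code}
    {v : Val} (he : e.isPure env.length = true) (hs : e.size ≤ 50) (hv : e.val O env = v) :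
    Runs P O κ env e v (50 * (κ + 1)) :=
  .ofVal he hv (Nat.mul_le_mul_right _ hs)

section NumRules

variable {P : Program} {O : Subroutine → Val → Val} {κ : ℕ} {env : List Val} {e e' : Code}
  {y z : ℂ} {T T' : ℕ}

theorem Runs.mul (h : Runs P O κ env e (.num y) T) (h' : Runs P O κ env e' (.num z) T') :
    Runs P O κ env (.op2 .mul e e') (.num (y * z)) (T + T' + 1) := h.op2 .mul h'

theorem Runs.add (h : Runs P O κ env e (.num y) T) (h' : Runs P O κ env e' (.num z) T') :
    Runs P O κ env (.op2 .add e e') (.num (y + z)) (T + T' + 1) := h.op2 .add h'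

theorem Runs.zero : Runs P O κ env Code.zero (.num 0) (50 * (κ + 1)) :=
  .pure rfl (by simp [Code.size]) (by simp [Code.val, Op1.run])

end NumRules

theorem prefixVal_eq {n d : ℕ} (x : Outcome n d) (m : ℕ) : prefixVal x m =
    Val.ofList (((List.ofFn x).take m).map fun a : Fin d => .nat a) := by
  rw [prefixVal]
  generalize (List.ofFn x).take m = l
  congr 1
  induction l with
  | nil => rfl
  | cons a l ih => exact congrArg (Val.nat a :: ·) ih

/-- The parameters of the programs. -/
def params (n d D L M dmax : ℕ) (rest : Val) : Val :=
  .cons (.nat n) (.cons (.nat d) (.cons (.nat D) (.cons (.nat L) (.cons (.nat M)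
    (.cons (.nat dmax) rest)))))

/-- The cost of the elementary operations in a function body. -/
def unitCost (κ : ℕ) : ℕ := 500 * (κ + 1)

theorem runs_zeros (m : Code) (O : Subroutine → Val → Val) (κ k : ℕ) :
    Runs (m :: library) O κ [.nat k] Code.zerosFn
      (Val.ofList (List.replicate k (.nat 0))) ((k + 1) * unitCost κ) := by
  induction k with
  | zero =>
    refine (Runs.iteFalse (.pure rfl (by decide) rfl)
      (.pure rfl (by decide) rfl)).mono ?_
    unfold unitCost; omega
  | succ k ih =>
    refine (Runs.iteTrue (v := .nat (k + 1)) (.pure rfl (by decide) rfl) (by simp)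
      (Runs.op2 .cons (.pure rfl (by decide) rfl)
        (Runs.call (.pure rfl (by decide) rfl) rfl ih))).mono ?_
    rw [add_mul (k + 1)]
    unfold unitCost; omega

namespace NoisyCircuit

variable {G : Type*} [Group G] [TopologicalSpace G] {n d : ℕ} (C : NoisyCircuit G n d)

open Classical in
/-- Amplitudes restricted to irreps of dimension at most `dmax`. -/
def cutAmp (dmax : ℕ) (amp : C.Amplitude) : C.Amplitude := fun j b k =>
  if (C.basis j).dim b.1 ≤ dmax then amp j b k else 0

theorem cutAmp_of_le {dmax : ℕ} (amp : C.Amplitude) {j : ℕ} {b : C.Label j}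
    (h : (C.basis j).dim b.1 ≤ dmax) (k : Fin ((C.basis j).dim b.1)) :
    C.cutAmp dmax amp j b k = amp j b k := if_pos h

theorem cutAmp_of_not_le {dmax : ℕ} (amp : C.Amplitude) {j : ℕ} {b : C.Label j}
    (h : ¬ (C.basis j).dim b.1 ≤ dmax) (k : Fin ((C.basis j).dim b.1)) :
    C.cutAmp dmax amp j b k = 0 := if_neg h

/-- Time bound for the last step of a forward scan. -/
def endTime (s n κ : ℕ) : ℕ := (2 * s + n + 4) * unitCost κ

/-- Time bound for forward scans, without the scanning itself. -/
def fwdTime (D s dmax n κ : ℕ) : ℕ → ℕ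
  | 0 => endTime s n κ
  | w + 1 => endTime s n κ + 2 * unitCost κ +
      s * (4 * unitCost κ + dmax * (2 * unitCost κ + 2 * D * unitCost κ +
        fwdTime D s dmax n κ w))

/-- Time bound for backward scans, without the scanning itself. -/
def backTime (D s dmax n κ : ℕ) : ℕ → ℕ
  | 0 => endTime s n κ + 2 * D * unitCost κ + fwdTime D s dmax n κ 0
  | w + 1 => endTime s n κ + 2 * D * unitCost κ + fwdTime D s dmax n κ (w + 1) +
      2 * unitCost κ + s * (4 * unitCost κ + dmax * (2 * unitCost κ + 2 * D * unitCost κ +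
        backTime D s dmax n κ w))

variable {C} in
theorem ControlledGrowth.trivRight {D : ℕ} (hC : C.ControlledGrowth D) {j i : ℕ} (hji : j < i)
    (hi : i < D) (b : C.Label j) (h : ∀ l, j < l → l < i → C.TrivRight j l b) {c : C.Label i}
    (hc : C.contraction j i b c ≠ 0) (ht : C.IsTriv i c.1) : C.TrivRight j i b :=
  (hC.right hji hi b h).resolve_right fun h' => h' c hc ht

variable {C} in
theorem ControlledGrowth.trivLeft {D : ℕ} (hC : C.ControlledGrowth D) {i l : ℕ} (hil : i < l)
    (hl : l < D) (b : C.Label l) (h : ∀ j, i < j → j < l → C.TrivLeft j l b) {a : C.Label i}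
    (ha : C.contraction i l a b ≠ 0) (ht : C.IsTriv i a.1) : C.TrivLeft i l b :=
  (hC.left hil hl b h).resolve_right fun h' => h' a ha ht

theorem endTime_le_fwdTime (D s dmax n κ w : ℕ) :
    4 * unitCost κ ≤ endTime s n κ ∧ endTime s n κ ≤ fwdTime D s dmax n κ w := by
  constructor
  · exact Nat.mul_le_mul_right _ (by omega)
  · cases w with
    | zero => exact le_rfl
    | succ w => rw [fwdTime]; omega

section Specs

variable {C} {D M s dmax : ℕ} {g : Fin D → G} {O : Subroutine → Val → Val}
  (hO : C.Subroutines D M dmax g O) (hs : C.SparseContractions D s) (main : Code) (κ L m : ℕ)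
  (x : Outcome n d) (rest : Val)

include hO

theorem exists_contractBra {i j : ℕ} (hij : i < j) (hj : j ≤ D) (b : C.Label i) :
    ∃ cs : List (C.Label j), Enumerates cs (C.contraction i j b) ∧
      O .contractBra (Val.ofList [.nat i, .nat j, C.labelVal i b]) = Val.ofList
        (cs.map fun c => .cons (C.labelVal j c) (.num (C.contraction i j b c))) := by
  obtain ⟨cs, h1, h2, h3⟩ := hO.contractBra i j hij hj b
  exact ⟨cs, ⟨h1, h2⟩, h3⟩

theorem exists_contractKet {i j : ℕ} (hij : i < j) (hj : j ≤ D) (c : C.Label j) :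
    ∃ bs : List (C.Label i), Enumerates bs (fun b => C.contraction i j b c) ∧
      O .contractKet (Val.ofList [.nat i, .nat j, C.labelVal j c]) = Val.ofList
        (bs.map fun b => .cons (C.labelVal i b) (.num (C.contraction i j b c))) := by
  obtain ⟨cs, h1, h2, h3⟩ := hO.contractKet i j hij hj c
  exact ⟨cs, ⟨h1, h2⟩, h3⟩

theorem runs_end {j : ℕ} [NeZero d] (b : C.Label j) {cs : List (C.Label D)}
    (hcs : Enumerates cs (C.contraction j D b)) (hlen : cs.length ≤ s) :
    Runs (main :: library) O κ [.cons (.cons (.nat D) (Val.ofList (List.replicate n (.nat 0))))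
        (Val.ofList (cs.map fun c => .cons (C.labelVal D c) (.num (C.contraction j D b c))))]
      (Code.sumLoop 11 Code.endBody)
      (.num (∑ c : C.Label D, C.contraction j D b c * starRingEnd ℂ (C.T D c 0 0)))
      ((s + 1) * unitCost κ) := by
  rw [← hcs.sum_eq]
  refine (Runs.sumLoop (P := main :: library) (body := Code.endBody) rfl
    (fun c => .cons (C.labelVal D c) (.num (C.contraction j D b c))) _ _ (120 * (κ + 1)) cs
    fun c _ rest => ?_).mono ?_
  -- The marginal at the full prefix of `n` zeros fixes every entry, so it is the diagonal entry
  -- that gives the overlap with the input state.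
  · have hm := hO.marginal D le_rfl c 0 n le_rfl
    have hpre : prefixVal (0 : Outcome n d) n = Val.ofList (List.replicate n (.nat 0)) := by
      rw [prefixVal_eq]
      congr 1
      have : List.ofFn (0 : Outcome n d) = List.replicate n 0 := by
        rw [List.eq_replicate_iff]
        refine ⟨by simp, fun b hb => ?_⟩
        obtain ⟨i, rfl⟩ := (List.mem_ofFn' _ _).1 hb
        rfl
      rw [this]
      simp
    have hsum : prefixMarginal (fun z => C.T D c z z) (0 : Outcome n d) n = C.T D c 0 0 := by
      rw [prefixMarginal, Finset.sum_eq_single 0]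
      · intro z hz hne
        exact absurd (funext fun i => (Finset.mem_filter.1 hz).2 i i.2) hne
      · simp
    rw [hpre, hsum] at hm
    refine (Runs.mul (.pure rfl (by decide) rfl)
      (.pure (v := .num _) rfl (by decide) ?_)).mono ?_
    · exact congrArg (Op1.run .conj) hm
    · omega
  · have := Nat.mul_le_mul_right (120 * (κ + 1) + 16 * (κ + 1)) hlen
    rw [add_mul s]
    unfold unitCost
    nlinarith

variable [NeZero d]

/-- The recursive call is taken as the hypothesis `hscan`, at budget `w` and cost `S`. The mutual
recursion is closed in `runs_scanFwd` by induction on the budget. -/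
theorem runs_layerFwd (pv : Val) (w S : ℕ) (hscan : ∀ i < D, ∀ b : C.Label i,
      Runs (main :: library) O κ [.cons (.cons (.cons pv (params n d D L M dmax rest)) (.nat w))
        (.cons (.cons (.nat i) (C.labelVal i b)) (.nat (i + 1)))] Code.scanFwdFn
        (.num (tau w (C.fwd (C.cutAmp dmax (C.layerAmp C.eig (extend g))) (D - (i + 1)) i b))) S)
    {i : ℕ} (hi : i < D) (c : C.Label i) (hdim : (C.basis i).dim c.1 ≤ dmax) :
    Runs (main :: library) O κ [.cons (.cons (.cons (.cons pv (params n d D L M dmax rest)) (.nat w))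
        (.cons (.nat i) (C.labelVal i c))) (O .expand (Val.ofList [.nat i, C.labelVal i c]))]
      (Code.sumLoop 10 Code.layerFwdBody)
      (.num (∑ k, C.cutAmp dmax (C.layerAmp C.eig (extend g)) i c k *
        tau w (C.fwd (C.cutAmp dmax (C.layerAmp C.eig (extend g))) (D - (i + 1)) i
          (C.relabel c k)))) (dmax * (unitCost κ + S) + unitCost κ) := by
  rw [hO.expand i hi c hdim, List.ofFn_eq_map, ← List.sum_ofFn, List.ofFn_eq_map]
  refine (Runs.sumLoop (P := main :: library) (body := Code.layerFwdBody) rfl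
    (fun k => C.labelVal i ⟨c.1, c.2.1, k⟩) _ _ (160 * (κ + 1) + S) _ fun k _ rest => ?_).mono ?_
  · have he := hO.eigen i hi c
    have hc := hO.coeff ⟨i, hi⟩ c.1 c.2.1 c.2.2 k hdim
    have hamp : C.cutAmp dmax (C.layerAmp C.eig (extend g)) i c k = C.eig i c.1 c.2.2 *
        C.coeff i c.1 (g ⟨i, hi⟩) c.2.2 k := by
      rw [cutAmp, if_pos hdim, layerAmp, extend, dif_pos hi]
    rw [hamp]
    refine Runs.mono (Runs.mul (Runs.mul (.pure rfl (by decide) he) (.pure rfl (by decide) hc))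
      (Runs.call (.pure rfl (by decide) rfl) rfl (hscan i hi _))) ?_
    omega
  · rw [List.length_finRange]
    have := Nat.mul_le_mul_right (160 * (κ + 1) + S + 16 * (κ + 1)) hdim
    have h2 : dmax * (160 * (κ + 1) + S + 16 * (κ + 1)) ≤ dmax * (unitCost κ + S) :=
      Nat.mul_le_mul_left _ (by unfold unitCost; omega)
    have h3 : 16 * (κ + 1) ≤ unitCost κ := by unfold unitCost; omega
    omega

include hs

theorem runs_branchFwd (pv : Val) (w S : ℕ) (hscan : ∀ i < D, ∀ b : C.Label i,
      Runs (main :: library) O κ [.cons (.cons (.cons pv (params n d D L M dmax rest)) (.nat w))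
        (.cons (.cons (.nat i) (C.labelVal i b)) (.nat (i + 1)))] Code.scanFwdFn
        (.num (tau w (C.fwd (C.cutAmp dmax (C.layerAmp C.eig (extend g))) (D - (i + 1)) i b))) S)
    {j i : ℕ} (hji : j < i) (hi : i < D) (b : C.Label j) {cs : List (C.Label i)}
    (hcs : Enumerates cs (C.contraction j i b)) :
    Runs (main :: library) O κ
      [.cons (.cons (.cons (.cons pv (params n d D L M dmax rest)) (.nat (w + 1))) (.nat i))
        (Val.ofList (cs.map fun c => .cons (C.labelVal i c) (.num (C.contraction j i b c))))]
      (Code.sumLoop 9 Code.branchFwdBody)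
      (.num (∑ c, C.contraction j i b c * ∑ k, C.cutAmp dmax (C.layerAmp C.eig (extend g)) i c k *
        tau w (C.fwd (C.cutAmp dmax (C.layerAmp C.eig (extend g))) (D - (i + 1)) i
          (C.relabel c k))))
      (s * (2 * unitCost κ + dmax * (unitCost κ + S)) + unitCost κ) := by
  rw [← hcs.sum_eq]
  refine (Runs.sumLoop (P := main :: library) (body := Code.branchFwdBody) rfl
    (fun c => .cons (C.labelVal i c) (.num (C.contraction j i b c))) _ _
    (200 * (κ + 1) + unitCost κ + dmax * (unitCost κ + S)) cs fun c _ rest' => ?_).mono ?_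
  · refine (Runs.mul (T' := 120 * (κ + 1) + unitCost κ + dmax * (unitCost κ + S))
      (.pure rfl (by decide) rfl) ?_).mono ?_
    · have hinfo := hO.info i hi c
      by_cases hdim : (C.basis i).dim c.1 ≤ dmax
      · refine (Runs.iteFalse (.pure rfl (by decide) ?_) (Runs.call (.pure rfl (by decide) rfl) rfl
          (runs_layerFwd hO main κ L rest pv w S hscan hi c hdim))).mono ?_
        · refine (congrArg (fun v => Op2.run .natLt (.nat dmax) (Op1.run .fst v)) hinfo).trans ?_
          simp [Op1.run, Op2.run, Val.ofList, not_lt.2 hdim]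
        · omega
      · refine (Runs.iteTrue (v := .nat 1) (.pure rfl (by decide) ?_) (by simp) ?_).mono
          (T := 50 * (κ + 1) + 50 * (κ + 1) + 1) ?_
        · refine (congrArg (fun v => Op2.run .natLt (.nat dmax) (Op1.run .fst v)) hinfo).trans ?_
          simp [Op1.run, Op2.run, Val.ofList, not_le.1 hdim]
        -- Above dimension `dmax` the subroutines guarantee nothing; the program answers 0, in
        -- agreement with the restricted amplitudes.
        · have : ∑ k, C.cutAmp dmax (C.layerAmp C.eig (extend g)) i c k *
              tau w (C.fwd (C.cutAmp dmax (C.layerAmp C.eig (extend g))) (D - (i + 1)) i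
                (C.relabel c k)) = 0 :=
            Finset.sum_eq_zero fun k _ => by rw [cutAmp, if_neg hdim, zero_mul]
          rw [this]
          exact Runs.zero
        · omega
    · omega
  · have hlen : cs.length ≤ s := hcs.length_eq ▸ (hs j i hji hi.le).1 b
    have := Nat.mul_le_mul hlen (show 200 * (κ + 1) + unitCost κ + dmax * (unitCost κ + S) +
      16 * (κ + 1) ≤ 2 * unitCost κ + dmax * (unitCost κ + S) by unfold unitCost; omega)
    have h3 : 16 * (κ + 1) ≤ unitCost κ := by unfold unitCost; omega
    omega

/-- The amount subtracted from the time bound is left to the enclosing `letIn` and tests of the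
scan; it is no truncated subtraction, since `fwdTime` is at least four units. -/
theorem runs_chooseFwd (pv : Val) (w : ℕ) (hscan : ∀ w', w = w' + 1 → ∀ i < D, ∀ b : C.Label i,
      Runs (main :: library) O κ [.cons (.cons (.cons pv (params n d D L M dmax rest)) (.nat w'))
        (.cons (.cons (.nat i) (C.labelVal i b)) (.nat (i + 1)))] Code.scanFwdFn
        (.num (tau w' (C.fwd (C.cutAmp dmax (C.layerAmp C.eig (extend g))) (D - (i + 1)) i b)))
        (2 * D * unitCost κ + fwdTime D s dmax n κ w'))
    {j i : ℕ} (hji : j < i) (hi : i < D) (b : C.Label j)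
    (h : ∀ l, j < l → l < i → C.TrivRight j l b)
    (hn : ∀ c : C.Label i, C.contraction j i b c ≠ 0 → ¬ C.IsTriv i c.1)
    {cs : List (C.Label i)} (hcs : Enumerates cs (C.contraction j i b)) :
    Runs (main :: library) O κ
      [Val.ofList (cs.map fun c => .cons (C.labelVal i c) (.num (C.contraction j i b c))),
        .cons (.cons (.cons pv (params n d D L M dmax rest)) (.nat w))
          (.cons (.cons (.nat j) (C.labelVal j b)) (.nat i))]
      (.ite (Code.var 1).fst.snd
        (.call 9 (.pair (.pair (Code.var 1).fst (Code.var 1).snd.snd) (.var 0))) .zero)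
      (.num (tau w (C.fwd (C.cutAmp dmax (C.layerAmp C.eig (extend g))) (D - (j + 1)) j b)))
      (fwdTime D s dmax n κ w - 300 * (κ + 1)) := by
  have hu : unitCost κ = 500 * (κ + 1) := rfl
  have he := endTime_le_fwdTime D s dmax n κ w
  cases w with
  | zero =>
    rw [C.tau_zero_fwd _ hji hi b h hn]
    exact Runs.mono (Runs.iteFalse (.pure rfl (by decide) rfl) Runs.zero) (by omega)
  | succ w =>
    rw [C.tau_succ_fwd _ hji hi b h hn]
    refine Runs.mono (Runs.iteTrue (v := .nat (w + 1)) (.pure rfl (by decide) rfl) (by simp)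
      (Runs.call (.pure rfl (by decide) rfl) rfl (runs_branchFwd hO hs main κ L rest pv w
        (2 * D * unitCost κ + fwdTime D s dmax n κ w) (hscan w rfl) hji hi b hcs))) ?_
    rw [fwdTime]
    have h1 : s * (2 * unitCost κ + dmax * (unitCost κ + (2 * D * unitCost κ +
        fwdTime D s dmax n κ w))) ≤ s * (4 * unitCost κ + dmax * (2 * unitCost κ +
          2 * D * unitCost κ + fwdTime D s dmax n κ w)) :=
      Nat.mul_le_mul_left _ (add_le_add (by omega) (Nat.mul_le_mul_left _ (by omega)))
    omega

/-- Outer induction on the budget, which drops at each non-trivial layer; inner induction on the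
distance to `D`, which drops at each trivial one. Two units of time are reserved for each position
still to be scanned. -/
theorem runs_scanFwd (hC : C.ControlledGrowth D) (pv : Val) (w : ℕ) {j i : ℕ} (hji : j < i)
    (hi : i ≤ D) (b : C.Label j) (h : ∀ l, j < l → l < i → C.TrivRight j l b) :
    Runs (main :: library) O κ [.cons (.cons (.cons pv (params n d D L M dmax rest)) (.nat w))
        (.cons (.cons (.nat j) (C.labelVal j b)) (.nat i))] Code.scanFwdFn
        (.num (tau w (C.fwd (C.cutAmp dmax (C.layerAmp C.eig (extend g))) (D - (j + 1)) j b)))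
      (2 * (D - i) * unitCost κ + fwdTime D s dmax n κ w) := by
  induction w using Nat.strong_induction_on generalizing j i with
  | _ w ihw =>
  have hu : unitCost κ = 500 * (κ + 1) := rfl
  have he := endTime_le_fwdTime D s dmax n κ w
  obtain ⟨k, hk⟩ : ∃ k, i + k = D := ⟨D - i, by omega⟩
  induction k generalizing i with
  | zero =>
    obtain rfl : i = D := hk
    obtain ⟨cs, hcs, hask⟩ := exists_contractBra hO hji le_rfl b
    rw [C.tau_fwd_end _ hji b h]
    have hlen : cs.length ≤ s := hcs.length_eq ▸ (hs j i hji le_rfl).1 b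
    refine Runs.mono (Runs.letIn (.pure rfl (by decide) hask)
      (Runs.iteTrue (v := .nat 1) (.pure rfl (by decide) ?_) (by simp)
        (Runs.call (Runs.op2 .cons (Runs.op2 .cons (.pure rfl (by decide) rfl)
          (Runs.call (.pure rfl (by decide) rfl) rfl (runs_zeros main O κ n)))
            (.pure rfl (by decide) rfl)) rfl (runs_end hO main κ b hcs hlen)))) ?_
    · change Val.nat (if i = i then 1 else 0) = _
      rw [if_pos rfl]
    · have : endTime s n κ = (n + 1) * unitCost κ + (s + 1) * unitCost κ + s * unitCost κ +
        2 * unitCost κ := by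
        unfold endTime; ring
      omega
  | succ k ihk =>
    have hiD : i < D := by omega
    obtain ⟨cs, hcs, hask⟩ := exists_contractBra hO hji hi b
    -- The list has a head, and its triviality decides the case for the whole image.
    obtain ⟨c0, hc0⟩ := C.exists_contraction_ne_zero_right j i b
    obtain ⟨c, cs, rfl⟩ := List.exists_cons_of_ne_nil (List.ne_nil_of_mem ((hcs.2 c0).2 hc0))
    have hc : C.contraction j i b c ≠ 0 := (hcs.2 c).1 List.mem_cons_self
    have hinfo := hO.info i hiD c
    have hD : 2 * (D - i) * unitCost κ = 2 * (D - (i + 1)) * unitCost κ + 2 * unitCost κ := by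
      have : D - i = D - (i + 1) + 1 := by omega
      rw [this]; ring
    have hcond : Runs (main :: library) O κ
        [Val.ofList ((c :: cs).map fun c => .cons (C.labelVal i c) (.num (C.contraction j i b c))),
          .cons (.cons (.cons pv (params n d D L M dmax rest)) (.nat w))
            (.cons (.cons (.nat j) (C.labelVal j b)) (.nat i))]
        (.op2 .natEq (Code.var 1).snd.snd (.nth 3 (Code.var 1).fst.fst)) (.nat 0)
        (50 * (κ + 1)) := by
      refine .pure rfl (by decide) ?_
      change Val.nat (if i = D then 1 else 0) = _
      rw [if_neg hiD.ne]
    by_cases ht : C.IsTriv i c.1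
    · rw [if_pos ht] at hinfo
      have htr := hC.trivRight hji hiD b h hc ht
      refine Runs.mono (Runs.letIn (.pure rfl (by decide) hask) (hcond.iteFalse
        (Runs.iteTrue (v := .nat 1) (.pure rfl (by decide)
          (congrArg (fun v => Op1.run .fst (Op1.run .snd v)) hinfo)) (by simp)
          (Runs.call (.pure rfl (by decide) rfl) rfl
            (ihk (i := i + 1) (by omega) (by omega) (fun l h1 h2 => ?_) (by omega)))))) ?_
      · rcases Nat.lt_succ_iff_lt_or_eq.1 h2 with h3 | rfl
        · exact h l h1 h3
        · exact htr
      · omega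
    · rw [if_neg ht] at hinfo
      refine Runs.mono (Runs.letIn (.pure rfl (by decide) hask) (hcond.iteFalse
        (Runs.iteFalse (.pure rfl (by decide)
          (congrArg (fun v => Op1.run .fst (Op1.run .snd v)) hinfo))
          (runs_chooseFwd hO hs main κ L rest pv w ?_ hji hiD b h ?_ hcs)))) ?_
      · rintro w' rfl i' hi' b'
        exact (ihw w' (by omega) (j := i') (i := i' + 1) (by omega) hi' b'
          (fun l h1 h2 => by omega)).mono (Nat.add_le_add_right (Nat.mul_le_mul_right _ (by omega)) _)
      · exact (hC.right hji hiD b h).resolve_left fun h' => ht (h' c hc)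
      · omega

end Specs
end NoisyCircuit

/-! ### Correctness of the backward scans. -/

namespace NoisyCircuit

variable {G : Type*} [Group G] [TopologicalSpace G] {n d : ℕ} (C : NoisyCircuit G n d)

/-- The initial row that evaluates marginals. -/
def marginalRow (x : Outcome n d) (m : ℕ) (a : C.Label 0) : ℂ :=
  prefixMarginal (fun z => C.T 0 a z z) x m

/-- The forward polynomial `F` is carried along untouched, so both directions draw on one budget and
no convolution of degrees has to be computed. -/
theorem tau_succ_scan_mul (M : ℕ) (amp : C.Amplitude) (init : C.Label 0 → ℂ) {i l : ℕ} (h : i < l)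
    (ρ : ℕ) (b : C.Label l) (hn : ∀ a, C.contraction i l a b ≠ 0 → ¬ C.IsTriv i a.1) (w : ℕ)
    (F : Polynomial ℂ) :
    tau (w + 1) (C.scan M amp init (i + 1) l ρ b * F) = ∑ a, C.contraction i l a b *
      ∑ k, amp i (C.relabel a k) a.2.2 *
        tau w (C.scan M amp init i i (M + 1) (C.relabel a k) * F) := by
  rw [C.scan_nontriv M amp init h ρ b hn, mul_assoc, tau_succ_X_mul, Finset.sum_mul, map_sum]
  refine Finset.sum_congr rfl fun a _ => ?_
  rw [mul_assoc, tau_C_mul, Finset.sum_mul, map_sum]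
  congr 1
  refine Finset.sum_congr rfl fun k _ => ?_
  rw [mul_assoc, tau_C_mul, scan_self]

theorem tau_zero_scan_mul (M : ℕ) (amp : C.Amplitude) (init : C.Label 0 → ℂ) {i l : ℕ} (h : i < l)
    (ρ : ℕ) (b : C.Label l) (hn : ∀ a, C.contraction i l a b ≠ 0 → ¬ C.IsTriv i a.1)
    (F : Polynomial ℂ) : tau 0 (C.scan M amp init (i + 1) l ρ b * F) = 0 := by
  rw [C.scan_nontriv M amp init h ρ b hn, mul_assoc, tau_zero_X_mul]

theorem enumerates_self {l : ℕ} (b : C.Label l) :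
    Enumerates [b] (fun a => C.contraction l l a b) := by
  refine ⟨List.nodup_singleton b, fun a => ?_⟩
  rw [List.mem_singleton]
  change a = b ↔ C.contraction l l a b ≠ 0
  rw [contraction_self]
  split_ifs with h <;> simp [h]

theorem endTime_le_backTime (D s dmax n κ w : ℕ) :
    4 * unitCost κ ≤ endTime s n κ ∧ endTime s n κ + 2 * D * unitCost κ + fwdTime D s dmax n κ w ≤
      backTime D s dmax n κ w := by
  constructor
  · exact Nat.mul_le_mul_right _ (by omega)
  · cases w with
    | zero => exact le_rfl
    | succ w => rw [backTime]; omega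

section Specs

variable {C} {D M s dmax : ℕ} {g : Fin D → G} {O : Subroutine → Val → Val}
  (hO : C.Subroutines D M dmax g O) (hs : C.SparseContractions D s) (main : Code) (κ L m : ℕ)
  (x : Outcome n d) (rest : Val)

include hO

theorem runs_marginal (hm : m ≤ n) {l : ℕ} (b : C.Label l) {as : List (C.Label 0)}
    (has : Enumerates as (fun a => C.contraction 0 l a b)) (hlen : as.length ≤ s) :
    Runs (main :: library) O κ [.cons (.cons (prefixVal x m) (params n d D L M dmax rest))
        (Val.ofList (as.map fun a => .cons (C.labelVal 0 a) (.num (C.contraction 0 l a b))))]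
      (Code.sumLoop 7 Code.marginalBody)
      (.num (∑ a : C.Label 0, C.contraction 0 l a b * C.marginalRow x m a))
      ((s + 1) * unitCost κ) := by
  rw [← has.sum_eq]
  refine (Runs.sumLoop (P := main :: library) (body := Code.marginalBody) rfl
    (fun a => .cons (C.labelVal 0 a) (.num (C.contraction 0 l a b))) _ _ (120 * (κ + 1)) as
    fun a _ rest => ?_).mono ?_
  · exact Runs.mono (Runs.mul (.pure rfl (by decide) rfl)
      (.pure (v := .num _) rfl (by decide) (hO.marginal 0 (Nat.zero_le D) a x m hm))) (by omega)
  · have := Nat.mul_le_mul_right (120 * (κ + 1) + 16 * (κ + 1)) hlen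
    rw [add_mul s]
    unfold unitCost
    nlinarith

variable [NeZero d]

theorem runs_layerBack {j₀ : ℕ} (c₀ : C.Label j₀) (w S : ℕ)
    (hscan : ∀ i < D, ∀ b : C.Label i, Runs (main :: library) O κ
      [.cons (.cons (.cons (prefixVal x m) (params n d D L M dmax rest))
          (.cons (.nat w) (.cons (.nat j₀) (C.labelVal j₀ c₀))))
        (.cons (.cons (.nat i) (C.labelVal i b)) (.cons (.nat i) (.cons (.nat (M + 1))
          (.cons (.cons (C.labelVal i b) (.num 1)) .nil))))] Code.scanBackFn
      (.num (tau w (C.scan M (C.cutAmp dmax (C.layerAmp C.eig (extend g))) (C.marginalRow x m)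
        i i (M + 1) b *
          C.fwd (C.cutAmp dmax (C.layerAmp C.eig (extend g))) (D - (j₀ + 1)) j₀ c₀))) S)
    {i : ℕ} (hi : i < D) (a : C.Label i) (hdim : (C.basis i).dim a.1 ≤ dmax) :
    Runs (main :: library) O κ [.cons
        (.cons (.cons (.cons (prefixVal x m) (params n d D L M dmax rest))
          (.cons (.nat w) (.cons (.nat j₀) (C.labelVal j₀ c₀)))) (.cons (.nat i) (C.labelVal i a)))
        (O .expand (Val.ofList [.nat i, C.labelVal i a]))]
      (Code.sumLoop 6 Code.layerBackBody)
      (.num (∑ k, C.cutAmp dmax (C.layerAmp C.eig (extend g)) i (C.relabel a k) a.2.2 *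
        tau w (C.scan M (C.cutAmp dmax (C.layerAmp C.eig (extend g))) (C.marginalRow x m)
          i i (M + 1) (C.relabel a k) *
            C.fwd (C.cutAmp dmax (C.layerAmp C.eig (extend g))) (D - (j₀ + 1)) j₀ c₀)))
      (dmax * (unitCost κ + S) + unitCost κ) := by
  rw [hO.expand i hi a hdim, List.ofFn_eq_map, ← List.sum_ofFn, List.ofFn_eq_map]
  refine (Runs.sumLoop (P := main :: library) (body := Code.layerBackBody) rfl
    (fun k => C.labelVal i ⟨a.1, a.2.1, k⟩) _ _ (160 * (κ + 1) + S) _ fun k _ rest' => ?_).mono ?_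
  · have he := hO.eigen i hi ⟨a.1, a.2.1, k⟩
    have hc := hO.coeff ⟨i, hi⟩ a.1 a.2.1 k a.2.2 hdim
    have hamp : C.cutAmp dmax (C.layerAmp C.eig (extend g)) i (C.relabel a k) a.2.2 =
        C.eig i a.1 k * C.coeff i a.1 (g ⟨i, hi⟩) k a.2.2 := by
      refine (C.cutAmp_of_le _ (b := C.relabel a k) hdim a.2.2).trans ?_
      change C.eig i a.1 k * C.coeff i a.1 (extend g i) k a.2.2 = _
      rw [extend, dif_pos hi]
    rw [hamp]
    have hone : ((1 : ℕ) : ℂ) = 1 := Nat.cast_one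
    refine Runs.mono (Runs.mul (Runs.mul (.pure rfl (by decide) he) (.pure rfl (by decide) hc))
      (Runs.call (.pure rfl (by decide) ?_) rfl (hscan i hi (C.relabel a k)))) ?_
    · rw [← hone]; rfl
    · omega
  · rw [List.length_finRange]
    have := Nat.mul_le_mul_right (160 * (κ + 1) + S + 16 * (κ + 1)) hdim
    have h2 : dmax * (160 * (κ + 1) + S + 16 * (κ + 1)) ≤ dmax * (unitCost κ + S) :=
      Nat.mul_le_mul_left _ (by unfold unitCost; omega)
    have h3 : 16 * (κ + 1) ≤ unitCost κ := by unfold unitCost; omega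
    omega

include hs

theorem runs_branchBack {j₀ : ℕ} (c₀ : C.Label j₀) (w S : ℕ)
    (hscan : ∀ i < D, ∀ b : C.Label i, Runs (main :: library) O κ
      [.cons (.cons (.cons (prefixVal x m) (params n d D L M dmax rest))
          (.cons (.nat w) (.cons (.nat j₀) (C.labelVal j₀ c₀))))
        (.cons (.cons (.nat i) (C.labelVal i b)) (.cons (.nat i) (.cons (.nat (M + 1))
          (.cons (.cons (C.labelVal i b) (.num 1)) .nil))))] Code.scanBackFn
      (.num (tau w (C.scan M (C.cutAmp dmax (C.layerAmp C.eig (extend g))) (C.marginalRow x m)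
        i i (M + 1) b *
          C.fwd (C.cutAmp dmax (C.layerAmp C.eig (extend g))) (D - (j₀ + 1)) j₀ c₀))) S)
    {i l : ℕ} (hil : i < l) (hl : l < D) (b : C.Label l) {as : List (C.Label i)}
    (has : Enumerates as (fun a => C.contraction i l a b)) :
    Runs (main :: library) O κ
      [.cons (.cons (.cons (.cons (prefixVal x m) (params n d D L M dmax rest))
          (.cons (.nat (w + 1)) (.cons (.nat j₀) (C.labelVal j₀ c₀)))) (.nat i))
        (Val.ofList (as.map fun a => .cons (C.labelVal i a) (.num (C.contraction i l a b))))]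
      (Code.sumLoop 5 Code.branchBackBody)
      (.num (∑ a, C.contraction i l a b *
        ∑ k, C.cutAmp dmax (C.layerAmp C.eig (extend g)) i (C.relabel a k) a.2.2 *
          tau w (C.scan M (C.cutAmp dmax (C.layerAmp C.eig (extend g))) (C.marginalRow x m)
            i i (M + 1) (C.relabel a k) *
              C.fwd (C.cutAmp dmax (C.layerAmp C.eig (extend g))) (D - (j₀ + 1)) j₀ c₀)))
      (s * (2 * unitCost κ + dmax * (unitCost κ + S)) + unitCost κ) := by
  rw [← has.sum_eq]
  refine (Runs.sumLoop (P := main :: library) (body := Code.branchBackBody) rfl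
    (fun a => .cons (C.labelVal i a) (.num (C.contraction i l a b))) _ _
    (200 * (κ + 1) + unitCost κ + dmax * (unitCost κ + S)) as fun a _ rest' => ?_).mono ?_
  · refine (Runs.mul (T' := 120 * (κ + 1) + unitCost κ + dmax * (unitCost κ + S))
      (.pure rfl (by decide) rfl) ?_).mono ?_
    · have hi : i < D := hil.trans hl
      have hinfo := hO.info i hi a
      by_cases hdim : (C.basis i).dim a.1 ≤ dmax
      · refine (Runs.iteFalse (.pure rfl (by decide) ?_) (Runs.call (.pure rfl (by decide) rfl) rfl
          (runs_layerBack hO main κ L m x rest c₀ w S hscan hi a hdim))).mono ?_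
        · refine (congrArg (fun v => Op2.run .natLt (.nat dmax) (Op1.run .fst v)) hinfo).trans ?_
          simp [Op1.run, Op2.run, Val.ofList, not_lt.2 hdim]
        · omega
      · refine (Runs.iteTrue (v := .nat 1) (.pure rfl (by decide) ?_) (by simp) ?_).mono
          (T := 50 * (κ + 1) + 50 * (κ + 1) + 1) ?_
        · refine (congrArg (fun v => Op2.run .natLt (.nat dmax) (Op1.run .fst v)) hinfo).trans ?_
          simp [Op1.run, Op2.run, Val.ofList, not_le.1 hdim]
        · have : ∑ k, C.cutAmp dmax (C.layerAmp C.eig (extend g)) i (C.relabel a k) a.2.2 *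
              tau w (C.scan M (C.cutAmp dmax (C.layerAmp C.eig (extend g))) (C.marginalRow x m)
                i i (M + 1) (C.relabel a k) *
                C.fwd (C.cutAmp dmax (C.layerAmp C.eig (extend g))) (D - (j₀ + 1)) j₀ c₀) = 0 :=
            Finset.sum_eq_zero fun k _ => mul_eq_zero_of_left
              (C.cutAmp_of_not_le _ (b := C.relabel a k) hdim a.2.2) _
          rw [this]
          exact Runs.zero
        · omega
    · omega
  · have hlen : as.length ≤ s := has.length_eq ▸ (hs i l hil hl.le).2 b
    have := Nat.mul_le_mul hlen (show 200 * (κ + 1) + unitCost κ + dmax * (unitCost κ + S) +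
      16 * (κ + 1) ≤ 2 * unitCost κ + dmax * (unitCost κ + S) by unfold unitCost; omega)
    have h3 : 16 * (κ + 1) ≤ unitCost κ := by unfold unitCost; omega
    omega

theorem runs_chooseBack {j₀ : ℕ} (c₀ : C.Label j₀) (w : ℕ)
    (hscan : ∀ w', w = w' + 1 → ∀ i < D, ∀ b : C.Label i, Runs (main :: library) O κ
      [.cons (.cons (.cons (prefixVal x m) (params n d D L M dmax rest))
          (.cons (.nat w') (.cons (.nat j₀) (C.labelVal j₀ c₀))))
        (.cons (.cons (.nat i) (C.labelVal i b)) (.cons (.nat i) (.cons (.nat (M + 1))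
          (.cons (.cons (C.labelVal i b) (.num 1)) .nil))))] Code.scanBackFn
      (.num (tau w' (C.scan M (C.cutAmp dmax (C.layerAmp C.eig (extend g))) (C.marginalRow x m)
        i i (M + 1) b *
          C.fwd (C.cutAmp dmax (C.layerAmp C.eig (extend g))) (D - (j₀ + 1)) j₀ c₀)))
      (2 * D * unitCost κ + backTime D s dmax n κ w'))
    {i l : ℕ} (hil : i < l) (hl : l < D) (b : C.Label l) (ρ : ℕ) (lst : Val)
    (hn : ∀ a, C.contraction i l a b ≠ 0 → ¬ C.IsTriv i a.1)
    {as : List (C.Label i)} (has : Enumerates as (fun a => C.contraction i l a b)) :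
    Runs (main :: library) O κ
      [Val.ofList (as.map fun a => .cons (C.labelVal i a) (.num (C.contraction i l a b))),
        .cons (.cons (.cons (prefixVal x m) (params n d D L M dmax rest))
          (.cons (.nat w) (.cons (.nat j₀) (C.labelVal j₀ c₀))))
        (.cons (.cons (.nat l) (C.labelVal l b)) (.cons (.nat (i + 1)) (.cons (.nat ρ) lst)))]
      (.ite (Code.var 1).fst.snd.fst
        (.call 5 (.pair (.pair (Code.var 1).fst (.pred (Code.var 1).snd.snd.fst)) (.var 0))) .zero)
      (.num (tau w (C.scan M (C.cutAmp dmax (C.layerAmp C.eig (extend g))) (C.marginalRow x m)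
        (i + 1) l ρ b *
          C.fwd (C.cutAmp dmax (C.layerAmp C.eig (extend g))) (D - (j₀ + 1)) j₀ c₀)))
      (backTime D s dmax n κ w - 300 * (κ + 1)) := by
  have hu : unitCost κ = 500 * (κ + 1) := rfl
  have he := endTime_le_backTime D s dmax n κ w
  cases w with
  | zero =>
    rw [C.tau_zero_scan_mul M _ _ hil ρ b hn]
    exact Runs.mono (Runs.iteFalse (.pure rfl (by decide) rfl) Runs.zero) (by omega)
  | succ w =>
    rw [C.tau_succ_scan_mul M _ _ hil ρ b hn]
    refine Runs.mono (Runs.iteTrue (v := .nat (w + 1)) (.pure rfl (by decide) rfl) (by simp)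
      (Runs.call (.pure rfl (by decide) rfl) rfl (runs_branchBack hO hs main κ L m x rest c₀ w
        (2 * D * unitCost κ + backTime D s dmax n κ w) (hscan w rfl) hil hl b has))) ?_
    rw [backTime]
    have h1 : s * (2 * unitCost κ + dmax * (unitCost κ + (2 * D * unitCost κ +
        backTime D s dmax n κ w))) ≤ s * (4 * unitCost κ + dmax * (2 * unitCost κ +
          2 * D * unitCost κ + backTime D s dmax n κ w)) :=
      Nat.mul_le_mul_left _ (add_le_add (by omega) (Nat.mul_le_mul_left _ (by omega)))
    omega

/-- The same double induction as in the forward direction. The list of contractions at the current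
position is part of the input, because it is summed over once position 0 is reached. -/
theorem runs_scanBack (hC : C.ControlledGrowth D) (hs1 : 1 ≤ s) (hm : m ≤ n) {j₀ : ℕ}
    (hj₀ : j₀ < D) (c₀ : C.Label j₀) (w : ℕ) {i l : ℕ} (hil : i ≤ l) (hl : l < D) (b : C.Label l)
    (ρ : ℕ) (h : ∀ j, i ≤ j → j < l → C.TrivLeft j l b) {as : List (C.Label i)}
    (has : Enumerates as (fun a => C.contraction i l a b)) :
    Runs (main :: library) O κ
      [.cons (.cons (.cons (prefixVal x m) (params n d D L M dmax rest))
          (.cons (.nat w) (.cons (.nat j₀) (C.labelVal j₀ c₀))))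
        (.cons (.cons (.nat l) (C.labelVal l b)) (.cons (.nat i) (.cons (.nat ρ)
          (Val.ofList (as.map fun a => .cons (C.labelVal i a)
            (.num (C.contraction i l a b)))))))] Code.scanBackFn
      (.num (tau w (C.scan M (C.cutAmp dmax (C.layerAmp C.eig (extend g))) (C.marginalRow x m)
        i l ρ b *
          C.fwd (C.cutAmp dmax (C.layerAmp C.eig (extend g))) (D - (j₀ + 1)) j₀ c₀)))
      (2 * i * unitCost κ + backTime D s dmax n κ w) := by
  induction w using Nat.strong_induction_on generalizing i l ρ with
  | _ w ihw =>
  have hu : unitCost κ = 500 * (κ + 1) := rfl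
  have he := endTime_le_backTime D s dmax n κ w
  induction i generalizing ρ with
  | zero =>
    -- If the scan starts at position 0, no unitary has been applied and the sparsity assumption
    -- does not apply; the list is the label itself, and `1 ≤ s` is used.
    have hlen : as.length ≤ s := by
      rcases Nat.eq_zero_or_pos l with rfl | h0
      · have h1 : as ⊆ [b] := fun a ha =>
          ((C.enumerates_self b).2 a).2 ((has.2 a).1 ha)
        exact ((List.subperm_of_subset has.1 h1).length_le).trans hs1
      · exact has.length_eq ▸ (hs 0 l h0 hl.le).2 b
    -- At position 0 the row is constant in X, so the whole remaining budget passes to the forward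
    -- scan.
    rw [scan_zero, tau_C_mul]
    refine Runs.mono (Runs.iteFalse (.pure rfl (by decide) rfl)
      (Runs.mul (Runs.call (.pure rfl (by decide) rfl) rfl
        (runs_marginal hO main κ L m x rest hm b has hlen))
        (Runs.call (.pure rfl (by decide) rfl) rfl (runs_scanFwd hO hs main κ L rest hC
          (prefixVal x m) w (Nat.lt_add_one j₀) hj₀ c₀ fun l h1 h2 => by omega)))) ?_
    have h1 : 2 * (D - (j₀ + 1)) * unitCost κ ≤ 2 * D * unitCost κ :=
      Nat.mul_le_mul_right _ (by omega)
    have : endTime s n κ = (s + 1) * unitCost κ + (s + n) * unitCost κ + 3 * unitCost κ := by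
      unfold endTime; ring
    omega
  | succ i ih =>
    have hilt : i < l := hil
    obtain ⟨cs, hcs, hask⟩ := exists_contractKet hO hilt hl.le b
    obtain ⟨c0, hc0⟩ := C.exists_contraction_ne_zero_left i l b
    obtain ⟨a, cs, rfl⟩ := List.exists_cons_of_ne_nil (List.ne_nil_of_mem ((hcs.2 c0).2 hc0))
    have ha : C.contraction i l a b ≠ 0 := (hcs.2 a).1 List.mem_cons_self
    have hinfo := hO.info i (hilt.trans hl) a
    have hD : 2 * (i + 1) * unitCost κ = 2 * i * unitCost κ + 2 * unitCost κ := by ring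
    have h' : ∀ j, i < j → j < l → C.TrivLeft j l b := fun j h1 h2 => h j h1 h2
    by_cases ht : C.IsTriv i a.1
    · rw [if_pos ht] at hinfo
      have htr := hC.trivLeft hilt hl b h' ha ht
      have hcond : ∀ y : Val, Runs (main :: library) O κ
        [Val.ofList ((a :: cs).map fun a => .cons (C.labelVal i a) (.num (C.contraction i l a b))),
          .cons y (.cons (.cons (.nat l) (C.labelVal l b)) (.cons (.nat (i + 1)) (.cons (.nat ρ)
          (Val.ofList (as.map fun a => .cons (C.labelVal (i + 1) a)
            (.num (C.contraction (i + 1) l a b)))))))] (.nth 1 (.ask .info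
              (.list2 (.pred (Code.var 1).snd.snd.fst) (Code.var 0).fst.fst))) (.nat 1)
          (50 * (κ + 1)) := fun y => .pure rfl (by decide)
            (congrArg (fun v => Op1.run .fst (Op1.run .snd v)) hinfo)
      cases ρ with
      | zero =>
        rw [C.scan_triv_zero M _ _ hilt b htr, zero_mul, map_zero]
        refine Runs.mono (Runs.iteTrue (v := .nat (i + 1)) (.pure rfl (by decide) rfl) (by simp)
          (Runs.letIn (.pure rfl (by decide) hask) ((hcond _).iteTrue (by simp)
            (Runs.iteFalse (.pure rfl (by decide) rfl) Runs.zero)))) ?_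
        omega
      | succ ρ =>
        rw [C.scan_triv_succ M _ _ hilt ρ b htr]
        refine Runs.mono (Runs.iteTrue (v := .nat (i + 1)) (.pure rfl (by decide) rfl) (by simp)
          (Runs.letIn (.pure rfl (by decide) hask) ((hcond _).iteTrue (by simp)
            (Runs.iteTrue (v := .nat (ρ + 1)) (.pure rfl (by decide) rfl) (by simp)
              (Runs.call (.pure rfl (by decide) rfl) rfl
                (ih hilt.le ρ (fun j h1 h2 => ?_) hcs)))))) ?_
        · rcases Nat.eq_or_lt_of_le h1 with rfl | h3
          · exact htr
          · exact h' j h3 h2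
        · omega
    · rw [if_neg ht] at hinfo
      refine Runs.mono (Runs.iteTrue (v := .nat (i + 1)) (.pure rfl (by decide) rfl) (by simp)
        (Runs.letIn (.pure rfl (by decide) hask) (Runs.iteFalse (.pure rfl (by decide)
          (congrArg (fun v => Op1.run .fst (Op1.run .snd v)) hinfo))
          (runs_chooseBack hO hs main κ L m x rest c₀ w ?_ hilt hl b ρ _ ?_ hcs)))) ?_
      · rintro w' rfl i' hi' b'
        -- After a non-trivial layer the scan restarts from the new label with the full allowance of
        -- M+1 trivial layers.
        have := ihw w' (by omega) (le_refl i') hi' b' (M + 1) (fun j h1 h2 => by omega)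
          (C.enumerates_self b')
        simp only [List.map_cons, List.map_nil, contraction_self, if_true] at this
        exact this.mono (Nat.add_le_add_right (Nat.mul_le_mul_right _ (by omega)) _)
      · exact (hC.left hilt hl b h').resolve_left fun h'' => ht (h'' a ha)
      · omega

end Specs
end NoisyCircuit

/-! ### Evaluation of marginals of the truncated distribution. -/

namespace NoisyCircuit

variable {G : Type*} [Group G] [TopologicalSpace G] {n d : ℕ} (C : NoisyCircuit G n d)

/-- Paths through irreps of dimension above `dmax` do not contribute. -/
theorem prefixMarginal_pNoisyTrunc [NeZero d] {D L dmax : ℕ} {γ : ℝ} (hdim : C.IrrepDimBound D L dmax)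
    (hγ : C.NoisePenalised D γ) (h1 : 1 ≤ dmax) (g : Fin D → G) (x : Outcome n d) (m : ℕ) :
    prefixMarginal (C.pNoisyTrunc L g) x m =
      tau L (∑ c, row (C.ker (C.cutAmp dmax (C.layerAmp C.eig (extend g))))
        (fun b => Polynomial.C (C.marginalRow x m b)) D c * C.overlap D c) := by
  rw [← C.sum_path_eq_tau]
  · simp only [prefixMarginal, pNoisyTrunc, marginalRow]
    rw [Finset.sum_comm]
    refine Finset.sum_congr rfl fun q hq => ?_
    rw [Finset.sum_mul, Finset.sum_mul]
    refine Finset.sum_congr rfl fun z _ => ?_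
    have hval : q.value C.eig g z = C.T _ (q.1 0) z z *
        (∏ i : Fin D, C.layerAmp C.eig (extend g) i (q.1 i.castSucc) (q.2 i) * q.transfer i) *
          starRingEnd ℂ (C.T _ (q.1 (Fin.last D)) 0 0) := by
      rw [Path.value]
      congr 2
      refine Finset.prod_congr rfl fun i _ => ?_
      rw [layerAmp, extend_apply]
      rfl
    rw [hval]
    by_cases hv : q.Valid
    · congr 2
      refine Finset.prod_congr rfl fun i _ => ?_
      congr 1
      exact (C.cutAmp_of_le _ (j := i) (b := q.1 i.castSucc)
        (hdim q hv (Finset.mem_filter.1 hq).2 i) _).symm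
    -- An invalid path contributes zero with either amplitude, so it does not matter that its irreps
    -- may be large.
    · by_cases h0 : C.T _ (q.1 0) z z = 0
      · exact (mul_eq_zero_of_left (mul_eq_zero_of_left h0 _) _).trans
          (mul_eq_zero_of_left (mul_eq_zero_of_left h0 _) _).symm
      · by_cases h2 : C.T _ (q.1 (Fin.last D)) 0 0 = 0
        · rw [h2, map_zero, mul_zero, mul_zero]
        · obtain ⟨i, hi⟩ : ∃ i, q.transfer i = 0 := by
            by_contra! hne
            exact hv ⟨hne, ⟨z, h0⟩, h2⟩
          have h3 : ∀ F : Fin D → ℂ, ∏ i, F i * q.transfer i = 0 := fun F =>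
            Finset.prod_eq_zero (Finset.mem_univ i) (by rw [hi, mul_zero])
          simp only [h3, mul_zero, zero_mul]
  -- Trivial irreps have dimension 1 ≤ `dmax`, so the restriction leaves them alone, and noise and
  -- coefficient are both 1.
  · intro j hj b hb k
    have hd := hb.dim_eq_one
    rw [C.cutAmp_of_le _ (hd.le.trans h1), layerAmp, (hγ j hj b.1 b.2.2).1 hb, one_mul, coeff,
      hb]
    have : b.2.2 = k := by
      ext
      have := b.2.2.2
      have := k.2
      omega
    rw [this]
    exact Matrix.one_apply_eq k

/-- The truncated distribution is normalised. -/
theorem sum_pNoisyTrunc [NeZero d] {D L dmax : ℕ} {γ : ℝ} (hdim : C.IrrepDimBound D L dmax)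
    (hγ : C.NoisePenalised D γ) (h1 : 1 ≤ dmax) (g : Fin D → G) :
    ∑ x, C.pNoisyTrunc L g x = 1 := by
  -- The marginal at the empty prefix is the total sum. Its initial row consists of traces, which
  -- propagate unchanged and without any X, so the truncation loses nothing.
  have h := C.prefixMarginal_pNoisyTrunc hdim hγ h1 g 0 0
  have h2 : ∀ f : Outcome n d → ℂ, prefixMarginal f 0 0 = ∑ x, f x := fun f => by
    simp [prefixMarginal]
  have h3 := sum_row_mul_col (C.ker (C.cutAmp dmax (C.layerAmp C.eig (extend g))))
    (fun b => Polynomial.C (C.marginalRow 0 0 b)) C.overlap D 0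
  simp only [col] at h3
  rw [h2, h3] at h
  rw [h]
  have h4 : ∀ b, C.marginalRow 0 0 b = (C.T 0 b).trace := fun b => h2 _
  simp only [h4]
  rw [sum_trace_mul_col, ← map_one Polynomial.C, tau_C]

/-- Time bound for the evaluation of a marginal. -/
def evalTime (D s dmax n κ rank L : ℕ) : ℕ :=
  (D + 1) * (rank * (2 * unitCost κ + 2 * D * unitCost κ + backTime D s dmax n κ L) +
    3 * unitCost κ)

section Specs

variable {C} {D M s dmax rank L m : ℕ} {g : Fin D → G} {O : Subroutine → Val → Val}
  (hO : C.Subroutines D M dmax g O) (hs : C.SparseContractions D s) (main : Code) (κ : ℕ)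
  (x : Outcome n d) (rest : Val) [NeZero d]

include hO hs

theorem runs_entries (hC : C.ControlledGrowth D) (hs1 : 1 ≤ s) (hm : m ≤ n)
    (hw : C.ContractibleWindows D M rank) {i : ℕ} (hi : i + M + 1 < D) :
    Runs (main :: library) O κ
      [.cons (.cons (.cons (prefixVal x m) (params n d D L M dmax rest)) (.nat i))
        (O .contractFull (.nat i))] (Code.sumLoop 3 Code.entryBody)
      (.num (∑ b : C.Label i, ∑ c : C.Label (i + M + 1), C.windowEntry i M b c *
          tau L (C.runs M (C.cutAmp dmax (C.layerAmp C.eig (extend g))) (C.marginalRow x m) i 0 b *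
            C.fwd (C.cutAmp dmax (C.layerAmp C.eig (extend g))) (D - (i + M + 2)) (i + M + 1) c)))
      (rank * (2 * unitCost κ + 2 * D * unitCost κ + backTime D s dmax n κ L) + unitCost κ) := by
  obtain ⟨es, h1, h2, h3⟩ := hO.contractFull i hi
  have hes : Enumerates es (fun e => C.windowEntry i M e.1 e.2) := ⟨h1, h2⟩
  rw [h3, ← Fintype.sum_prod_type', ← hes.sum_eq]
  refine (Runs.sumLoop (P := main :: library) (body := Code.entryBody) rfl
    (fun e : C.Label i × C.Label (i + M + 1) => Val.ofList
      [C.labelVal i e.1, C.labelVal (i + M + 1) e.2, .num (C.windowEntry i M e.1 e.2)]) _ _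
    (260 * (κ + 1) + (2 * D * unitCost κ + backTime D s dmax n κ L)) es fun e _ rest' => ?_).mono ?_
  -- The allowance is 0 here: the window starts its run, so the layer before it must be non-trivial
  -- or absent.
  · have hsc := runs_scanBack hO hs main κ L m x rest hC hs1 hm hi e.2 L (le_refl i) (by omega) e.1
      0 (fun j h1 h2 => by omega) (C.enumerates_self e.1)
    simp only [List.map_cons, List.map_nil, contraction_self, if_true, scan_self, zero_add,
      Finset.sum_range_one] at hsc
    have hone : ((1 : ℕ) : ℂ) = 1 := Nat.cast_one
    have hle : 2 * i * unitCost κ ≤ 2 * D * unitCost κ := Nat.mul_le_mul_right _ (by omega)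
    refine Runs.mono (Runs.mul (.pure rfl (by decide) rfl)
      (Runs.call (.ofVal rfl ?_ (Nat.mul_le_mul_right _ (by decide : _ ≤ 150))) rfl hsc)) ?_
    · rw [← hone]; rfl
    · omega
  · have hlen : es.length ≤ rank := hes.length_eq ▸ hw i hi
    have hu : unitCost κ = 500 * (κ + 1) := rfl
    have := Nat.mul_le_mul hlen (show 260 * (κ + 1) + (2 * D * unitCost κ +
      backTime D s dmax n κ L) + 16 * (κ + 1) ≤ 2 * unitCost κ + 2 * D * unitCost κ +
        backTime D s dmax n κ L by omega)
    omega

theorem runs_windows (hC : C.ControlledGrowth D) (hs1 : 1 ≤ s) (hm : m ≤ n)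
    (hw : C.ContractibleWindows D M rank) (k : ℕ) (hk : k ≤ D - (M + 1)) :
    Runs (main :: library) O κ
      [.cons (.cons (prefixVal x m) (params n d D L M dmax rest)) (.nat k)] Code.windowsFn
      (.num (∑ i ∈ Finset.range k, ∑ b : C.Label i, ∑ c : C.Label (i + M + 1),
        C.windowEntry i M b c *
          tau L (C.runs M (C.cutAmp dmax (C.layerAmp C.eig (extend g))) (C.marginalRow x m) i 0 b *
            C.fwd (C.cutAmp dmax (C.layerAmp C.eig (extend g))) (D - (i + M + 2)) (i + M + 1) c)))
      (k * (rank * (2 * unitCost κ + 2 * D * unitCost κ + backTime D s dmax n κ L) +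
        3 * unitCost κ) + unitCost κ) := by
  have hu : unitCost κ = 500 * (κ + 1) := rfl
  induction k with
  | zero =>
    rw [Finset.sum_range_zero]
    exact Runs.mono (Runs.iteFalse (.pure rfl (by decide) rfl) Runs.zero) (by omega)
  | succ k ih =>
    rw [Finset.sum_range_succ, add_comm (Finset.sum _ _)]
    refine Runs.mono (Runs.iteTrue (v := .nat (k + 1)) (.pure rfl (by decide) rfl) (by simp)
      (Runs.add (Runs.call (.pure rfl (by decide) rfl) rfl
        (runs_entries hO hs main κ x rest hC hs1 hm hw (by omega)))
        (Runs.call (.pure rfl (by decide) rfl) rfl (ih (by omega))))) ?_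
    rw [add_mul k]
    omega

/-- The evaluator computes marginals of the truncated distribution. -/
theorem runs_eval {γ : ℝ} (hC : C.ControlledGrowth D) (hs1 : 1 ≤ s) (hm : m ≤ n)
    (hw : C.ContractibleWindows D M rank) (hD : (M + 2) * (L + 1) ≤ D)
    (hdim : C.IrrepDimBound D L dmax) (hγ : C.NoisePenalised D γ) (h1 : 1 ≤ dmax) :
    Runs (main :: library) O κ [.cons (prefixVal x m) (params n d D L M dmax rest)] Code.evalFn
      (.num (prefixMarginal (C.pNoisyTrunc L g) x m)) (evalTime D s dmax n κ rank L) := by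
  have hu : unitCost κ = 500 * (κ + 1) := rfl
  rw [C.prefixMarginal_pNoisyTrunc hdim hγ h1, C.tau_sum_row_eq_sum_windows M _ _ hD]
  refine Runs.mono (Runs.call (.pure rfl (by decide) rfl) rfl
    (runs_windows hO hs main κ x rest hC hs1 hm hw (D - (M + 1)) le_rfl)) ?_
  have h2 := Nat.mul_le_mul_right (rank * (2 * unitCost κ + 2 * D * unitCost κ +
    backTime D s dmax n κ L) + 3 * unitCost κ) (show D - (M + 1) ≤ D by omega)
  rw [evalTime, add_mul D]
  omega

theorem runsWithin_evaluator {γ : ℝ} (hC : C.ControlledGrowth D) (hs1 : 1 ≤ s) (hm : m ≤ n)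
    (hw : C.ContractibleWindows D M rank) (hD : (M + 2) * (L + 1) ≤ D)
    (hdim : C.IrrepDimBound D L dmax) (hγ : C.NoisePenalised D γ) (h1 : 1 ≤ dmax) :
    RunsWithin evaluatorProgram O κ
      (Val.ofList [.nat n, .nat d, .nat D, .nat L, .nat M, .nat dmax, prefixVal x m])
      (.num (prefixMarginal (C.pNoisyTrunc L g) x m))
      (evalTime D s dmax n κ rank L + unitCost κ) := by
  have hu : unitCost κ = 500 * (κ + 1) := rfl
  exact Runs.mono (Runs.call (.pure rfl (by decide) rfl) rfl
    (Runs.call (.pure rfl (by decide) rfl) rfl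
      (runs_eval hO hs _ κ x (.cons (prefixVal x m) .nil) hC hs1 hm hw hD hdim hγ h1))) (by omega)

end Specs
end NoisyCircuit

/-! ### Sampling from a normalised quasi-distribution -/

section Pick

/-- The first index from `a` on, but at most `a + k`, at which the partial sums exceed `θ`. -/
def pick (θ : ℝ) (w : ℕ → ℂ) : ℕ → ℕ → ℕ
  | 0, a => a
  | k + 1, a => if θ < (∑ b ∈ Finset.range (a + 1), w b).re then a else pick θ w k (a + 1)

theorem pick_le (θ : ℝ) (w : ℕ → ℂ) (k a : ℕ) : pick θ w k a ≤ a + k := by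
  induction k generalizing a with
  | zero => exact le_rfl
  | succ k ih =>
    rw [pick]
    split_ifs
    · omega
    · have := ih (a + 1)
      omega

theorem lt_sum_of_pick_lt {θ : ℝ} {w : ℕ → ℂ} {k a : ℕ} (h : pick θ w k a < a + k) :
    θ < (∑ b ∈ Finset.range (pick θ w k a + 1), w b).re := by
  induction k generalizing a with
  | zero => exact absurd h (lt_irrefl _)
  | succ k ih =>
    rw [pick] at h ⊢
    split_ifs with h1
    · exact h1
    · rw [if_neg h1] at h
      exact ih (by omega)

theorem le_pick (θ : ℝ) (w : ℕ → ℂ) (k a : ℕ) : a ≤ pick θ w k a := by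
  induction k generalizing a with
  | zero => exact le_rfl
  | succ k ih =>
    rw [pick]
    split_ifs
    · exact le_rfl
    · have := ih (a + 1)
      omega

theorem sum_le_of_lt_pick {θ : ℝ} {w : ℕ → ℂ} {k a : ℕ} (h : a < pick θ w k a) :
    (∑ b ∈ Finset.range (pick θ w k a), w b).re ≤ θ := by
  induction k generalizing a with
  | zero => exact absurd h (lt_irrefl _)
  | succ k ih =>
    rw [pick] at h ⊢
    split_ifs with h1
    · exact absurd (if_pos h1 ▸ h) (lt_irrefl _)
    · rcases (le_pick θ w k (a + 1)).eq_or_lt with h2 | h2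
      · rw [← h2]
        exact not_lt.1 h1
      · exact ih h2

theorem measurable_pick (w : ℕ → ℂ) (k a : ℕ) : Measurable fun θ => pick θ w k a := by
  induction k generalizing a with
  | zero => exact measurable_const
  | succ k ih => exact Measurable.ite measurableSet_Iio measurable_const (ih (a + 1))

/-- The probability that a given index is picked is at most its relative weight. -/
theorem mul_volume_pick_le (w : ℕ → ℂ) (hw : ∀ b, 0 ≤ (w b).re) (k r : ℕ) :
    (∑ b ∈ Finset.range (k + 1), w b).re *
      (volume {u : ℝ | u ∈ Set.Icc (0 : ℝ) 1 ∧
        pick (u * ∑ b ∈ Finset.range (k + 1), w b).re w k 0 = r}).toReal ≤ (w r).re := by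
  set S := ∑ b ∈ Finset.range (k + 1), w b with hS
  have hSum : ∀ m, 0 ≤ (∑ b ∈ Finset.range m, w b).re := fun m => by
    rw [Complex.re_sum]
    exact Finset.sum_nonneg fun b _ => hw b
  rcases (hSum (k + 1)).eq_or_lt with h0 | h0
  · rw [hS, ← h0, zero_mul]
    exact hw r
  rw [← hS] at h0
  -- The index `r` is picked only if u·S lies between two consecutive partial sums. The first index
  -- has no lower test and the last no upper one; there 0 ≤ u and u ≤ 1 take over.
  have hsub : {u : ℝ | u ∈ Set.Icc (0 : ℝ) 1 ∧ pick (u * S).re w k 0 = r} ⊆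
      Set.Icc ((∑ b ∈ Finset.range r, w b).re / S.re)
        ((∑ b ∈ Finset.range (r + 1), w b).re / S.re) := by
    rintro u ⟨⟨hu0, hu1⟩, rfl⟩
    have hre : ((u : ℂ) * S).re = u * S.re := by simp
    constructor
    · rw [div_le_iff₀ h0, ← hre]
      rcases (Nat.zero_le (pick (u * S).re w k 0)).eq_or_lt with h1 | h1
      · rw [← h1, Finset.sum_range_zero, hre, Complex.zero_re]
        positivity
      · exact sum_le_of_lt_pick h1
    · rw [le_div_iff₀ h0, ← hre]
      rcases (pick_le (u * S).re w k 0).eq_or_lt with h1 | h1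
      · rw [h1, zero_add, hre, ← hS]
        exact mul_le_of_le_one_left h0.le hu1
      · exact (lt_sum_of_pick_lt h1).le
  have h2 := ENNReal.toReal_mono (by simp) (measure_mono (μ := volume) hsub)
  rw [Real.volume_Icc, ENNReal.toReal_ofReal (by
    rw [Finset.sum_range_succ, Complex.add_re, add_div]
    have := div_nonneg (hw r) h0.le
    linarith)] at h2
  calc _ ≤ S.re * _ := mul_le_mul_of_nonneg_left h2 h0.le
    _ = (w r).re := by
      rw [Finset.sum_range_succ, Complex.add_re]
      field_simp
      ring

end Pick

theorem prefixMarginal_congr {n d : ℕ} {F : Outcome n d → ℂ} {x y : Outcome n d} {m : ℕ}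
    (h : ∀ i : Fin n, (i : ℕ) < m → x i = y i) : prefixMarginal F x m = prefixMarginal F y m := by
  rw [prefixMarginal, prefixMarginal]
  congr 1
  ext z
  simp only [Finset.mem_filter, Finset.mem_univ, true_and]
  exact forall_congr' fun i => forall_congr' fun hi => by rw [h i hi]

section Sampling

variable {n d : ℕ} {F : Outcome n d → ℂ}

/-- Weight of the extension of a prefix of length `i` by a given entry: the positive part of the
corresponding marginal. -/
def weight (F : Outcome n d → ℂ) (x : Outcome n d) (i : Fin n) (b : ℕ) : ℂ :=
  if h : b < d then
    if 0 < (prefixMarginal F (Function.update x i ⟨b, h⟩) (i + 1)).re then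
      prefixMarginal F (Function.update x i ⟨b, h⟩) (i + 1) else 0
  else 0

theorem weight_re_nonneg (x : Outcome n d) (i : Fin n) (b : ℕ) : 0 ≤ (weight F x i b).re := by
  rw [weight]
  split_ifs with h h1
  · exact h1.le
  · exact le_rfl
  · exact le_rfl

theorem weight_re (x : Outcome n d) (i : Fin n) (a : Fin d) : (weight F x i a).re =
    max (prefixMarginal F (Function.update x i a) (i + 1)).re 0 := by
  rw [weight, dif_pos a.2]
  split_ifs with h1
  · exact (max_eq_left h1.le).symm
  · exact (max_eq_right (not_lt.1 h1)).symm

theorem weight_congr {x y : Outcome n d} {i : Fin n} (h : ∀ j < i, x j = y j) :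
    weight F x i = weight F y i := by
  funext b
  rw [weight, weight]
  refine dite_congr rfl (fun hb => ?_) fun _ => rfl
  rw [prefixMarginal_congr (y := Function.update y i ⟨b, _⟩) fun j hj => ?_]
  rcases eq_or_ne j i with rfl | hne
  · rw [Function.update_self, Function.update_self]
  · rw [Function.update_of_ne hne, Function.update_of_ne hne]
    exact h j (Fin.lt_def.2 (by have := Fin.val_ne_of_ne hne; omega))

theorem prefixMarginal_eq_sum (x : Outcome n d) (i : Fin n) : prefixMarginal F x i =
    ∑ a, prefixMarginal F (Function.update x i a) (i + 1) := by
  simp only [prefixMarginal]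
  rw [← Finset.sum_fiberwise _ fun z : Outcome n d => z i]
  refine Finset.sum_congr rfl fun a _ => ?_
  rw [Finset.filter_filter]
  congr 1
  ext z
  simp only [Finset.mem_filter, Finset.mem_univ, true_and]
  constructor
  · rintro ⟨h1, rfl⟩ j hj
    rcases eq_or_ne j i with rfl | hne
    · rw [Function.update_self]
    · rw [Function.update_of_ne hne]
      exact h1 j (by have := Fin.val_ne_of_ne hne; omega)
  · intro h
    refine ⟨fun j hj => ?_, ?_⟩
    · rw [h j (by omega), Function.update_of_ne (by rintro rfl; exact lt_irrefl _ hj)]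
    · rw [h i (by omega), Function.update_self]

variable [NeZero d]

/-- The entry chosen after a prefix of length `i`. -/
def choice (F : Outcome n d → ℂ) (x : Outcome n d) (i : Fin n) (u : ℝ) : Fin d :=
  ⟨pick (u * ∑ b ∈ Finset.range d, weight F x i b).re (weight F x i) (d - 1) 0, by
    have := pick_le (u * ∑ b ∈ Finset.range d, weight F x i b).re (weight F x i) (d - 1) 0
    have := NeZero.pos d
    omega⟩

/-- The outcome after the choice of the first `k` entries. -/
def stage (F : Outcome n d → ℂ) (u : Fin n → ℝ) : ℕ → Outcome n d
  | 0 => 0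
  | k + 1 => if h : k < n then
      Function.update (stage F u k) ⟨k, h⟩ (choice F (stage F u k) ⟨k, h⟩ (u ⟨k, h⟩)) else stage F u k

theorem choice_congr {x y : Outcome n d} {i : Fin n} (h : ∀ j < i, x j = y j) :
    choice F x i = choice F y i := by
  funext u
  simp only [choice, weight_congr h]

theorem stage_succ_of_ne (u : Fin n → ℝ) {k : ℕ} {j : Fin n} (h : (j : ℕ) ≠ k) :
    stage F u (k + 1) j = stage F u k j := by
  rw [stage]
  split_ifs with hk
  · exact Function.update_of_ne (fun h1 : j = ⟨k, hk⟩ => h (by rw [h1])) _ _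
  · rfl

theorem stage_eq (u : Fin n → ℝ) {k : ℕ} {j : Fin n} (h : (j : ℕ) < k) :
    stage F u k j = stage F u (j + 1) j := by
  induction k, h using Nat.le_induction with
  | base => rfl
  | succ k hk ih => rw [stage_succ_of_ne u (by omega), ih]

theorem stage_self (u : Fin n → ℝ) (j : Fin n) :
    stage F u (j + 1) j = choice F (stage F u j) j (u j) := by
  rw [stage, dif_pos j.2]
  exact Function.update_self (β := fun _ : Fin n => Fin d) j _ _

/-- The output is the outcome that agrees with all choices. -/
theorem stage_eq_iff (u : Fin n → ℝ) (x : Outcome n d) :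
    stage F u n = x ↔ ∀ i, choice F x i (u i) = x i := by
  have key : ∀ i, stage F u n i = choice F (stage F u n) i (u i) := fun i => by
    rw [stage_eq u i.2, stage_self]
    refine congrFun (choice_congr fun j hj => ?_) _
    rw [stage_eq u hj, stage_eq u j.2]
  constructor
  · rintro rfl i
    exact (key i).symm
  · intro h
    have : ∀ k, ∀ i : Fin n, (i : ℕ) < k → stage F u n i = x i := by
      intro k
      induction k with
      | zero => exact fun i hi => absurd hi (Nat.not_lt_zero _)
      | succ k ih =>
        intro i hi
        rw [key, ← h i]
        exact congrFun (choice_congr fun j hj => ih j (by have := Fin.lt_def.1 hj; omega)) _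
    exact funext fun i => this n i i.2

theorem measurable_choice (x : Outcome n d) (i : Fin n) : Measurable (choice F x i) := by
  have h : Measurable fun u : ℝ => pick (u * ∑ b ∈ Finset.range d, weight F x i b).re
      (weight F x i) (d - 1) 0 := by
    refine (measurable_pick _ _ _).comp (Complex.measurable_re.comp ?_)
    exact Complex.measurable_ofReal.mul_const _
  refine measurable_to_countable' fun a => ?_
  have : choice F x i ⁻¹' {a} = (fun u : ℝ => pick (u * ∑ b ∈ Finset.range d, weight F x i b).re
      (weight F x i) (d - 1) 0) ⁻¹' {(a : ℕ)} := by
    ext u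
    exact Fin.ext_iff
  rw [this]
  exact h (measurableSet_singleton _)

theorem measurableSet_stage (x : Outcome n d) :
    MeasurableSet {u : Fin n → ℝ | stage F u n = x} := by
  simp only [stage_eq_iff, Set.ofPred_forall]
  exact MeasurableSet.iInter fun i =>
    ((measurable_choice x i).comp (measurable_pi_apply i)) (measurableSet_singleton (x i))

/-- The conditional probability of an entry. -/
def entryProb (F : Outcome n d → ℂ) (x : Outcome n d) (i : Fin n) : ℝ :=
  (volume {u : ℝ | u ∈ Set.Icc (0 : ℝ) 1 ∧ choice F x i u = x i}).toReal

/-- The probability of an outcome. -/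
def outProb (F : Outcome n d → ℂ) (x : Outcome n d) : ℝ :=
  (volume {u : Fin n → ℝ | (∀ i, u i ∈ Set.Icc (0 : ℝ) 1) ∧ stage F u n = x}).toReal

/-- By `stage_eq_iff` the choices may be computed along `x` itself, so the event is a product of
conditions on the separate coordinates of `u`. -/
theorem outProb_eq_prod (x : Outcome n d) : outProb F x = ∏ i, entryProb F x i := by
  have : {u : Fin n → ℝ | (∀ i, u i ∈ Set.Icc (0 : ℝ) 1) ∧ stage F u n = x} =
      Set.univ.pi fun i => {u : ℝ | u ∈ Set.Icc (0 : ℝ) 1 ∧ choice F x i u = x i} := by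
    ext u
    simp only [Set.mem_ofPred_eq, Set.mem_univ_pi, stage_eq_iff]
    exact forall_and.symm
  rw [outProb, this, volume_pi_pi, ENNReal.toReal_prod]
  rfl

theorem sum_outProb : ∑ x, outProb F x = 1 := by
  set Q : Set (Fin n → ℝ) := Set.univ.pi fun _ => Set.Icc (0 : ℝ) 1 with hQ
  have hQ1 : volume Q = 1 := by
    rw [hQ, volume_pi_pi]
    simp
  have hm : ∀ x, MeasurableSet ((fun u : Fin n → ℝ => stage F u n) ⁻¹' {x}) := measurableSet_stage
  have h := sum_measure_preimage_singleton (μ := volume.restrict Q) Finset.univ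
    (f := fun u : Fin n → ℝ => stage F u n) fun x _ => hm x
  rw [Finset.coe_univ, Set.preimage_univ, Measure.restrict_apply_univ, hQ1] at h
  have h2 : ∀ x, outProb F x =
      (volume.restrict Q ((fun u : Fin n → ℝ => stage F u n) ⁻¹' {x})).toReal := fun x => by
    rw [Measure.restrict_apply (hm x), outProb]
    congr 2
    ext u
    exact ⟨fun h => ⟨h.2, fun i _ => h.1 i⟩, fun h => ⟨fun i => h.2 i trivial, h.1⟩⟩
  simp only [h2]
  rw [← ENNReal.toReal_sum, h, ENNReal.toReal_one]
  intro x _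
  exact ((measure_mono (Set.subset_univ _)).trans_lt
    (by rw [Measure.restrict_apply_univ, hQ1]; exact ENNReal.one_lt_top)).ne

/-- The conditional probability of an entry is at most its weight divided by the total weight, and
the total weight is at least the positive part of the previous marginal. The product telescopes from
the empty prefix, where the marginal is 1. -/
theorem prod_entryProb_le (hF : ∑ x, F x = 1) (x : Outcome n d) (k : ℕ) (hk : k ≤ n) :
    ∏ i ∈ Finset.univ.filter (fun i : Fin n => (i : ℕ) < k), entryProb F x i ≤ max (prefixMarginal F x k).re 0 := by
  induction k with
  | zero =>
    have : prefixMarginal F x 0 = 1 := by rw [← hF]; simp [prefixMarginal]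
    simp [this]
  | succ k ih =>
    set i : Fin n := ⟨k, hk⟩
    have hset : (Finset.univ.filter fun j : Fin n => (j : ℕ) < k + 1) =
        insert i (Finset.univ.filter fun j : Fin n => (j : ℕ) < k) := by
      ext j
      simp only [Finset.mem_filter, Finset.mem_univ, true_and, Finset.mem_insert, Fin.ext_iff, i]
      omega
    rw [hset, Finset.prod_insert (by simp [i])]
    have hd : d - 1 + 1 = d := Nat.sub_add_cancel (NeZero.pos d)
    have hp := mul_volume_pick_le (weight F x i) (weight_re_nonneg x i) (d - 1) (x i)
    rw [hd] at hp
    have he : entryProb F x i = (volume {u : ℝ | u ∈ Set.Icc (0 : ℝ) 1 ∧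
        pick (u * ∑ b ∈ Finset.range d, weight F x i b).re (weight F x i) (d - 1) 0 =
          (x i : ℕ)}).toReal := by
      rw [entryProb]
      congr 3
      ext u
      exact and_congr_right fun _ => Fin.ext_iff
    rw [← he, weight_re, Function.update_eq_self] at hp
    -- The positive part of a sum is at most the sum of the positive parts.
    have hS : max (prefixMarginal F x k).re 0 ≤
        (∑ b ∈ Finset.range d, weight F x i b).re := by
      rw [← Fin.sum_univ_eq_sum_range (fun b => weight F x i b), Complex.re_sum]
      refine max_le ?_ (Finset.sum_nonneg fun b _ => weight_re_nonneg x i b)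
      rw [show prefixMarginal F x k = _ from prefixMarginal_eq_sum x i, Complex.re_sum]
      exact Finset.sum_le_sum fun a _ => by
        rw [weight_re]
        exact le_max_left _ _
    have h0 : 0 ≤ entryProb F x i := ENNReal.toReal_nonneg
    calc _ ≤ entryProb F x i * (∑ b ∈ Finset.range d, weight F x i b).re :=
          mul_le_mul_of_nonneg_left ((ih (by omega)).trans hS) h0
      _ ≤ _ := by rw [mul_comm]; exact hp

theorem outProb_le (hF : ∑ x, F x = 1) (x : Outcome n d) : outProb F x ≤ max (F x).re 0 := by
  have h := prod_entryProb_le hF x n le_rfl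
  rw [Finset.filter_true_of_mem fun i _ => i.2, ← outProb_eq_prod] at h
  have h2 : prefixMarginal F x n = F x := by
    rw [prefixMarginal, Finset.sum_eq_single_of_mem x (by simp)]
    intro z hz hne
    exact absurd (funext fun i => (Finset.mem_filter.1 hz).2 i i.2) hne
  rwa [h2] at h

/-- The distribution sampled from is at most twice as far from a given probability distribution as
the quasi-distribution. -/
theorem sum_abs_sub_outProb_le (hF : ∑ x, F x = 1) {p : Outcome n d → ℝ} (hp : ∀ x, 0 ≤ p x)
    (hp1 : ∑ x, p x = 1) : ∑ x, |p x - outProb F x| ≤ 2 * ∑ x, ‖(p x : ℂ) - F x‖ := by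
  have hq : ∀ x, 0 ≤ outProb F x := fun x => ENNReal.toReal_nonneg
  have h1 : ∀ x, |p x - (F x).re| ≤ ‖(p x : ℂ) - F x‖ := fun x => by
    have := Complex.abs_re_le_norm ((p x : ℂ) - F x)
    simpa using this
  -- Where Re F is non-negative it dominates q, and elsewhere q vanishes. Summation with Σ q = Σ p =
  -- 1 then bounds the distance from Re F to q by that from p to Re F.
  have h2 : ∀ x, |(F x).re - outProb F x| = |(F x).re| - outProb F x := fun x => by
    have := outProb_le hF x
    have := hq x
    rcases le_total 0 (F x).re with h | h
    · rw [max_eq_left h] at *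
      rw [abs_of_nonneg h, abs_of_nonneg (by linarith)]
    · rw [max_eq_right h] at *
      rw [abs_of_nonpos h, abs_of_nonpos (by linarith)]
      linarith
  have h3 : ∑ x, |(F x).re - outProb F x| ≤ ∑ x, |p x - (F x).re| := by
    simp only [h2]
    rw [Finset.sum_sub_distrib, sum_outProb, ← hp1, ← Finset.sum_sub_distrib]
    refine Finset.sum_le_sum fun x _ => ?_
    have h4 := abs_sub_abs_le_abs_sub (F x).re (p x)
    rwa [abs_of_nonneg (hp x), abs_sub_comm] at h4
  calc ∑ x, |p x - outProb F x| ≤ ∑ x, (|p x - (F x).re| + |(F x).re - outProb F x|) :=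
        Finset.sum_le_sum fun x _ => abs_sub_le _ _ _
    _ ≤ 2 * ∑ x, |p x - (F x).re| := by
        rw [Finset.sum_add_distrib]
        linarith
    _ ≤ _ := mul_le_mul_of_nonneg_left (Finset.sum_le_sum fun x _ => h1 x) (by norm_num)

end Sampling

/-! ### Correctness of the sampler -/

theorem runs_snoc (main : Code) (O : Subroutine → Val → Val) (κ : ℕ) (l : List Val) (v : Val) :
    Runs (main :: library) O κ [.cons (Val.ofList l) v] Code.snocFn (Val.ofList (l ++ [v]))
      ((l.length + 1) * unitCost κ) := by
  have hu : unitCost κ = 500 * (κ + 1) := rfl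
  induction l with
  | nil =>
    exact Runs.mono (Runs.iteFalse (.pure rfl (by decide) rfl) (.pure rfl (by decide) rfl))
      (by simp; omega)
  | cons a l ih =>
    refine Runs.mono (Runs.iteTrue (v := .nat 1) (.pure rfl (by decide) rfl) (by simp)
      (Runs.op2 .cons (.pure rfl (by decide) rfl)
        (Runs.call (.pure rfl (by decide) rfl) rfl ih))) ?_
    rw [List.length_cons, add_mul (l.length + 1)]
    omega

theorem prefixVal_update {n d : ℕ} (x : Outcome n d) (i : Fin n) (a : Fin d) :
    prefixVal (Function.update x i a) (i + 1) =
      Val.ofList (((List.ofFn x).take i).map (fun a : Fin d => .nat a) ++ [.nat a]) := by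
  rw [prefixVal_eq]
  congr 1
  have : (List.ofFn (Function.update x i a)).take (i + 1) = (List.ofFn x).take i ++ [a] := by
    refine List.ext_getElem (by simp) fun j h1 h2 => ?_
    have hj : j < i + 1 := by simp at h1; omega
    rw [List.getElem_take, List.getElem_ofFn]
    rcases Nat.lt_succ_iff_lt_or_eq.1 hj with h | h
    · rw [List.getElem_append_left (by simp; omega), List.getElem_take, List.getElem_ofFn,
        Function.update_of_ne (by simp [Fin.ext_iff]; omega)]
    · subst h
      rw [List.getElem_append_right (by simp)]
      simp
  rw [this, List.map_append]
  rfl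

theorem runs_snoc_prefix {n d : ℕ} (main : Code) (O : Subroutine → Val → Val) (κ : ℕ)
    (x : Outcome n d) (i : Fin n) (a : Fin d) :
    Runs (main :: library) O κ [.cons (prefixVal x i) (.nat a)] Code.snocFn
      (prefixVal (Function.update x i a) (i + 1)) ((n + 1) * unitCost κ) := by
  rw [prefixVal_update, prefixVal_eq]
  refine Runs.mono (runs_snoc main O κ _ _) (Nat.mul_le_mul_right _ ?_)
  simp

/-- The list has k+1 weights but at most k comparisons are made: the last index is returned by
default, as in `pick`. -/
theorem runs_pick (main : Code) (O : Subroutine → Val → Val) (κ : ℕ) (θ : ℂ) (w : ℕ → ℂ) (k a : ℕ) :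
    Runs (main :: library) O κ
      [.cons (.num θ) (.cons (.num (∑ b ∈ Finset.range a, w b)) (.cons (.nat a)
        (Val.ofList ((List.range' a (k + 1)).map fun b => .num (w b)))))] Code.pickFn
      (.nat (pick θ.re w k a)) ((k + 1) * unitCost κ) := by
  have hu : unitCost κ = 500 * (κ + 1) := rfl
  induction k generalizing a with
  | zero =>
    exact Runs.mono (Runs.iteFalse (.pure rfl (by decide) rfl) (.pure rfl (by decide) rfl))
      (by omega)
  | succ k ih =>
    have ih := ih (a + 1)
    rw [Finset.sum_range_succ] at ih
    rw [pick, add_mul (k + 1), Finset.sum_range_succ]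
    split_ifs with h
    · refine Runs.mono (Runs.iteTrue (v := .nat 1) (.pure rfl (by decide) rfl) (by simp)
        (Runs.letIn (.pure rfl (by decide) rfl)
          (Runs.iteTrue (v := .nat 1) (.pure rfl (by decide) ?_) (by simp)
            (.pure rfl (by decide) rfl)))) ?_
      · exact congrArg Val.nat (if_pos h)
      · omega
    · refine Runs.mono (Runs.iteTrue (v := .nat 1) (.pure rfl (by decide) rfl) (by simp)
        (Runs.letIn (.pure rfl (by decide) rfl)
          (Runs.iteFalse (.pure rfl (by decide) ?_)
            (Runs.call (.pure rfl (by decide) rfl) rfl ih)))) ?_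
      · exact congrArg Val.nat (if_neg h)
      · omega

theorem runs_total (main : Code) (O : Subroutine → Val → Val) (κ : ℕ) (w : ℕ → ℂ) (d : ℕ) :
    Runs (main :: library) O κ
      [.cons .nil (Val.ofList ((List.range' 0 d).map fun b => .num (w b)))]
      (Code.sumLoop 15 Code.head) (.num (∑ b ∈ Finset.range d, w b)) ((d + 1) * unitCost κ) := by
  have h : ∑ b ∈ Finset.range d, w b = ((List.range' 0 d).map w).sum := by
    rw [← List.range_eq_range']
    rfl
  rw [h]
  refine Runs.mono (Runs.sumLoop rfl (fun b => .num (w b)) w .nil (50 * (κ + 1)) _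
    fun b _ rest => .pure rfl (by decide) rfl) ?_
  have hu : unitCost κ = 500 * (κ + 1) := rfl
  have := Nat.mul_le_mul_left d (show 50 * (κ + 1) + 16 * (κ + 1) ≤ unitCost κ by omega)
  rw [List.length_range', add_mul]
  omega

namespace NoisyCircuit

variable {G : Type*} [Group G] [TopologicalSpace G] {n d : ℕ} {C : NoisyCircuit G n d}

theorem Subroutines.withRand {D M dmax : ℕ} {g : Fin D → G} {O : Subroutine → Val → Val}
    (hO : C.Subroutines D M dmax g O) (u : Fin n → ℝ) :
    C.Subroutines D M dmax g (withRand O u) where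
  info := hO.info
  expand := hO.expand
  coeff := hO.coeff
  eigen := hO.eigen
  contractBra := hO.contractBra
  contractKet := hO.contractKet
  contractFull := hO.contractFull
  marginal := hO.marginal

/-- Time bound for the choice of one entry. -/
def entryTime (D s dmax n d κ rank L : ℕ) : ℕ :=
  d * (evalTime D s dmax n κ rank L + (n + 3) * unitCost κ) + (d + d + n + 8) * unitCost κ

section Specs

variable {D M s dmax rank L m : ℕ} {g : Fin D → G} {O : Subroutine → Val → Val}

theorem runs_weights {E κ : ℕ} {main : Code} {F : Outcome n d → ℂ}
    (hE : ∀ (x : Outcome n d) (m : ℕ), m ≤ n → Runs (main :: library) O κ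
      [.cons (prefixVal x m) (params n d D L M dmax .nil)] Code.evalFn
      (.num (prefixMarginal F x m)) E)
    (x : Outcome n d) (i : Fin n) (k a : ℕ) (hk : a + k = d) :
    Runs (main :: library) O κ
      [.cons (.cons (params n d D L M dmax .nil) (prefixVal x i)) (.cons (.nat a) (.nat k))]
      Code.weightsFn (Val.ofList ((List.range' a k).map fun b => .num (weight F x i b)))
      (k * (E + (n + 3) * unitCost κ) + unitCost κ) := by
  have hu : unitCost κ = 500 * (κ + 1) := rfl
  induction k generalizing a with
  | zero =>
    exact Runs.mono (Runs.iteFalse (.pure rfl (by decide) rfl) (.pure rfl (by decide) rfl))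
      (by omega)
  | succ k ih =>
    have ha : a < d := by omega
    have ih := ih (a + 1) (by omega)
    have hs := runs_snoc_prefix main O κ x i ⟨a, ha⟩
    have he := hE (Function.update x i ⟨a, ha⟩) (i + 1) i.2
    have hpos : Runs (main :: library) O κ
        [.num (prefixMarginal F (Function.update x i ⟨a, ha⟩) (i + 1)), .cons
          (.cons (params n d D L M dmax .nil) (prefixVal x i)) (.cons (.nat a) (.nat (k + 1)))]
        (.ite (.op2 .ltRe Code.zero (.var 0)) (.var 0) Code.zero) (.num (weight F x i a))
        (101 * (κ + 1)) := by
      rw [weight, dif_pos ha]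
      split_ifs with h
      · refine Runs.mono (Runs.iteTrue (v := .nat 1) (.pure rfl (by decide) ?_) (by simp)
          (.pure rfl (by decide) rfl)) (by omega)
        simp [Code.val, Op1.run, Op2.run, h]
      · refine Runs.mono (Runs.iteFalse (.pure rfl (by decide) ?_) Runs.zero) (by omega)
        simp [Code.val, Op1.run, Op2.run, h]
    refine Runs.mono (Runs.iteTrue (v := .nat (k + 1)) (.pure rfl (by decide) rfl) (by simp)
      (Runs.op2 .cons
        (Runs.letIn (Runs.call (Runs.op2 .cons (Runs.call (.pure rfl (by decide) rfl) rfl hs)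
          (.pure rfl (by decide) rfl)) rfl he) hpos)
        (Runs.call (.pure rfl (by decide) rfl) rfl ih))) ?_
    rw [add_mul k, add_mul n 3, add_mul n 1]
    omega

variable [NeZero d]

theorem runs_sample {E κ : ℕ} {main : Code} {F : Outcome n d → ℂ} {u : Fin n → ℝ}
    (hu : ∀ i : Fin n, O .rand (.nat i) = .num (u i))
    (hE : ∀ (x : Outcome n d) (m : ℕ), m ≤ n → Runs (main :: library) O κ
      [.cons (prefixVal x m) (params n d D L M dmax .nil)] Code.evalFn
      (.num (prefixMarginal F x m)) E)
    (k i : ℕ) (hk : i + k = n) :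
    Runs (main :: library) O κ
      [.cons (params n d D L M dmax .nil) (.cons (.nat i) (prefixVal (stage F u i) i))]
      Code.sampleFn (prefixVal (stage F u n) n)
      (k * (d * (E + (n + 3) * unitCost κ) + (d + d + n + 8) * unitCost κ) + unitCost κ) := by
  have hc : unitCost κ = 500 * (κ + 1) := rfl
  induction k generalizing i with
  | zero =>
    obtain rfl : i = n := by omega
    refine Runs.mono (Runs.iteFalse (.pure rfl (by decide) ?_) (.pure rfl (by decide) rfl))
      (by omega)
    exact congrArg Val.nat (if_neg (lt_irrefl _))
  | succ k ih =>
    have hi : i < n := by omega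
    have ih := ih (i + 1) (by omega)
    have hd : d - 1 + 1 = d := Nat.sub_add_cancel (NeZero.pos d)
    set x := stage F u i with hx
    have hw := runs_weights hE x ⟨i, hi⟩ d 0 (zero_add d)
    have ht := runs_total main O κ (weight F x ⟨i, hi⟩) d
    have hp := runs_pick main O κ (u ⟨i, hi⟩ * ∑ b ∈ Finset.range d, weight F x ⟨i, hi⟩ b)
      (weight F x ⟨i, hi⟩) (d - 1) 0
    rw [hd, Finset.sum_range_zero] at hp
    have hs := runs_snoc_prefix main O κ x ⟨i, hi⟩ (choice F x ⟨i, hi⟩ (u ⟨i, hi⟩))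
    have hst : stage F u (i + 1) =
        Function.update x ⟨i, hi⟩ (choice F x ⟨i, hi⟩ (u ⟨i, hi⟩)) := by
      rw [stage, dif_pos hi]
    rw [hst] at ih
    refine Runs.mono (Runs.iteTrue (v := .nat 1) (.pure rfl (by decide)
        (congrArg Val.nat (if_pos hi))) (by simp)
      (Runs.letIn (Runs.call (.pure rfl (by decide) rfl) rfl hw)
        (Runs.letIn (Runs.mul (.pure rfl (by decide) (hu ⟨i, hi⟩))
          (Runs.call (.pure rfl (by decide) rfl) rfl ht))
          (Runs.call (Runs.op2 .cons (.pure rfl (by decide) rfl)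
            (Runs.op2 .cons (.pure rfl (by decide) rfl)
              (Runs.call (Runs.op2 .cons (.pure rfl (by decide) rfl)
                (Runs.call (Runs.op2 .cons (.pure rfl (by decide) rfl)
                  (Runs.op2 .cons Runs.zero (.pure rfl (by decide) rfl))) rfl hp)) rfl hs)))
            rfl ih)))) ?_
    simp only [add_mul, mul_add] at *
    omega

/-- The sampler draws from the distribution of the staged choices. -/
theorem runsWithin_sampler {γ : ℝ} (hO : C.Subroutines D M dmax g O)
    (hs : C.SparseContractions D s) (κ : ℕ) (hC : C.ControlledGrowth D) (hs1 : 1 ≤ s)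
    (hw : C.ContractibleWindows D M rank) (hD : (M + 2) * (L + 1) ≤ D)
    (hdim : C.IrrepDimBound D L dmax) (hγ : C.NoisePenalised D γ) (h1 : 1 ≤ dmax)
    (u : Fin n → ℝ) :
    RunsWithin samplerProgram (withRand O u) κ
      (Val.ofList [.nat n, .nat d, .nat D, .nat L, .nat M, .nat dmax])
      (prefixVal (stage (C.pNoisyTrunc L g) u n) n)
      (n * entryTime D s dmax n d κ rank L + 2 * unitCost κ) := by
  have hc : unitCost κ = 500 * (κ + 1) := rfl
  refine Runs.mono (Runs.call (.pure rfl (by decide) rfl) rfl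
    (Runs.call (.pure rfl (by decide) rfl) rfl
      (runs_sample (L := L) (M := M) (dmax := dmax) (D := D) (u := u) (F := C.pNoisyTrunc L g)
        (fun i => ?_) (fun x m hm => runs_eval (hO.withRand u) hs _ κ x .nil hC hs1 hm hw hD hdim
          hγ h1) n 0 (zero_add n)))) ?_
  · exact dif_pos i.2
  · rw [← entryTime]
    omega

end Specs
end NoisyCircuit

namespace NoisyCircuit

/-! ### Asymptotics of the running time -/

section ClosedForm

variable (D s dmax n d κ rank L : ℕ)

/-- With S = s·dmax the recursion reads T(w+1) ≤ S·A + S·T(w); the factor 2 in the base absorbs the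
additive term. -/
theorem fwdTime_le (hs : 1 ≤ s) (hd : 1 ≤ dmax) (w : ℕ) : fwdTime D s dmax n κ w ≤
    (n + 4 * D + 14) * unitCost κ * (2 * (s * dmax)) ^ (w + 1) := by
  have hS : s ≤ s * dmax := Nat.le_mul_of_pos_right _ hd
  have hS1 : 1 ≤ s * dmax := hs.trans hS
  generalize hu : unitCost κ = u
  induction w with
  | zero =>
    rw [fwdTime, endTime, hu]
    have : 2 * s + n + 4 ≤ (n + 4 * D + 14) * (2 * (s * dmax)) := by nlinarith
    calc (2 * s + n + 4) * u ≤ (n + 4 * D + 14) * (2 * (s * dmax)) * u := Nat.mul_le_mul_right _ this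
      _ = _ := by ring
  | succ w ih =>
    rw [fwdTime, endTime, hu]
    set A := (n + 4 * D + 14) * u with hA
    set X := A * (2 * (s * dmax)) ^ (w + 1) with hX
    have hAX : A ≤ X := Nat.le_mul_of_pos_right _ (by positivity)
    have h1 : (2 * s + n + 4) + 2 + 4 * s + s * dmax * (2 + 2 * D) ≤
        s * dmax * (n + 4 * D + 14) := by nlinarith
    calc (2 * s + n + 4) * u + 2 * u + s * (4 * u + dmax * (2 * u + 2 * D * u +
          fwdTime D s dmax n κ w))
        = ((2 * s + n + 4) + 2 + 4 * s + s * dmax * (2 + 2 * D)) * u +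
          s * dmax * fwdTime D s dmax n κ w := by ring
      _ ≤ s * dmax * (n + 4 * D + 14) * u + s * dmax * X :=
          Nat.add_le_add (Nat.mul_le_mul_right _ h1) (Nat.mul_le_mul_left _ ih)
      _ = s * dmax * A + s * dmax * X := by rw [hA]; ring
      _ ≤ s * dmax * X + s * dmax * X := Nat.add_le_add_right (Nat.mul_le_mul_left _ hAX) _
      _ = _ := by rw [hX]; ring

/-- In units of S times the previous bound, the overhead costs 1, the forward scan 2 and the
recursion 1; hence the base 4S. -/
theorem backTime_le (hs : 1 ≤ s) (hd : 1 ≤ dmax) (w : ℕ) : backTime D s dmax n κ w ≤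
    (n + 4 * D + 14) * unitCost κ * (4 * (s * dmax)) ^ (w + 1) := by
  have hS : s ≤ s * dmax := Nat.le_mul_of_pos_right _ hd
  have hS1 : 1 ≤ s * dmax := hs.trans hS
  have hf := fwdTime_le D s dmax n κ hs hd
  generalize hu : unitCost κ = u at hf
  induction w with
  | zero =>
    have hf := hf 0
    rw [backTime, endTime, hu]
    have : 2 * s + n + 4 + 2 * D ≤ (n + 4 * D + 14) * (2 * (s * dmax)) := by nlinarith
    calc (2 * s + n + 4) * u + 2 * D * u + fwdTime D s dmax n κ 0
        ≤ (2 * s + n + 4 + 2 * D) * u + (n + 4 * D + 14) * u * (2 * (s * dmax)) ^ (0 + 1) := by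
          rw [← add_mul]; exact Nat.add_le_add_left hf _
      _ ≤ (n + 4 * D + 14) * (2 * (s * dmax)) * u +
          (n + 4 * D + 14) * u * (2 * (s * dmax)) ^ (0 + 1) :=
          Nat.add_le_add_right (Nat.mul_le_mul_right _ this) _
      _ = _ := by ring
  | succ w ih =>
    have hf := hf (w + 1)
    rw [backTime, endTime, hu]
    set A := (n + 4 * D + 14) * u with hA
    set X := A * (4 * (s * dmax)) ^ (w + 1) with hX
    have hAX : A ≤ X := Nat.le_mul_of_pos_right _ (by positivity)
    have hfX : A * (2 * (s * dmax)) ^ (w + 1 + 1) ≤ 2 * (s * dmax) * X := by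
      rw [hX, pow_succ (2 * (s * dmax))]
      have := Nat.mul_le_mul_left (A * (2 * (s * dmax))) (Nat.pow_le_pow_left
        (show 2 * (s * dmax) ≤ 4 * (s * dmax) by omega) (w + 1))
      linarith
    have h1 : (2 * s + n + 4) + 2 * D + 2 + 4 * s + s * dmax * (2 + 2 * D) ≤
        s * dmax * (n + 4 * D + 14) := by nlinarith
    calc (2 * s + n + 4) * u + 2 * D * u + fwdTime D s dmax n κ (w + 1) + 2 * u +
          s * (4 * u + dmax * (2 * u + 2 * D * u + backTime D s dmax n κ w))
        = ((2 * s + n + 4) + 2 * D + 2 + 4 * s + s * dmax * (2 + 2 * D)) * u +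
          fwdTime D s dmax n κ (w + 1) + s * dmax * backTime D s dmax n κ w := by ring
      _ ≤ s * dmax * (n + 4 * D + 14) * u + 2 * (s * dmax) * X + s * dmax * X :=
          Nat.add_le_add (Nat.add_le_add (Nat.mul_le_mul_right _ h1) (hf.trans hfX))
            (Nat.mul_le_mul_left _ ih)
      _ = s * dmax * A + 2 * (s * dmax) * X + s * dmax * X := by rw [hA]; ring
      _ ≤ s * dmax * X + 2 * (s * dmax) * X + s * dmax * X := by
          have := Nat.mul_le_mul_left (s * dmax) hAX
          omega
      _ = _ := by rw [hX]; ring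

theorem evalTime_le (hs : 1 ≤ s) (hd : 1 ≤ dmax) : evalTime D s dmax n κ rank L ≤
    (D + 1) * (2 * rank + 1) * ((n + 4 * D + 14) * unitCost κ * (4 * (s * dmax)) ^ (L + 1)) := by
  have hb := backTime_le D s dmax n κ hs hd L
  have hS1 : 1 ≤ s * dmax := Nat.mul_pos hs hd
  set Y := (n + 4 * D + 14) * unitCost κ * (4 * (s * dmax)) ^ (L + 1) with hY
  have hA : (n + 4 * D + 14) * unitCost κ ≤ Y := Nat.le_mul_of_pos_right _ (by positivity)
  rw [evalTime, mul_assoc (D + 1)]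
  refine Nat.mul_le_mul_left _ ?_
  generalize unitCost κ = u at *
  have h1 : 2 * u + 2 * D * u ≤ Y := le_trans (by nlinarith) hA
  have h2 : 3 * u ≤ Y := le_trans (by nlinarith) hA
  calc rank * (2 * u + 2 * D * u + backTime D s dmax n κ L) + 3 * u ≤
        rank * (Y + Y) + Y := Nat.add_le_add (Nat.mul_le_mul_left _ (Nat.add_le_add h1 hb)) h2
    _ = _ := by ring

/-- Time bound for both programs. -/
def totalTime : ℕ :=
  n * entryTime D s dmax n d κ rank L + evalTime D s dmax n κ rank L + 2 * unitCost κ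

theorem totalTime_le (hs : 1 ≤ s) (hd : 1 ≤ dmax) : totalTime D s dmax n d κ rank L ≤
    (n * (d * ((D + 1) * (2 * rank + 1) + 1) + (2 * d + 1)) + (D + 1) * (2 * rank + 1) + 2) *
      ((n + 4 * D + 14) * unitCost κ * (4 * (s * dmax)) ^ (L + 1)) := by
  have he := evalTime_le D s dmax n κ rank L hs hd
  have hS1 : 1 ≤ s * dmax := Nat.mul_pos hs hd
  rw [totalTime, entryTime]
  set Y := (n + 4 * D + 14) * unitCost κ * (4 * (s * dmax)) ^ (L + 1) with hY
  have hA : (n + 4 * D + 14) * unitCost κ ≤ Y := Nat.le_mul_of_pos_right _ (by positivity)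
  set E := (D + 1) * (2 * rank + 1)
  generalize unitCost κ = u at *
  generalize evalTime D s dmax n κ rank L = e at *
  have h1 : (n + 3) * u ≤ Y := le_trans (Nat.mul_le_mul_right _ (by omega)) hA
  have h2 : (n + 8) * u ≤ Y := le_trans (Nat.mul_le_mul_right _ (by omega)) hA
  have h3 : u ≤ Y := le_trans (by nlinarith) hA
  have h4 : (d + d + n + 8) * u ≤ (2 * d + 1) * Y := by
    have := Nat.mul_le_mul_left (2 * d) h3
    linarith
  calc n * (d * (e + (n + 3) * u) + (d + d + n + 8) * u) + e + 2 * u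
      ≤ n * (d * (E * Y + Y) + (2 * d + 1) * Y) + E * Y + 2 * Y := by gcongr
    _ = _ := by ring

end ClosedForm

/-- The factor of the time bound that does not depend on the truncation is polynomial. -/
theorem totalTime_le_of_poly {D s dmax n d κ rank L a : ℕ} (hn : 1 ≤ n) (hs : 1 ≤ s)
    (hd : 1 ≤ dmax) (hD : D ≤ a * n ^ a) (hκ : κ ≤ a * n ^ a) (hr : rank ≤ a * n ^ a) :
    totalTime D s dmax n d κ rank L ≤
      (d * ((a + 1) * (2 * a + 1) + 1) + (2 * d + 1) + (a + 1) * (2 * a + 1) + 2) *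
        ((15 + 4 * a) * (500 * (a + 1))) * n ^ (5 * (a + 1)) * (4 * (s * dmax)) ^ (L + 1) := by
  refine (totalTime_le D s dmax n d κ rank L hs hd).trans ?_
  have hN : n ^ a ≤ n ^ (a + 1) := Nat.pow_le_pow_right hn (Nat.le_succ a)
  have hnN : n ≤ n ^ (a + 1) := Nat.le_self_pow (Nat.succ_ne_zero a) n
  -- N = n^(a+1) dominates n and n^a. Five factors are linear in N: n, the depth, the rank, n+4D+14
  -- and the unit cost.
  rw [show n ^ (5 * (a + 1)) = (n ^ (a + 1)) ^ 5 by rw [← pow_mul, mul_comm]]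
  generalize n ^ (a + 1) = N at *
  have h1 : 1 ≤ N := hn.trans hnN
  have hD : D + 1 ≤ (a + 1) * N := by nlinarith [Nat.mul_le_mul_left a hN]
  have hr : 2 * rank + 1 ≤ (2 * a + 1) * N := by nlinarith [Nat.mul_le_mul_left a hN]
  have hu : unitCost κ ≤ 500 * (a + 1) * N := by
    unfold unitCost
    nlinarith [Nat.mul_le_mul_left a hN]
  have hA : n + 4 * D + 14 ≤ (15 + 4 * a) * N := by nlinarith [Nat.mul_le_mul_left a hN]
  have hE : (D + 1) * (2 * rank + 1) ≤ (a + 1) * (2 * a + 1) * N ^ 2 := by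
    calc _ ≤ (a + 1) * N * ((2 * a + 1) * N) := Nat.mul_le_mul hD hr
      _ = _ := by ring
  have h2 : 1 ≤ N ^ 2 := Nat.one_le_pow _ _ h1
  have h23 : N ^ 2 ≤ N ^ 3 := Nat.pow_le_pow_right h1 (by norm_num)
  have h3 : 1 ≤ N ^ 3 := h2.trans h23
  generalize (D + 1) * (2 * rank + 1) = E at *
  have hE3 : E ≤ (a + 1) * (2 * a + 1) * N ^ 3 := hE.trans (Nat.mul_le_mul_left _ h23)
  calc _ ≤ (N * (d * ((a + 1) * (2 * a + 1) * N ^ 2 + 1 * N ^ 2) + (2 * d + 1) * N ^ 2) +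
        (a + 1) * (2 * a + 1) * N ^ 3 + 2 * N ^ 3) *
        ((15 + 4 * a) * N * (500 * (a + 1) * N) * (4 * (s * dmax)) ^ (L + 1)) := by
        gcongr
        · omega
        · exact Nat.le_mul_of_pos_right _ h2
        · omega
    _ = _ := by ring

theorem pow_ceil_le {S : ℕ} {Z y : ℝ} (hZ : 1 ≤ Z) (hS : (4 * S : ℝ) ≤ Z) (hy : 0 ≤ y) :
    (4 * S : ℝ) ^ (⌈y⌉₊ + 1) ≤ Z ^ 2 * Z ^ y := by
  have hL : ((⌈y⌉₊ + 1 : ℕ) : ℝ) ≤ 2 + y := by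
    have := (Nat.ceil_lt_add_one hy).le
    push_cast
    linarith
  calc (4 * S : ℝ) ^ (⌈y⌉₊ + 1) ≤ Z ^ (⌈y⌉₊ + 1) := pow_le_pow_left₀ (by positivity) hS _
    _ = Z ^ ((⌈y⌉₊ + 1 : ℕ) : ℝ) := (Real.rpow_natCast _ _).symm
    _ ≤ Z ^ (2 + y) := Real.rpow_le_rpow_of_exponent_le hZ hL
    _ = Z ^ 2 * Z ^ y := by
      rw [Real.rpow_add (by linarith)]
      norm_num

/-- Since ε ≤ 1/2, log(1/ε) is at least log 2, so the constant log K is absorbed into a multiple of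
it. -/
theorem log_div_le {K ε : ℝ} (hK : 1 ≤ K) (hε : 0 < ε) (hε2 : ε ≤ 1 / 2) :
    Real.log (K / ε) ≤ (1 + Real.log K / Real.log 2) * Real.log (1 / ε) := by
  have h2 : 0 < Real.log 2 := Real.log_pos (by norm_num)
  have h3 : Real.log 2 ≤ Real.log (1 / ε) :=
    Real.log_le_log (by norm_num) (by rw [le_div_iff₀ hε]; linarith)
  have hlK := Real.log_nonneg hK
  rw [div_eq_mul_one_div, Real.log_mul (by positivity) (by positivity), add_mul, one_mul, add_comm]
  refine add_le_add_right ?_ _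
  rw [div_mul_eq_mul_div, le_div_iff₀ h2]
  exact mul_le_mul_of_nonneg_left h3 hlK

theorem exists_time_bound (d a B : ℕ) (K : ℝ) (hK : 1 ≤ K) : ∃ c : ℕ, 0 < c ∧
    ∀ (n D s dmax rank κ : ℕ) (r ε : ℝ), 3 ≤ n → 0 < ε → ε ≤ 1 / 2 → 0 < r →
      D ≤ a * n ^ a → κ ≤ a * n ^ a → rank ≤ a * n ^ a → 1 ≤ s → 1 ≤ dmax →
      (s ≤ B → dmax ≤ B →
        (totalTime D s dmax n d κ rank ⌈Real.log (K / ε) / r⌉₊ : ℝ) ≤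
          c * (n : ℝ) ^ c * ((c : ℝ) / ε) ^ ((c : ℝ) / r)) ∧
      (s * dmax ≤ B * n ^ B →
        (totalTime D s dmax n d κ rank ⌈Real.log (K / ε) / r⌉₊ : ℝ) ≤
          c * (n : ℝ) ^ c * (n : ℝ) ^ ((c : ℝ) * Real.log (1 / ε) / r)) ∧
      ((s : ℝ) * dmax ≤ B * Real.log n →
        (totalTime D s dmax n d κ rank ⌈Real.log (K / ε) / r⌉₊ : ℝ) ≤
          c * (n : ℝ) ^ c * Real.log n ^ ((c : ℝ) * Real.log (1 / ε) / r)) := by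
  have hlog3 : 1 < Real.log 3 := by
    rw [Real.lt_log_iff_exp_lt (by norm_num)]
    exact Real.exp_one_lt_d9.trans (by norm_num)
  -- As log 3 > 1, a fixed power of log n exceeds 4B for all n ≥ 3; this supplies the base in the
  -- logarithmic regime.
  obtain ⟨m, hm⟩ := pow_unbounded_of_one_lt (4 * B : ℝ) hlog3
  set C₁ := (d * ((a + 1) * (2 * a + 1) + 1) + (2 * d + 1) + (a + 1) * (2 * a + 1) + 2) *
    ((15 + 4 * a) * (500 * (a + 1))) with hC₁
  set e := 5 * (a + 1) with he
  set h : ℕ := ⌈1 + Real.log K / Real.log 2⌉₊ with hh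
  -- One constant for all regimes, the sum of what each requires; the last groups are 2b + b·h for
  -- the exponents b = 5B and b = m+1.
  set c : ℕ := C₁ * (4 * B * B + 1) ^ 2 + e + ⌈K⌉₊ + 4 * B * B + (10 * B + 5 * B * h) +
    (2 * (m + 1) + (m + 1) * h) + 1 with hc
  refine ⟨c, Nat.succ_pos _, fun n D s dmax rank κ r ε hn hε hε2 hr hD hκ hrank hs hd => ?_⟩
  have ht : (totalTime D s dmax n d κ rank ⌈Real.log (K / ε) / r⌉₊ : ℝ) ≤
      C₁ * (n : ℝ) ^ e * (4 * ((s * dmax : ℕ) : ℝ)) ^ (⌈Real.log (K / ε) / r⌉₊ + 1) := by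
    exact_mod_cast totalTime_le_of_poly (L := ⌈Real.log (K / ε) / r⌉₊) (d := d) (by omega) hs hd
      hD hκ hrank
  have hKε : 1 ≤ K / ε := by
    rw [le_div_iff₀ hε]
    linarith
  have hy : 0 ≤ Real.log (K / ε) / r := div_nonneg (Real.log_nonneg hKε) hr.le
  have hC₁c : C₁ ≤ c := by
    have : C₁ * 1 ≤ C₁ * (4 * B * B + 1) ^ 2 := Nat.mul_le_mul_left _ (Nat.one_le_pow _ _ (by omega))
    omega
  have hn1 : (1 : ℝ) ≤ n := by exact_mod_cast (by omega : 1 ≤ n)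
  have hlogε : 0 ≤ Real.log (1 / ε) := Real.log_nonneg (by rw [le_div_iff₀ hε]; linarith)
  have hlogK : Real.log (K / ε) ≤ h * Real.log (1 / ε) :=
    (log_div_le hK hε hε2).trans (mul_le_mul_of_nonneg_right (Nat.le_ceil _) hlogε)
  -- a base that is a power of `X`, for which `X ^ (2 * b)` is at most polynomial
  have key : ∀ (X : ℝ) (b : ℕ), 1 ≤ X → X ≤ n → (4 * ((s * dmax : ℕ) : ℝ)) ≤ X ^ b →
      e + 2 * b ≤ c → b * h ≤ c →
      (totalTime D s dmax n d κ rank ⌈Real.log (K / ε) / r⌉₊ : ℝ) ≤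
        c * (n : ℝ) ^ c * X ^ ((c : ℝ) * Real.log (1 / ε) / r) := by
    intro X b hX hXn hS hb hbh
    have h1 := pow_ceil_le (one_le_pow₀ hX) hS hy
    have h2 : (X ^ b) ^ (Real.log (K / ε) / r) ≤ X ^ ((c : ℝ) * Real.log (1 / ε) / r) := by
      rw [← Real.rpow_natCast, ← Real.rpow_mul (by linarith)]
      refine Real.rpow_le_rpow_of_exponent_le hX ?_
      rw [← mul_div_assoc]
      refine div_le_div_of_nonneg_right ?_ hr.le
      calc (b : ℝ) * Real.log (K / ε) ≤ b * (h * Real.log (1 / ε)) :=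
            mul_le_mul_of_nonneg_left hlogK (Nat.cast_nonneg _)
        _ = ((b * h : ℕ) : ℝ) * Real.log (1 / ε) := by push_cast; ring
        _ ≤ _ := mul_le_mul_of_nonneg_right (Nat.cast_le.2 hbh) hlogε
    have h3 : (X ^ b) ^ 2 ≤ (n : ℝ) ^ (2 * b) := by
      rw [← pow_mul, mul_comm b]
      exact pow_le_pow_left₀ (by linarith) hXn _
    have hX0 : 0 < X := by linarith
    calc _ ≤ C₁ * (n : ℝ) ^ e * ((X ^ b) ^ 2 * (X ^ b) ^ (Real.log (K / ε) / r)) :=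
          ht.trans (mul_le_mul_of_nonneg_left h1 (by positivity))
      _ ≤ C₁ * (n : ℝ) ^ e * ((n : ℝ) ^ (2 * b) * X ^ ((c : ℝ) * Real.log (1 / ε) / r)) := by
          gcongr
      _ = C₁ * (n : ℝ) ^ (e + 2 * b) * X ^ ((c : ℝ) * Real.log (1 / ε) / r) := by ring
      _ ≤ _ := by
          gcongr
  refine ⟨fun hsB hdB => ?_, fun hS => ?_, fun hS => ?_⟩
  · have hB : 1 ≤ B := hs.trans hsB
    have hBB : 1 ≤ B * B := Nat.mul_pos hB hB
    have hZ : (1 : ℝ) ≤ (4 * B * B : ℕ) := by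
      exact_mod_cast (by rw [mul_assoc]; omega : 1 ≤ 4 * B * B)
    have hS : (4 * ((s * dmax : ℕ) : ℝ)) ≤ (4 * B * B : ℕ) := by
      have := Nat.mul_le_mul hsB hdB
      exact_mod_cast (by rw [mul_assoc]; omega : 4 * (s * dmax) ≤ 4 * B * B)
    have h1 := pow_ceil_le hZ hS hy
    have hKc : K ≤ c := (Nat.le_ceil K).trans (Nat.cast_le.2 (by omega))
    have hcε : 1 ≤ (c : ℝ) / ε := hKε.trans (div_le_div_of_nonneg_right hKc hε.le)
    have hZc : Real.log (4 * B * B : ℕ) ≤ c :=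
      (Real.log_le_self (by linarith)).trans (Nat.cast_le.2 (by omega))
    have h2 : ((4 * B * B : ℕ) : ℝ) ^ (Real.log (K / ε) / r) ≤ ((c : ℝ) / ε) ^ ((c : ℝ) / r) := by
      -- Base and exponent trade places, Z^(log y) = y^(log Z): a constant base to the power
      -- log(K/ε)/r becomes a power of 1/ε with exponent O(1/r).
      rw [Real.rpow_def_of_pos (by linarith), Real.rpow_def_of_pos (by linarith)]
      refine Real.exp_le_exp.2 ?_
      have h3 : Real.log (K / ε) ≤ Real.log (c / ε) :=
        Real.log_le_log (by linarith) (div_le_div_of_nonneg_right hKc hε.le)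
      rw [← mul_div_assoc, ← mul_div_assoc, mul_comm (Real.log _)]
      refine div_le_div_of_nonneg_right ?_ hr.le
      exact mul_le_mul h3 hZc (Real.log_nonneg hZ) (Real.log_nonneg hcε)
    have h4 : C₁ * (4 * B * B) ^ 2 ≤ c := by
      have : C₁ * (4 * B * B) ^ 2 ≤ C₁ * (4 * B * B + 1) ^ 2 :=
        Nat.mul_le_mul_left _ (Nat.pow_le_pow_left (Nat.le_succ _) _)
      omega
    calc _ ≤ C₁ * (n : ℝ) ^ e *
          (((4 * B * B : ℕ) : ℝ) ^ 2 * ((4 * B * B : ℕ) : ℝ) ^ (Real.log (K / ε) / r)) :=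
          ht.trans (mul_le_mul_of_nonneg_left h1 (by positivity))
      _ ≤ C₁ * (n : ℝ) ^ e * (((4 * B * B : ℕ) : ℝ) ^ 2 * ((c : ℝ) / ε) ^ ((c : ℝ) / r)) := by
          gcongr
      _ = ((C₁ * (4 * B * B) ^ 2 : ℕ) : ℝ) * (n : ℝ) ^ e * ((c : ℝ) / ε) ^ ((c : ℝ) / r) := by
          push_cast
          ring
      _ ≤ _ := by
          gcongr
          omega
  · refine key n (5 * B) hn1 le_rfl ?_ (by omega) (by omega)
    have h1 : 4 * B ≤ n ^ (4 * B) :=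
      Nat.lt_two_pow_self.le.trans (Nat.pow_le_pow_left (by omega) _)
    have h2 : 4 * (s * dmax) ≤ n ^ (5 * B) := by
      calc 4 * (s * dmax) ≤ 4 * (B * n ^ B) := Nat.mul_le_mul_left _ hS
        _ = 4 * B * n ^ B := by ring
        _ ≤ n ^ (4 * B) * n ^ B := Nat.mul_le_mul_right _ h1
        _ = n ^ (5 * B) := by rw [← pow_add]; congr 1; ring
    exact_mod_cast h2
  · have hl : Real.log 3 ≤ Real.log n :=
      Real.log_le_log (by norm_num) (by exact_mod_cast hn)
    refine key (Real.log n) (m + 1) (by linarith) (Real.log_le_self (by linarith)) ?_ (by omega)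
      (by omega)
    have h1 : (4 * B : ℝ) ≤ Real.log n ^ m :=
      hm.le.trans (pow_le_pow_left₀ (by linarith) hl _)
    push_cast
    calc 4 * ((s : ℝ) * dmax) ≤ 4 * B * Real.log n := by linarith
      _ ≤ Real.log n ^ m * Real.log n := mul_le_mul_of_nonneg_right h1 (by linarith)
      _ = _ := (pow_succ _ _).symm

end NoisyCircuit

end TruncSim

end

/-! ### The main theorem, with one time bound serving both programs. -/

theorem mainTheorem3 :
    ∃ evaluator sampler : Program,
    ∀ (d : ℕ) [NeZero d] (a B : ℕ) (K : ℝ), 1 ≤ K →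
    ∃ c : ℕ, 0 < c ∧
    ∀ (G : Type*) [Group G] [TopologicalSpace G] [IsTopologicalGroup G] [CompactSpace G]
      [MeasurableSpace G] [BorelSpace G] (μ : Measure G) [μ.IsHaarMeasure] [IsProbabilityMeasure μ]
      (n D M s dmax rank κ : ℕ) (C : NoisyCircuit G n d) (γ r ε : ℝ)
      (O : (Fin D → G) → Subroutine → Val → Val) (L : ℕ),
      3 ≤ n → 0 < ε → ε ≤ 1 / 2 → 0 < γ → γ ≤ 1 →
      -- the rate: the spectral gap, or its tightened form
      (r = γ ∨ (γ < 1 ∧ r = Real.log (1 / (1 - γ)))) →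
      -- the truncation parameter
      L = ⌈Real.log (K / ε) / r⌉₊ →
      -- polynomially bounded depth, subroutine costs and window rank
      D ≤ a * n ^ a → κ ≤ a * n ^ a → rank ≤ a * n ^ a →
      1 ≤ s → 1 ≤ dmax →
      C.IrrepDimBound D L dmax →
      C.ControlledGrowth D →
      C.SparseContractions D s →
      C.NoisePenalised D γ →
      C.ContractibleWindows D M rank → (M + 2) * (L + 1) ≤ D →
      (∀ g, C.Subroutines D M dmax g (O g)) →
      -- anti-concentration of the noiseless residual
      (∑ x, ∫ g, ‖(C.p g x : ℂ) - C.pTrunc L g x‖ ^ 2 ∂(Measure.pi fun _ : Fin D => μ)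
        ≤ K / (d : ℝ) ^ n) →
      -- the error, in `ℓ¹(L²)` and in mean square of the `ℓ¹` distance
      (∑ x, Real.sqrt (∫ g, ‖(C.pNoisy g x : ℂ) - C.pNoisyTrunc L g x‖ ^ 2
          ∂(Measure.pi fun _ : Fin D => μ)) ≤ ε) ∧
      (∫ g, (∑ x, ‖(C.pNoisy g x : ℂ) - C.pNoisyTrunc L g x‖) ^ 2
          ∂(Measure.pi fun _ : Fin D => μ) ≤ ε ^ 2) ∧
      ∃ t : ℕ,
        -- the truncated distribution and its marginals are computed in `t` steps
        (∀ (g : Fin D → G) (x : Outcome n d), ∀ m ≤ n,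
          RunsWithin evaluator (O g) κ
            (Val.ofList [.nat n, .nat d, .nat D, .nat L, .nat M, .nat dmax, prefixVal x m])
            (.num (prefixMarginal (C.pNoisyTrunc L g) x m)) t) ∧
        -- a sample is drawn in `t` steps from `n` uniform reals
        (∀ g : Fin D → G, ∃ out : (Fin n → ℝ) → Outcome n d,
          (∀ x, MeasurableSet {u | out u = x}) ∧
          (∀ u : Fin n → ℝ, (∀ i, u i ∈ Set.Icc (0 : ℝ) 1) →
            RunsWithin sampler (withRand (O g) u) κ
              (Val.ofList [.nat n, .nat d, .nat D, .nat L, .nat M, .nat dmax])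
              (prefixVal (out u) n) t) ∧
          ∑ x, |C.pNoisy g x - (volume {u : Fin n → ℝ |
              (∀ i, u i ∈ Set.Icc (0 : ℝ) 1) ∧ out u = x}).toReal|
            ≤ 2 * ∑ x, ‖(C.pNoisy g x : ℂ) - C.pNoisyTrunc L g x‖) ∧
        -- the running time
        (s ≤ B → dmax ≤ B →
          (t : ℝ) ≤ c * (n : ℝ) ^ c * ((c : ℝ) / ε) ^ ((c : ℝ) / r)) ∧
        (s * dmax ≤ B * n ^ B →
          (t : ℝ) ≤ c * (n : ℝ) ^ c * (n : ℝ) ^ ((c : ℝ) * Real.log (1 / ε) / r)) ∧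
        ((s : ℝ) * dmax ≤ B * Real.log n →
          (t : ℝ) ≤ c * (n : ℝ) ^ c * Real.log n ^ ((c : ℝ) * Real.log (1 / ε) / r)) := by
  refine ⟨evaluatorProgram, samplerProgram, fun d _ a B K hK => ?_⟩
  obtain ⟨c, hc, hbound⟩ := NoisyCircuit.exists_time_bound d a B K hK
  refine ⟨c, hc, ?_⟩
  intro G _ _ _ _ _ _ μ _ _ n D M s dmax rank κ C γ r ε O L hn hε hε2 hγ0 hγ1 hr hL hD hκ hrank hs
    hdmax hdim hgrowth hsparse hnoise hwin hML hO hanti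
  subst hL
  obtain ⟨herr, herr2⟩ := C.error_bounds μ _ hγ0 hγ1 hnoise hε (damping_le hγ0 hγ1 hK hε hr) hanti
  refine ⟨herr, herr2, NoisyCircuit.totalTime D s dmax n d κ rank _, ?_, ?_,
    hbound n D s dmax rank κ r ε hn hε hε2 (rate_pos hγ0 hr) hD hκ hrank hs hdmax⟩
  · intro g x m hm
    refine Runs.mono (NoisyCircuit.runsWithin_evaluator (hO g) hsparse κ x hgrowth hs hm hwin hML
      hdim hnoise hdmax) ?_
    rw [NoisyCircuit.totalTime]
    omega
  · intro g
    refine ⟨fun u => stage (C.pNoisyTrunc ⌈Real.log (K / ε) / r⌉₊ g) u n, measurableSet_stage, fun u _ => ?_, ?_⟩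
    · refine Runs.mono (NoisyCircuit.runsWithin_sampler (hO g) hsparse κ hgrowth hs hwin hML hdim
        hnoise hdmax u) ?_
      rw [NoisyCircuit.totalTime]
      omega
    · exact sum_abs_sub_outProb_le (C.sum_pNoisyTrunc hdim hnoise hdmax g) (C.pNoisy_nonneg g)
        (C.sum_pNoisy g)
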